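/- Let $n\ge 2$ and $m\ge 8(n-1)$ be integers. For every real $\lambda\ge 1$ there is a smooth Riemannian metric $g_\lambda$ on the sphere $S^{m+n}$ with $\mathrm{Ric}(g_\lambda)\ge 1$ (that is, $\mathrm{Ric}(v,v)\ge g_\lambda(v,v)$ for all tangent vectors $v$) which is the doubly warped product $$g_\lambda=dr^2+f_\lambda(r)^2\,ds_m^2+h_\lambda(r)^2\,ds_{n-1}^2,\qquad f_\lambda(r)=\frac{\sin r}{(1+\lambda^2\sin^2 r)^{1/4}},\quad h_\lambda(r)=\Big(\frac1{\lambda^2}+\tan^2 r\Big)^{-1/2},$$ in the coordinates $(0,\pi/2)\times S^m\times S^{n-1}\to S^{m+n}\subset\mathbb R^{m+1}\times\mathbb R^n$, $(r,x,y)\mapsto(\sin r\,x,\cos r\,y)$, whose image is dense; here $ds_k^2$ is the standard metric of the unit sphere $S^k$. As $\lambda\to\infty$, the spaces $S^{m+n}$ with the Riemannian distances of $g_\lambda$ converge in the Gromov–Hausdorff sense to the $n$-dimensional Grushin hemisphere, which is the following compact metric space. Consider, on the open hemisphere $\{p\in S^n\subset\mathbb R\times\mathbb R^n: p_0>0\}$,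 the smooth Riemannian metric that equals $dr^2+(\tan r)^{-2}ds_{n-1}^2$ in the coordinates $(r,y)\mapsto(\sin r,\cos r\,y)$, $0<r<\pi/2$, $y\in S^{n-1}$ (it extends smoothly over the pole $r=\pi/2$); the Grushin hemisphere is the metric completion of the open hemisphere with the Riemannian distance of this metric. -/

import Mathlib

set_option maxSynthPendingDepth 3

open scoped Manifold ContDiff Topology ENNReal InnerProductSpace

namespace RicciLimit

noncomputable section

/-! ### Riemannian metrics, their distance, and their Ricci curvature -/

section Riemannian

variable {E : Type*} [NormedAddCommGroup E] [NormedSpace ℝ E]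

/-- The Christoffel symbols, at the point `y`, of a metric `G` on (an open subset of) the vector
space `E`: the bilinear map `Γ` determined by the Koszul formula
`G y (Γ u v) w = (∂_u G(v, w) + ∂_v G(u, w) - ∂_w G(u, v)) / 2`.
Here `D u v w = ∂_u G(v, w)`, and the last summand below is `w ↦ ∂_w G(u, v)`. -/
def christoffel (G : E → E →L[ℝ] E →L[ℝ] ℝ) (y : E) : E →L[ℝ] E →L[ℝ] E :=
  let D : E →L[ℝ] E →L[ℝ] E →L[ℝ] ℝ := fderiv ℝ G y
  let flip : (E →L[ℝ] E →L[ℝ] ℝ) →L[ℝ] E →L[ℝ] E →L[ℝ] ℝ :=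
    (ContinuousLinearMap.flipₗᵢ ℝ E E ℝ).toContinuousLinearEquiv.toContinuousLinearMap
  let K : E →L[ℝ] E →L[ℝ] E →L[ℝ] ℝ := (1 / 2 : ℝ) • (D + D.flip - flip ∘L D.flip)
  (ContinuousLinearMap.compL ℝ E (E →L[ℝ] ℝ) E (ContinuousLinearMap.inverse (G y))) ∘L K

/-- The endomorphism `u ↦ R(u, v) w` of `E`, where `R` is the curvature tensor of `G` at `y`:
`R(u, v) w = ∂_u Γ(v, w) - ∂_v Γ(u, w) + Γ(u, Γ(v, w)) - Γ(v, Γ(u, w))`. -/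
def curvatureEnd (G : E → E →L[ℝ] E →L[ℝ] ℝ) (y v w : E) : E →ₗ[ℝ] E where
  toFun u :=
    fderiv ℝ (christoffel G) y u v w - fderiv ℝ (christoffel G) y v u w
      + christoffel G y u (christoffel G y v w) - christoffel G y v (christoffel G y u w)
  map_add' u u' := by
    simp only [map_add, add_apply]
    abel
  map_smul' c u := by
    simp only [map_smul, smul_apply, RingHom.id_apply, smul_sub, smul_add]

/-- The Ricci tensor `Ric(v, w) = tr (u ↦ R(u, v) w)` of the metric `G` at `y` (for `E` of finite
dimension, which is the only case used). -/
def coordRicci (G : E → E →L[ℝ] E →L[ℝ] ℝ) (y v w : E) : ℝ :=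
  LinearMap.trace ℝ E (curvatureEnd G y v w)

variable {M : Type*} [TopologicalSpace M] [ChartedSpace E M] [IsManifold 𝓘(ℝ, E) ∞ M]

variable (E M) in
/-- Smooth Riemannian metrics on the (boundaryless) manifold `M` modelled on `E`. -/
abbrev SmoothMetric :=
  Bundle.ContMDiffRiemannianMetric 𝓘(ℝ, E) ∞ E (fun x : M ↦ TangentSpace 𝓘(ℝ, E) x)

/-- The expression of the metric `g` in the preferred chart at `x₀`, that is, the pullback of `g`
under the inverse of this chart. -/
def coordMetric (g : SmoothMetric E M) (x₀ : M) (y : E) : E →L[ℝ] E →L[ℝ] ℝ :=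
  let D : E →L[ℝ] E := mfderiv 𝓘(ℝ, E) 𝓘(ℝ, E) (extChartAt 𝓘(ℝ, E) x₀).symm y
  let B : E →L[ℝ] E →L[ℝ] ℝ := g.inner ((extChartAt 𝓘(ℝ, E) x₀).symm y)
  B.bilinearComp D D

/-- The Ricci tensor of `g` at `x`, computed in the preferred chart at `x`. (In Mathlib the tangent
space at `x` is the model space `E`, where a vector is given by its coordinates in this chart.) -/
def ricci (g : SmoothMetric E M) (x : M) (v w : TangentSpace 𝓘(ℝ, E) x) : ℝ :=
  coordRicci (coordMetric g x) (extChartAt 𝓘(ℝ, E) x x) v w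

/-- The lower bound `Ric(g) ≥ k`, meaning `Ric(v, v) ≥ k g(v, v)` for all tangent vectors `v`. -/
def RicciGE (g : SmoothMetric E M) (k : ℝ) : Prop :=
  ∀ (x : M) (v : TangentSpace 𝓘(ℝ, E) x), k * g.inner x v v ≤ ricci g x v v

open scoped Bundle in
/-- The Riemannian distance of `g`: the infimum of the `g`-lengths of `C^1` curves. -/
def riemDist (g : SmoothMetric E M) (x y : M) : ℝ≥0∞ :=
  letI : Bundle.RiemannianBundle (fun x : M ↦ TangentSpace 𝓘(ℝ, E) x) := ⟨g.toRiemannianMetric⟩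
  Manifold.riemannianEDist 𝓘(ℝ, E) x y

/-- The metric space `X` is isometric to `M` with the Riemannian distance of `g`. -/
def IsRiemannianSpace (g : SmoothMetric E M) (X : Type*) [MetricSpace X] : Prop :=
  ∃ φ : X ≃ M, ∀ a b : X, edist a b = riemDist g (φ a) (φ b)

/-- The metric space `X` is (isometric to) the metric completion of `M` with the Riemannian
distance of `g`. -/
def IsMetricCompletion (g : SmoothMetric E M) (X : Type*) [MetricSpace X] : Prop :=
  CompleteSpace X ∧ ∃ ι : M → X, DenseRange ι ∧ ∀ a b : M, edist (ι a) (ι b) = riemDist g a b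

end Riemannian

/-! ### Warped products on spheres and on open hemispheres -/

/-- The unit sphere `S^k` in `ℝ^{k+1}`. -/
abbrev Sphere (k : ℕ) : Type := Metric.sphere (0 : EuclideanSpace ℝ (Fin (k + 1))) 1

/-- The vector `(x, y)` of `ℝ^{m+n+1} = ℝ^{m+1} × ℝ^n`. -/
def pair {m n : ℕ} (x : EuclideanSpace ℝ (Fin (m + 1))) (y : EuclideanSpace ℝ (Fin n)) :
    EuclideanSpace ℝ (Fin (m + n + 1)) :=
  WithLp.toLp 2 (fun i ↦ Fin.append x y (Fin.cast (by omega) i))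

/-- The metric `g` on `S^{m+n}` is the doubly warped product `dr² + f(r)² ds_m² + h(r)² ds_{n-1}²`
in the coordinates `(r, x, y) ↦ (sin r x, cos r y)`, where `0 < r < π/2`, `x ∈ S^m ⊂ ℝ^{m+1}` and
`y ∈ S^{n-1} ⊂ ℝ^n`. That is, if `ξ` is the image of the tangent vector `(a, u, v)` at `(r, x, y)`
under the differential of this map, then `g(ξ, ξ) = a² + f(r)² |u|² + h(r)² |v|²`.
These points are dense in `S^{m+n}`, so this determines `g`. -/
def IsDoublyWarpedProduct {m n : ℕ} (f h : ℝ → ℝ)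
    (g : SmoothMetric (EuclideanSpace ℝ (Fin (m + n))) (Sphere (m + n))) : Prop :=
  ∀ r ∈ Set.Ioo 0 (Real.pi / 2),
  ∀ (x u : EuclideanSpace ℝ (Fin (m + 1))) (y v : EuclideanSpace ℝ (Fin n)) (a : ℝ),
    ‖x‖ = 1 → ‖y‖ = 1 → ⟪x, u⟫_ℝ = 0 → ⟪y, v⟫_ℝ = 0 →
  ∀ (p : Sphere (m + n)) (ξ : TangentSpace (𝓡 (m + n)) p),
    (p : EuclideanSpace ℝ (Fin (m + n + 1))) = pair (Real.sin r • x) (Real.cos r • y) →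
    mfderiv (𝓡 (m + n)) 𝓘(ℝ, EuclideanSpace ℝ (Fin (m + n + 1)))
        (fun q : Sphere (m + n) ↦ (q : EuclideanSpace ℝ (Fin (m + n + 1)))) p ξ
      = pair ((a * Real.cos r) • x + Real.sin r • u) (-(a * Real.sin r) • y + Real.cos r • v) →
    g.inner p ξ ξ = a ^ 2 + f r ^ 2 * ‖u‖ ^ 2 + h r ^ 2 * ‖v‖ ^ 2

/-- The warping function `f_λ`. -/
def warpF (lam r : ℝ) : ℝ := Real.sin r / (1 + lam ^ 2 * Real.sin r ^ 2) ^ (1 / 4 : ℝ)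

/-- The warping function `h_λ`. -/
def warpH (lam r : ℝ) : ℝ := (1 / lam ^ 2 + Real.tan r ^ 2) ^ (-(1 / 2) : ℝ)

/-- The open hemisphere `{p ∈ S^n : p_0 > 0}`, the north pole being `(1, 0, …, 0)`. -/
def openHemisphere (n : ℕ) : TopologicalSpace.Opens (Sphere n) where
  carrier := {p | 0 < (p : EuclideanSpace ℝ (Fin (n + 1))) 0}
  is_open' := isOpen_lt continuous_const (by fun_prop)

/-- The vector `(t, y)` of `ℝ^{n+1} = ℝ × ℝ^n`. -/
def consVec {n : ℕ} (t : ℝ) (y : EuclideanSpace ℝ (Fin n)) : EuclideanSpace ℝ (Fin (n + 1)) :=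
  WithLp.toLp 2 (Fin.cons t y)

/-- The metric `g` on the open hemisphere of `S^n` is the warped product `dr² + h(r)² ds_{n-1}²`
in the coordinates `(r, y) ↦ (sin r, cos r y)`, where `0 < r < π/2` is the distance to the equator
and `y ∈ S^{n-1} ⊂ ℝ^n`. That is, if `ξ` is the image of the tangent vector `(a, v)` at `(r, y)`
under the differential of this map, then `g(ξ, ξ) = a² + h(r)² |v|²`.
Only the north pole is not of this form, so this determines `g`. -/
def IsWarpedProduct {n : ℕ} (h : ℝ → ℝ)
    (g : SmoothMetric (EuclideanSpace ℝ (Fin n)) (openHemisphere n)) : Prop :=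
  ∀ r ∈ Set.Ioo 0 (Real.pi / 2),
  ∀ (y v : EuclideanSpace ℝ (Fin n)) (a : ℝ), ‖y‖ = 1 → ⟪y, v⟫_ℝ = 0 →
  ∀ (p : openHemisphere n) (ξ : TangentSpace (𝓡 n) p),
    ((p : Sphere n) : EuclideanSpace ℝ (Fin (n + 1))) = consVec (Real.sin r) (Real.cos r • y) →
    mfderiv (𝓡 n) 𝓘(ℝ, EuclideanSpace ℝ (Fin (n + 1)))
        (fun q : openHemisphere n ↦ ((q : Sphere n) : EuclideanSpace ℝ (Fin (n + 1)))) p ξ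
      = consVec (a * Real.cos r) (-(a * Real.sin r) • y + Real.cos r • v) →
    g.inner p ξ ξ = a ^ 2 + h r ^ 2 * ‖v‖ ^ 2

/-- The metric space `X` is the `n`-dimensional Grushin hemisphere: the metric completion of the
warped product `dr² + (tan r)^{-2} ds_{n-1}²` on the open hemisphere of `S^n`. -/
def IsGrushinHemisphere (n : ℕ) (X : Type*) [MetricSpace X] : Prop :=
  ∃ g : SmoothMetric (EuclideanSpace ℝ (Fin n)) (openHemisphere n),
    IsWarpedProduct (fun r ↦ (Real.tan r)⁻¹) g ∧ IsMetricCompletion g X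

end

end RicciLimit

open RicciLimit

/-! Write a = λ², s = sin² r, u = a s, q = 1 + (a - 1) s. Then f² = s / √(1 + u) and h² = a cos² r /
q. The metric is the restriction to the sphere of an ambient form F|dX|² + H|dY|² + R⟨X, dX⟩² on
ℝ^{m+1} × ℝ^n, whose coefficients are smooth functions of s = |X|². The correction R is chosen so
that ∂_r has length one. Global smoothness of g_λ is then automatic, also where f or h vanishes
(`contDiff_ambientForm`, `ambientForm_polar`).

Ricci bound. Where X ≠ 0 and Y ≠ 0, coordinates (r, v, w), with graph coordinates on both spheres,
give an explicit Ricci tensor (`coordRicci_warpedForm`). Its diagonal entries combine -f''/f > 0,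
-h''/h (negative once q > 3/2), the mixed curvature -f'h'/(fh) ≥ a/(2q), and the intrinsic terms 1 -
f'² ≥ 0 and 1 - h'². The m copies of the good terms outweigh the n - 1 copies of the bad ones
because m ≥ 8(n - 1) (`warpedRicci_ge`). Naturality of curvature (`coordRicci_pullback`) moves the
bound to the charts of the sphere, and continuity extends it from the dense generic set to all
points (`ricciGE_sphereMetric`).

Convergence. Since f ≤ λ^{-1/2}, the fibres S^m of (X, Y) ↦ (|X|, Y) have diameter at most π
λ^{-1/2}. The lift (t, Y) ↦ (t x, Y) does not increase distances because h_λ ≤ cot r, so d_λ exceeds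
the Grushin distance of the projections by at most the fibre bound (`sphereDist_le`). Conversely, Y
↦ √(1 - 1/a) Y induces a 1-Lipschitz map from the sphere to the open hemisphere and moves
projections only slightly along meridians, uniformly as a → ∞ (`grushinDist_shrinkMap_le`,
`grushinDist_le`). The projection is thus almost isometric. This gives total boundedness of the
Grushin hemisphere, hence compactness of its completion, and then the Gromov–Hausdorff limit. -/

namespace RicciLimit

/-! ### Christoffel symbols and curvature under changes of coordinates. -/

section Naturality

variable {E : Type*} [NormedAddCommGroup E] [NormedSpace ℝ E]
  {E' : Type*} [NormedAddCommGroup E'] [NormedSpace ℝ E']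

/-- `G` is a nondegenerate symmetric `C^2` metric near `y`. -/
structure IsMetricNear (G : E → E →L[ℝ] E →L[ℝ] ℝ) (y : E) : Prop where
  smooth : ContDiffAt ℝ 2 G y
  symm : ∀ᶠ z in 𝓝 y, ∀ v w, G z v w = G z w v
  inv : (G y).IsInvertible

theorem isInvertible_of_pos [FiniteDimensional ℝ E] (B : E →L[ℝ] E →L[ℝ] ℝ)
    (h : ∀ v, v ≠ 0 → 0 < B v v) : B.IsInvertible := by
  have hinj : Function.Injective (B : E →ₗ[ℝ] E →L[ℝ] ℝ) := by
    rw [← LinearMap.ker_eq_bot, LinearMap.ker_eq_bot']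
    intro v hv
    by_contra hne
    have := h v hne
    have h0 : B v = 0 := hv
    rw [h0] at this
    simp at this
  have hfr : Module.finrank ℝ E = Module.finrank ℝ (E →L[ℝ] ℝ) := by
    rw [← LinearEquiv.finrank_eq (LinearMap.toContinuousLinearMap : (E →ₗ[ℝ] ℝ) ≃ₗ[ℝ] _)]
    exact (Subspace.dual_finrank_eq (K := ℝ) (V := E)).symm
  refine ⟨(LinearEquiv.ofInjectiveOfFinrankEq (B : E →ₗ[ℝ] E →L[ℝ] ℝ) hinj
    hfr).toContinuousLinearEquiv, ?_⟩
  ext v w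
  rfl

theorem IsMetricNear.eventually [CompleteSpace E] {G : E → E →L[ℝ] E →L[ℝ] ℝ} {y : E}
    (h : IsMetricNear G y) : ∀ᶠ z in 𝓝 y, IsMetricNear G z := by
  have h1 : ∀ᶠ z in 𝓝 y, (G z).IsInvertible := by
    obtain ⟨e, he⟩ := h.inv
    have := ContinuousLinearEquiv.nhds e
    rw [he] at this
    exact h.smooth.continuousAt.preimage_mem_nhds this
  filter_upwards [h1, h.symm.eventually_nhds, h.smooth.eventually (by simp)] with z h1 h2 h3
  exact ⟨h3, h2, h1⟩

theorem christoffel_spec {G : E → E →L[ℝ] E →L[ℝ] ℝ} {y : E} (h : (G y).IsInvertible)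
    (u v w : E) :
    G y (christoffel G y u v) w =
      (1 / 2) * (fderiv ℝ G y u v w + fderiv ℝ G y v u w - fderiv ℝ G y w u v) := by
  simp only [christoffel, ContinuousLinearMap.comp_apply, ContinuousLinearMap.compL_apply,
    h.self_apply_inverse, smul_apply, sub_apply, add_apply, ContinuousLinearMap.flip_apply]
  rfl

/-- Nondegeneracy makes the Koszul formula determine its solution, so an explicit candidate can be
verified without inverting the metric. -/
theorem christoffel_eq {G : E → E →L[ℝ] E →L[ℝ] ℝ} {y : E} (h : (G y).IsInvertible)
    {u v x : E}
    (hx : ∀ w, G y x w = (1 / 2) * (fderiv ℝ G y u v w + fderiv ℝ G y v u w - fderiv ℝ G y w u v)) :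
    christoffel G y u v = x := by
  apply h.injective
  ext w
  rw [christoffel_spec h, hx]

theorem IsMetricNear.contDiffAt_christoffel [CompleteSpace E] {G : E → E →L[ℝ] E →L[ℝ] ℝ} {y : E}
    (h : IsMetricNear G y) : ContDiffAt ℝ 1 (christoffel G) y := by
  have hD : ContDiffAt ℝ 1 (fderiv ℝ G) y := h.smooth.fderiv_right (by norm_num)
  have hi : ContDiffAt ℝ 1 (fun z ↦ ContinuousLinearMap.inverse (G z)) y :=
    (h.inv.contDiffAt_map_inverse).comp y (h.smooth.of_le (by norm_num))
  unfold christoffel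
  refine ContDiffAt.clm_comp ?_ ?_
  · exact (ContinuousLinearMap.compL ℝ E (E →L[ℝ] ℝ) E).contDiff.contDiffAt.comp y hi
  · have hfl : ContDiffAt ℝ 1 (fun z ↦ (fderiv ℝ G z).flip) y :=
      (ContinuousLinearMap.flipₗᵢ ℝ E E (E →L[ℝ] ℝ)).contDiff.contDiffAt.comp y hD
    exact ((hD.add hfl).sub (contDiffAt_const.clm_comp hfl)).const_smul (1 / 2 : ℝ)

/-- The pullback of the metric `G` under the map `Φ`. -/
noncomputable def pullback (Φ : E' → E) (G : E → E →L[ℝ] E →L[ℝ] ℝ) (z : E') :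
    E' →L[ℝ] E' →L[ℝ] ℝ :=
  (G (Φ z)).bilinearComp (fderiv ℝ Φ z) (fderiv ℝ Φ z)

theorem contDiffAt_bilinearComp {n : ℕ∞ω} {F X : Type*} [NormedAddCommGroup F] [NormedSpace ℝ F]
    [NormedAddCommGroup X] [NormedSpace ℝ X]
    {B : X → E →L[ℝ] E →L[ℝ] ℝ} {D : X → F →L[ℝ] E} {x : X}
    (hB : ContDiffAt ℝ n B x) (hD : ContDiffAt ℝ n D x) :
    ContDiffAt ℝ n (fun z ↦ (B z).bilinearComp (D z) (D z)) x := by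
  have h1 : ContDiffAt ℝ n (fun z ↦ ((B z) ∘L (D z)).flip) x :=
    (ContinuousLinearMap.flipₗᵢ ℝ F E ℝ).contDiff.contDiffAt.comp x (hB.clm_comp hD)
  exact (ContinuousLinearMap.flipₗᵢ ℝ F F ℝ).contDiff.contDiffAt.comp x (h1.clm_comp hD)

theorem contDiffAt_pullback {n n' : ℕ∞ω} {Φ : E' → E} {G : E → E →L[ℝ] E →L[ℝ] ℝ} {z : E'}
    (hG : ContDiffAt ℝ n G (Φ z)) (hΦ : ContDiffAt ℝ n' Φ z) (hn : n + 1 ≤ n') :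
    ContDiffAt ℝ n (pullback Φ G) z :=
  contDiffAt_bilinearComp (hG.comp z (hΦ.of_le (le_self_add.trans hn))) (hΦ.fderiv_right hn)

theorem fderiv_pullback {Φ : E' → E} {G : E → E →L[ℝ] E →L[ℝ] ℝ} {z : E'}
    (hG : ContDiffAt ℝ 1 G (Φ z)) (hΦ : ContDiffAt ℝ 2 Φ z) (u v w : E') :
    fderiv ℝ (pullback Φ G) z u v w =
      fderiv ℝ G (Φ z) (fderiv ℝ Φ z u) (fderiv ℝ Φ z v) (fderiv ℝ Φ z w)
      + G (Φ z) (fderiv ℝ (fderiv ℝ Φ) z u v) (fderiv ℝ Φ z w)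
      + G (Φ z) (fderiv ℝ Φ z v) (fderiv ℝ (fderiv ℝ Φ) z u w) := by
  have hp : DifferentiableAt ℝ (pullback Φ G) z :=
    (contDiffAt_pullback hG hΦ (by norm_num)).differentiableAt one_ne_zero
  have h1 : fderiv ℝ (fun z ↦ pullback Φ G z v w) z u = fderiv ℝ (pullback Φ G) z u v w := by
    have := ((hp.hasFDerivAt.clm_apply (hasFDerivAt_const v z)).clm_apply
      (hasFDerivAt_const w z)).fderiv
    rw [this]
    simp
  have hGd : HasFDerivAt (fun z ↦ G (Φ z)) ((fderiv ℝ G (Φ z)) ∘L (fderiv ℝ Φ z)) z :=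
    (hG.differentiableAt one_ne_zero).hasFDerivAt.comp z
      (hΦ.differentiableAt two_ne_zero).hasFDerivAt
  have hD : HasFDerivAt (fderiv ℝ Φ) (fderiv ℝ (fderiv ℝ Φ) z) z :=
    ((hΦ.fderiv_right (m := 1) (by norm_num)).differentiableAt one_ne_zero).hasFDerivAt
  rw [← h1]
  change fderiv ℝ (fun z ↦ G (Φ z) (fderiv ℝ Φ z v) (fderiv ℝ Φ z w)) z u = _
  rw [((hGd.clm_apply (hD.clm_apply (hasFDerivAt_const v z))).clm_apply
    (hD.clm_apply (hasFDerivAt_const w z))).fderiv]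
  simp
  ring

/-- Transformation law of the Christoffel symbols. -/
theorem christoffel_pullback {Φ : E' → E} {G : E → E →L[ℝ] E →L[ℝ] ℝ} {z : E'}
    (hG : IsMetricNear G (Φ z)) (hΦ : ContDiffAt ℝ 2 Φ z) (hi : (fderiv ℝ Φ z).IsInvertible)
    (hi' : (pullback Φ G z).IsInvertible) (u v : E') :
    fderiv ℝ Φ z (christoffel (pullback Φ G) z u v) =
      christoffel G (Φ z) (fderiv ℝ Φ z u) (fderiv ℝ Φ z v) + fderiv ℝ (fderiv ℝ Φ) z u v := by
  apply hG.inv.injective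
  ext w'
  obtain ⟨w, rfl⟩ := hi.surjective w'
  have hs : ∀ a b, fderiv ℝ (fderiv ℝ Φ) z a b = fderiv ℝ (fderiv ℝ Φ) z b a := fun a b ↦
    (hΦ.isSymmSndFDerivAt (by simp)).eq a b
  have hsG : ∀ a b, G (Φ z) a b = G (Φ z) b a := hG.symm.self_of_nhds
  have h1 : G (Φ z) (fderiv ℝ Φ z (christoffel (pullback Φ G) z u v)) (fderiv ℝ Φ z w) =
    pullback Φ G z (christoffel (pullback Φ G) z u v) w := rfl
  have hG1 : ContDiffAt ℝ 1 G (Φ z) := hG.smooth.of_le (by norm_num)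
  -- In the Koszul combination the second derivatives of `Φ` cancel, by their symmetry and that of
  -- `G`, except for twice the term pairing D²Φ(u, v) with DΦ(w).
  rw [h1, christoffel_spec hi', map_add, add_apply,
    christoffel_spec hG.inv, fderiv_pullback hG1 hΦ, fderiv_pullback hG1 hΦ,
    fderiv_pullback hG1 hΦ, hs v u, hs w u, hs w v,
    hsG (fderiv ℝ Φ z v) (fderiv ℝ (fderiv ℝ Φ) z u w),
    hsG (fderiv ℝ Φ z u) (fderiv ℝ (fderiv ℝ Φ) z v w)]
  ring

theorem isInvertible_pullback {Φ : E' → E} {G : E → E →L[ℝ] E →L[ℝ] ℝ} {z : E'}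
    (hG : (G (Φ z)).IsInvertible) (hi : (fderiv ℝ Φ z).IsInvertible) :
    (pullback Φ G z).IsInvertible := by
  obtain ⟨e, he⟩ := hG
  obtain ⟨D, hD⟩ := hi
  refine ⟨(D.trans e).trans (D.symm.arrowCongr (ContinuousLinearEquiv.refl ℝ ℝ)), ?_⟩
  ext v w
  simp [pullback, ← he, ← hD]

theorem hasFDerivAt_christoffel_apply {G : E → E →L[ℝ] E →L[ℝ] ℝ} {y : E}
    (h : DifferentiableAt ℝ (christoffel G) y) (v w : E) :
    HasFDerivAt (fun z ↦ christoffel G z v w)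
      (((fderiv ℝ (christoffel G) y).flip v).flip w) y := by
  have := (h.hasFDerivAt.clm_apply (hasFDerivAt_const v y)).clm_apply (hasFDerivAt_const w y)
  convert this using 1
  ext x
  simp

theorem IsMetricNear.pullback {Φ : E' → E} {G : E → E →L[ℝ] E →L[ℝ] ℝ} {y : E'}
    (hG : IsMetricNear G (Φ y)) (hΦ : ContDiffAt ℝ 3 Φ y) (hi : (fderiv ℝ Φ y).IsInvertible) :
    IsMetricNear (pullback Φ G) y where
  smooth := contDiffAt_pullback hG.smooth hΦ (by norm_num)
  symm := by filter_upwards [hΦ.continuousAt.eventually hG.symm] with z hz _ _ using hz _ _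
  inv := isInvertible_pullback hG.inv hi

/-- Naturality of the curvature tensor. -/
theorem curvatureEnd_pullback [CompleteSpace E] [CompleteSpace E']
    {Φ : E' → E} {G : E → E →L[ℝ] E →L[ℝ] ℝ} {y : E'}
    (hG : IsMetricNear G (Φ y)) (hΦ : ContDiffAt ℝ 3 Φ y) (hi : (fderiv ℝ Φ y).IsInvertible)
    (u v w : E') :
    fderiv ℝ Φ y (curvatureEnd (pullback Φ G) y v w u) =
      curvatureEnd G (Φ y) (fderiv ℝ Φ y v) (fderiv ℝ Φ y w) (fderiv ℝ Φ y u) := by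
  have hG' := hG.pullback hΦ hi
  have hDsm : ContDiffAt ℝ 2 (fderiv ℝ Φ) y := hΦ.fderiv_right (by norm_num)
  have hDDsm : ContDiffAt ℝ 1 (fderiv ℝ (fderiv ℝ Φ)) y := hDsm.fderiv_right (by norm_num)
  have hiev : ∀ᶠ z in 𝓝 y, (fderiv ℝ Φ z).IsInvertible := by
    obtain ⟨e, he⟩ := hi
    have := ContinuousLinearEquiv.nhds e
    rw [he] at this
    exact hDsm.continuousAt.preimage_mem_nhds this
  have key : ∀ᶠ z in 𝓝 y, ∀ u v, fderiv ℝ Φ z (christoffel (pullback Φ G) z u v) =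
      christoffel G (Φ z) (fderiv ℝ Φ z u) (fderiv ℝ Φ z v) + fderiv ℝ (fderiv ℝ Φ) z u v := by
    filter_upwards [hiev, hΦ.continuousAt.eventually hG.eventually,
      hΦ.eventually (by simp)] with z h1 h2 h3 u v
    exact christoffel_pullback h2 (h3.of_le (by norm_num)) h1
      (isInvertible_pullback h2.inv h1) u v
  have hc' := hG'.contDiffAt_christoffel.differentiableAt one_ne_zero
  have hc := hG.contDiffAt_christoffel.differentiableAt one_ne_zero
  have hD := (hDsm.differentiableAt two_ne_zero).hasFDerivAt
  have hDD := (hDDsm.differentiableAt one_ne_zero).hasFDerivAt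
  have hcΦ : HasFDerivAt (fun z ↦ christoffel G (Φ z))
      ((fderiv ℝ (christoffel G) (Φ y)) ∘L (fderiv ℝ Φ y)) y :=
    hc.hasFDerivAt.comp y (hΦ.differentiableAt three_ne_zero).hasFDerivAt
  -- The transformation law of the Christoffel symbols, differentiated in the direction `t`; this is
  -- where three derivatives of `Φ` are needed.
  have key' : ∀ t u v, fderiv ℝ (fderiv ℝ Φ) y t (christoffel (pullback Φ G) y u v) +
      fderiv ℝ Φ y (fderiv ℝ (christoffel (pullback Φ G)) y t u v) =
      fderiv ℝ (christoffel G) (Φ y) (fderiv ℝ Φ y t) (fderiv ℝ Φ y u) (fderiv ℝ Φ y v)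
      + christoffel G (Φ y) (fderiv ℝ (fderiv ℝ Φ) y t u) (fderiv ℝ Φ y v)
      + christoffel G (Φ y) (fderiv ℝ Φ y u) (fderiv ℝ (fderiv ℝ Φ) y t v)
      + fderiv ℝ (fderiv ℝ (fderiv ℝ Φ)) y t u v := by
    intro t u v
    have h1 := hD.clm_apply ((hc'.hasFDerivAt.clm_apply (hasFDerivAt_const u y)).clm_apply
      (hasFDerivAt_const v y))
    have h2 := ((hcΦ.clm_apply (hD.clm_apply (hasFDerivAt_const u y))).clm_apply
      (hD.clm_apply (hasFDerivAt_const v y))).add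
      ((hDD.clm_apply (hasFDerivAt_const u y)).clm_apply (hasFDerivAt_const v y))
    have h3 := congrArg (fun L ↦ L t) (h1.unique (h2.congr_of_eventuallyEq
      (by filter_upwards [key] with z hz using hz u v)))
    simp at h3
    rw [add_comm, h3]
    abel
  have hs : ∀ a b, fderiv ℝ (fderiv ℝ Φ) y a b = fderiv ℝ (fderiv ℝ Φ) y b a := fun a b ↦
    ((hΦ.of_le (m := 2) (by norm_num)).isSymmSndFDerivAt (by simp)).eq a b
  have hs3 : ∀ a b c, fderiv ℝ (fderiv ℝ (fderiv ℝ Φ)) y a b c =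
      fderiv ℝ (fderiv ℝ (fderiv ℝ Φ)) y b a c := fun a b c ↦ by
    rw [(hDsm.isSymmSndFDerivAt (by simp)).eq a b]
  have k0 := key.self_of_nhds
  have e1 := key' u v w
  have e2 := key' v u w
  simp only [curvatureEnd, LinearMap.coe_mk, AddHom.coe_mk, map_add, map_sub]
  rw [k0 u (christoffel (pullback Φ G) y v w), k0 v (christoffel (pullback Φ G) y u w)]
  have e3 := eq_sub_of_add_eq' e1
  have e4 := eq_sub_of_add_eq' e2
  -- Antisymmetrizing in `u` and `v` removes the third derivatives; the terms containing second
  -- derivatives cancel against those produced by the quadratic part of the curvature.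
  rw [e3, e4, k0 v w, k0 u w, hs3 v u w, hs v u]
  simp only [map_add]
  rw [hs u (christoffel (pullback Φ G) y v w), hs v (christoffel (pullback Φ G) y u w)]
  abel

/-- By `curvatureEnd_pullback` the two curvature endomorphisms are conjugate under the derivative of
`Φ`, and the trace is invariant under conjugation. -/
theorem coordRicci_pullback [CompleteSpace E] [CompleteSpace E']
    {Φ : E' → E} {G : E → E →L[ℝ] E →L[ℝ] ℝ} {y : E'}
    (hG : IsMetricNear G (Φ y)) (hΦ : ContDiffAt ℝ 3 Φ y) (hi : (fderiv ℝ Φ y).IsInvertible)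
    (v w : E') :
    coordRicci (pullback Φ G) y v w =
      coordRicci G (Φ y) (fderiv ℝ Φ y v) (fderiv ℝ Φ y w) := by
  have h := curvatureEnd_pullback hG hΦ hi
  obtain ⟨e, he⟩ := hi
  rw [coordRicci, coordRicci, ← LinearMap.trace_conj' _ e.toLinearEquiv]
  congr 1
  ext x
  obtain ⟨x, rfl⟩ := e.surjective x
  have := h x v w
  rw [← he] at this ⊢
  simpa [LinearEquiv.conj_apply] using this

/-- A `C^2` metric has `C^1` Christoffel symbols. This lets a Ricci bound pass from a dense set to
its closure. -/
theorem IsMetricNear.continuousAt_coordRicci [FiniteDimensional ℝ E]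
    {G : E → E →L[ℝ] E →L[ℝ] ℝ} {y : E} (h : IsMetricNear G y) (v w : E) :
    ContinuousAt (fun z ↦ coordRicci G z v w) y := by
  have hc := h.contDiffAt_christoffel
  have h0 := hc.continuousAt
  have h1 : ContinuousAt (fderiv ℝ (christoffel G)) y :=
    (hc.fderiv_right (m := 0) (by norm_num)).continuousAt
  let b := Module.finBasis ℝ E
  have : ∀ z, coordRicci G z v w = ∑ i, b.repr (curvatureEnd G z v w (b i)) i := by
    intro z
    rw [coordRicci, LinearMap.trace_eq_matrix_trace ℝ b, Matrix.trace]
    simp [LinearMap.toMatrix_apply]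
  simp only [this]
  refine tendsto_finsetSum _ fun i _ ↦ ?_
  have hb : Continuous fun x ↦ b.repr x i := (b.coord i).continuous_of_finiteDimensional
  refine hb.continuousAt.comp (f := fun z ↦ curvatureEnd G z v w (b i)) (x := y) ?_
  simp only [curvatureEnd, LinearMap.coe_mk, AddHom.coe_mk]
  fun_prop

end Naturality

/-! ### The Ricci tensor of a doubly warped product. -/

section DoublyWarped

variable {P : Type*} [NormedAddCommGroup P] [InnerProductSpace ℝ P]
  {Q : Type*} [NormedAddCommGroup Q] [InnerProductSpace ℝ Q]

/-- The round metric in the coordinates `v ↦ v + √(1 - |v|²) x` of the unit sphere. -/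
noncomputable def graphMetric (v u u' : P) : ℝ :=
  ⟪u, u'⟫_ℝ + ⟪v, u⟫_ℝ * ⟪v, u'⟫_ℝ / (1 - ⟪v, v⟫_ℝ)

/-- The derivative of `graphMetric · u u'` at `v` in the direction `x`. -/
noncomputable def graphMetricDeriv (v x u u' : P) : ℝ :=
  (⟪x, u⟫_ℝ * ⟪v, u'⟫_ℝ + ⟪v, u⟫_ℝ * ⟪x, u'⟫_ℝ) / (1 - ⟪v, v⟫_ℝ)
    + 2 * ⟪v, x⟫_ℝ * ⟪v, u⟫_ℝ * ⟪v, u'⟫_ℝ / (1 - ⟪v, v⟫_ℝ) ^ 2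

theorem hasDerivAt_graphMetric {v : P} (hv : 1 - ⟪v, v⟫_ℝ ≠ 0) (x u u' : P) :
    HasDerivAt (fun t : ℝ ↦ graphMetric (v + t • x) u u') (graphMetricDeriv v x u u') 0 := by
  have hl : HasDerivAt (fun t : ℝ ↦ v + t • x) x 0 := by
    simpa using ((hasDerivAt_id (0 : ℝ)).smul_const x).const_add v
  have hi : ∀ u : P, HasDerivAt (fun t : ℝ ↦ ⟪v + t • x, u⟫_ℝ) ⟪x, u⟫_ℝ 0 := fun u ↦ by
    simpa using hl.inner ℝ (hasDerivAt_const (0 : ℝ) u)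
  have h := (((hi u).mul (hi u')).div ((hl.inner ℝ hl).const_sub 1) (by simpa using hv)).const_add
    ⟪u, u'⟫_ℝ
  refine h.congr_deriv ?_
  simp only [graphMetricDeriv, Pi.mul_apply, zero_smul, add_zero, real_inner_comm v x]
  field_simp
  ring

/-- This says Γ(x, y) = κ(x, y) v. The embedding F(v) = v + √(1 - |v|²) e of the sphere satisfies
D²F(x, y) = dF(Γ(x, y)) - κ(x, y) F; the component in the parameter space, where F is linear, gives
Γ. -/
theorem graphMetric_koszul {v : P} (hv : 1 - ⟪v, v⟫_ℝ ≠ 0) (x y z : P) :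
    (1 / 2) * (graphMetricDeriv v x y z + graphMetricDeriv v y x z - graphMetricDeriv v z x y) =
      graphMetric v x y * graphMetric v v z := by
  simp only [graphMetricDeriv, graphMetric, real_inner_comm y x, real_inner_comm z x,
    real_inner_comm z y]
  field_simp
  ring

@[simp]
theorem graphMetric_zero (u u' : P) : graphMetric 0 u u' = ⟪u, u'⟫_ℝ := by simp [graphMetric]

@[simp]
theorem graphMetricDeriv_zero (x u u' : P) : graphMetricDeriv 0 x u u' = 0 := by
  simp [graphMetricDeriv]

theorem graphMetric_add_left (v u₁ u₂ u' : P) :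
    graphMetric v (u₁ + u₂) u' = graphMetric v u₁ u' + graphMetric v u₂ u' := by
  simp only [graphMetric, inner_add_left, inner_add_right]
  ring

theorem graphMetric_smul_left (v : P) (c : ℝ) (u u' : P) :
    graphMetric v (c • u) u' = c * graphMetric v u u' := by
  simp only [graphMetric, inner_smul_left, inner_smul_right]
  simp
  ring

theorem graphMetric_comm (v u u' : P) : graphMetric v u u' = graphMetric v u' u := by
  simp only [graphMetric, real_inner_comm u u', mul_comm]

/-- The doubly warped product `dr² + φ(r) κ + ψ(r) κ'`, where `κ` and `κ'` are the round metrics in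
graph coordinates. -/
noncomputable def warpedForm (φ ψ : ℝ → ℝ) (z ζ ζ' : ℝ × P × Q) : ℝ :=
  ζ.1 * ζ'.1 + φ z.1 * graphMetric z.2.1 ζ.2.1 ζ'.2.1 + ψ z.1 * graphMetric z.2.2 ζ.2.2 ζ'.2.2

/-- The Christoffel symbols of `warpedForm φ ψ`, where `k` and `l` are the logarithmic derivatives
of `√φ` and `√ψ`. -/
noncomputable def warpedChristoffel (φ ψ k l : ℝ → ℝ) (z ζ ζ' : ℝ × P × Q) : ℝ × P × Q :=
  (-(k z.1 * φ z.1 * graphMetric z.2.1 ζ.2.1 ζ'.2.1)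
      - l z.1 * ψ z.1 * graphMetric z.2.2 ζ.2.2 ζ'.2.2,
    k z.1 • (ζ.1 • ζ'.2.1 + ζ'.1 • ζ.2.1) + graphMetric z.2.1 ζ.2.1 ζ'.2.1 • z.2.1,
    l z.1 • (ζ.1 • ζ'.2.2 + ζ'.1 • ζ.2.2) + graphMetric z.2.2 ζ.2.2 ζ'.2.2 • z.2.2)

variable {φ ψ k l : ℝ → ℝ}

theorem hasDerivAt_comp_line {E F : Type*} [NormedAddCommGroup E] [NormedSpace ℝ E]
    [NormedAddCommGroup F] [NormedSpace ℝ F] {f : E → F} {f' : E →L[ℝ] F} {z : E}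
    (h : HasFDerivAt f f' z) (x : E) : HasDerivAt (fun t : ℝ ↦ f (z + t • x)) (f' x) 0 := by
  have hl : HasDerivAt (fun t : ℝ ↦ z + t • x) x 0 := by
    simpa using ((hasDerivAt_id (0 : ℝ)).smul_const x).const_add z
  have h' : HasFDerivAt f f' (z + (0 : ℝ) • x) := by simpa using h
  exact h'.comp_hasDerivAt _ hl

theorem eventually_line {E : Type*} [NormedAddCommGroup E] [NormedSpace ℝ E] {p : E → Prop} {z : E}
    (h : ∀ᶠ y in 𝓝 z, p y) (x : E) : ∀ᶠ t : ℝ in 𝓝 0, p (z + t • x) := by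
  have hc : ContinuousAt (fun t : ℝ ↦ z + t • x) 0 := by fun_prop
  have : Filter.Tendsto (fun t : ℝ ↦ z + t • x) (𝓝 0) (𝓝 z) := by
    simpa [ContinuousAt] using hc
  exact this.eventually h

/-- The hypothesis φ' = 2kφ encodes φ = f² and k = f'/f without square roots. As `G` is assumed
differentiable, derivatives along lines suffice. -/
theorem fderiv_warpedForm {G : (ℝ × P × Q) → (ℝ × P × Q) →L[ℝ] (ℝ × P × Q) →L[ℝ] ℝ} {z : ℝ × P × Q}
    (hd : DifferentiableAt ℝ G z)
    (hG : ∀ᶠ y in 𝓝 z, ∀ ζ ζ', G y ζ ζ' = warpedForm φ ψ y ζ ζ')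
    (hφ : HasDerivAt φ (2 * k z.1 * φ z.1) z.1) (hψ : HasDerivAt ψ (2 * l z.1 * ψ z.1) z.1)
    (h1 : 1 - ⟪z.2.1, z.2.1⟫_ℝ ≠ 0) (h2 : 1 - ⟪z.2.2, z.2.2⟫_ℝ ≠ 0) (x ζ ζ' : ℝ × P × Q) :
    fderiv ℝ G z x ζ ζ' =
      2 * k z.1 * φ z.1 * x.1 * graphMetric z.2.1 ζ.2.1 ζ'.2.1
      + φ z.1 * graphMetricDeriv z.2.1 x.2.1 ζ.2.1 ζ'.2.1
      + (2 * l z.1 * ψ z.1 * x.1 * graphMetric z.2.2 ζ.2.2 ζ'.2.2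
      + ψ z.1 * graphMetricDeriv z.2.2 x.2.2 ζ.2.2 ζ'.2.2) := by
  have hG1 := hasDerivAt_comp_line ((hd.hasFDerivAt.clm_apply (hasFDerivAt_const ζ z)).clm_apply
    (hasFDerivAt_const ζ' z)) x
  have hl : HasDerivAt (fun t : ℝ ↦ z.1 + t * x.1) x.1 0 := by
    simpa using ((hasDerivAt_id (0 : ℝ)).mul_const x.1).const_add z.1
  have hφ' : HasDerivAt (fun t : ℝ ↦ φ (z.1 + t * x.1)) (2 * k z.1 * φ z.1 * x.1) 0 :=
    HasDerivAt.comp (h₂ := φ) (h := fun t : ℝ ↦ z.1 + t * x.1) 0 (by simpa using hφ) hl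
  have hψ' : HasDerivAt (fun t : ℝ ↦ ψ (z.1 + t * x.1)) (2 * l z.1 * ψ z.1 * x.1) 0 :=
    HasDerivAt.comp (h₂ := ψ) (h := fun t : ℝ ↦ z.1 + t * x.1) 0 (by simpa using hψ) hl
  have hw := (((hφ'.mul (hasDerivAt_graphMetric h1 x.2.1 ζ.2.1 ζ'.2.1)).const_add
    (ζ.1 * ζ'.1))).add (hψ'.mul (hasDerivAt_graphMetric h2 x.2.2 ζ.2.2 ζ'.2.2))
  have he := hw.congr_of_eventuallyEq (f₁ := fun t : ℝ ↦ G (z + t • x) ζ ζ') (by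
    filter_upwards [eventually_line hG x] with t ht
    simp [ht, warpedForm])
  have := hG1.unique he
  simp at this
  rw [this]

theorem christoffel_warpedForm
    {G : (ℝ × P × Q) → (ℝ × P × Q) →L[ℝ] (ℝ × P × Q) →L[ℝ] ℝ} {z : ℝ × P × Q}
    (hd : IsMetricNear G z)
    (hG : ∀ᶠ y in 𝓝 z, ∀ ζ ζ', G y ζ ζ' = warpedForm φ ψ y ζ ζ')
    (hφ : HasDerivAt φ (2 * k z.1 * φ z.1) z.1) (hψ : HasDerivAt ψ (2 * l z.1 * ψ z.1) z.1)
    (h1 : 1 - ⟪z.2.1, z.2.1⟫_ℝ ≠ 0) (h2 : 1 - ⟪z.2.2, z.2.2⟫_ℝ ≠ 0) (ζ ζ' : ℝ × P × Q) :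
    christoffel G z ζ ζ' = warpedChristoffel φ ψ k l z ζ ζ' := by
  refine christoffel_eq hd.inv fun w ↦ ?_
  have hdd := hd.smooth.differentiableAt two_ne_zero
  rw [fderiv_warpedForm hdd hG hφ hψ h1 h2, fderiv_warpedForm hdd hG hφ hψ h1 h2,
    fderiv_warpedForm hdd hG hφ hψ h1 h2, hG.self_of_nhds]
  have k1 := graphMetric_koszul h1 ζ.2.1 ζ'.2.1 w.2.1
  have k2 := graphMetric_koszul h2 ζ.2.2 ζ'.2.2 w.2.2
  simp only [warpedForm, warpedChristoffel, graphMetric_add_left, graphMetric_smul_left]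
  rw [← k1, ← k2, graphMetric_comm _ ζ'.2.1 w.2.1, graphMetric_comm _ ζ'.2.2 w.2.2,
    graphMetric_comm _ ζ.2.1 w.2.1, graphMetric_comm _ ζ.2.2 w.2.2]
  ring

theorem trace_prod {A B : Type*} [AddCommGroup A] [Module ℝ A] [Module.Finite ℝ A]
    [AddCommGroup B] [Module ℝ B] [Module.Finite ℝ B] (T : A × B →ₗ[ℝ] A × B) :
    LinearMap.trace ℝ (A × B) T =
      LinearMap.trace ℝ A (LinearMap.fst ℝ A B ∘ₗ T ∘ₗ LinearMap.inl ℝ A B)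
      + LinearMap.trace ℝ B (LinearMap.snd ℝ A B ∘ₗ T ∘ₗ LinearMap.inr ℝ A B) := by
  have h : T = (T ∘ₗ LinearMap.inl ℝ A B) ∘ₗ LinearMap.fst ℝ A B
      + (T ∘ₗ LinearMap.inr ℝ A B) ∘ₗ LinearMap.snd ℝ A B := by
    ext x <;> simp [Prod.mk_zero_zero]
  conv_lhs => rw [h]
  rw [map_add, LinearMap.trace_comp_comm', LinearMap.trace_comp_comm' (LinearMap.snd ℝ A B)]

variable [FiniteDimensional ℝ P] [FiniteDimensional ℝ Q]

/-- Each spherical diagonal block of `curvatureEnd` at the centre of the coordinates has this shape.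
-/
theorem trace_smul_id_add_smul_rankOne (c d : ℝ) (u : P) (T : P →ₗ[ℝ] P)
    (hT : ∀ p, T p = c • p + (d * ⟪p, u⟫_ℝ) • u) :
    LinearMap.trace ℝ P T = c * Module.finrank ℝ P + d * ⟪u, u⟫_ℝ := by
  have h : T = c • LinearMap.id + d • (innerₛₗ ℝ u).smulRight u := by
    ext p
    simp [hT, mul_smul, real_inner_comm u p]
  rw [h, map_add, map_smul, map_smul, LinearMap.trace_id, LinearMap.trace_smulRight]
  simp

/-- The Ricci curvature of a doubly warped product. -/
theorem coordRicci_warpedForm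
    {G : (ℝ × P × Q) → (ℝ × P × Q) →L[ℝ] (ℝ × P × Q) →L[ℝ] ℝ} {r k' l' : ℝ}
    (hd : IsMetricNear G (r, 0, 0))
    (hG : ∀ᶠ y in 𝓝 (r, (0 : P), (0 : Q)), ∀ ζ ζ', G y ζ ζ' = warpedForm φ ψ y ζ ζ')
    (hφ : ∀ᶠ t in 𝓝 r, HasDerivAt φ (2 * k t * φ t) t)
    (hψ : ∀ᶠ t in 𝓝 r, HasDerivAt ψ (2 * l t * ψ t) t)
    (hk : HasDerivAt k k' r) (hl : HasDerivAt l l' r) (a : ℝ) (u : P) (w : Q) :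
    coordRicci G (r, 0, 0) (a, u, w) (a, u, w) =
      a ^ 2 * (-(Module.finrank ℝ P * (k' + k r ^ 2)) - Module.finrank ℝ Q * (l' + l r ^ 2))
      + ‖u‖ ^ 2 * (-(φ r * (k' + k r ^ 2)) + (Module.finrank ℝ P - 1) * (1 - k r ^ 2 * φ r)
        - Module.finrank ℝ Q * (l r * k r * φ r))
      + ‖w‖ ^ 2 * (-(ψ r * (l' + l r ^ 2)) + (Module.finrank ℝ Q - 1) * (1 - l r ^ 2 * ψ r)
        - Module.finrank ℝ P * (k r * l r * ψ r)) := by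
  have hev : ∀ᶠ y in 𝓝 (r, (0 : P), (0 : Q)), ∀ ζ ζ',
      christoffel G y ζ ζ' = warpedChristoffel φ ψ k l y ζ ζ' := by
    have c1 : Filter.Tendsto (fun y : ℝ × P × Q ↦ y.1) (𝓝 (r, 0, 0)) (𝓝 r) :=
      continuous_fst.tendsto' _ _ rfl
    have c2 : Filter.Tendsto (fun y : ℝ × P × Q ↦ 1 - ⟪y.2.1, y.2.1⟫_ℝ) (𝓝 (r, 0, 0)) (𝓝 1) :=
      Continuous.tendsto' (by fun_prop) _ _ (by simp)
    have c3 : Filter.Tendsto (fun y : ℝ × P × Q ↦ 1 - ⟪y.2.2, y.2.2⟫_ℝ) (𝓝 (r, 0, 0)) (𝓝 1) :=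
      Continuous.tendsto' (by fun_prop) _ _ (by simp)
    filter_upwards [hd.eventually, hG.eventually_nhds, c1.eventually hφ, c1.eventually hψ,
      c2.eventually_ne one_ne_zero, c3.eventually_ne one_ne_zero] with y h1 h2 h3 h4 h5 h6 ζ ζ'
    exact christoffel_warpedForm h1 h2 h3 h4 h5 h6 ζ ζ'
  have hC0 := hev.self_of_nhds
  have hdc := hd.contDiffAt_christoffel.differentiableAt one_ne_zero
  have hφr := hφ.self_of_nhds
  have hψr := hψ.self_of_nhds
  -- At the centres of both graph coordinates the first derivatives of the round metrics vanish, so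
  -- only derivatives in `r` and of the factors v, w in κ(·,·) v, κ'(·,·) w survive.
  have hCd : ∀ x ζ ζ' : ℝ × P × Q, fderiv ℝ (christoffel G) (r, 0, 0) x ζ ζ' =
      (-((k' + 2 * k r ^ 2) * φ r * x.1 * ⟪ζ.2.1, ζ'.2.1⟫_ℝ)
        - (l' + 2 * l r ^ 2) * ψ r * x.1 * ⟪ζ.2.2, ζ'.2.2⟫_ℝ,
      (k' * x.1) • (ζ.1 • ζ'.2.1 + ζ'.1 • ζ.2.1) + ⟪ζ.2.1, ζ'.2.1⟫_ℝ • x.2.1,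
      (l' * x.1) • (ζ.1 • ζ'.2.2 + ζ'.1 • ζ.2.2) + ⟪ζ.2.2, ζ'.2.2⟫_ℝ • x.2.2) := by
    intro x ζ ζ'
    have h1 := hasDerivAt_comp_line (hasFDerivAt_christoffel_apply hdc ζ ζ') x
    have hlin : HasDerivAt (fun t : ℝ ↦ r + t * x.1) x.1 0 := by
      simpa using ((hasDerivAt_id (0 : ℝ)).mul_const x.1).const_add r
    have comp : ∀ {f : ℝ → ℝ} {f' : ℝ}, HasDerivAt f f' r →
        HasDerivAt (fun t : ℝ ↦ f (r + t * x.1)) (f' * x.1) 0 := fun {f f'} hf ↦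
      HasDerivAt.comp (h₂ := f) (h := fun t : ℝ ↦ r + t * x.1) 0 (by simpa using hf) hlin
    have g1 := hasDerivAt_graphMetric (v := (0 : P)) (by simp) x.2.1 ζ.2.1 ζ'.2.1
    have g2 := hasDerivAt_graphMetric (v := (0 : Q)) (by simp) x.2.2 ζ.2.2 ζ'.2.2
    have s1 : HasDerivAt (fun t : ℝ ↦ (0 : P) + t • x.2.1) x.2.1 0 := by
      simpa using ((hasDerivAt_id (0 : ℝ)).smul_const x.2.1).const_add 0
    have s2 : HasDerivAt (fun t : ℝ ↦ (0 : Q) + t • x.2.2) x.2.2 0 := by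
      simpa using ((hasDerivAt_id (0 : ℝ)).smul_const x.2.2).const_add 0
    have A := ((((comp hk).mul (comp hφr)).mul g1).neg).sub (((comp hl).mul (comp hψr)).mul g2)
    have B := ((comp hk).smul_const (ζ.1 • ζ'.2.1 + ζ'.1 • ζ.2.1)).add (g1.smul s1)
    have C := ((comp hl).smul_const (ζ.1 • ζ'.2.2 + ζ'.1 • ζ.2.2)).add (g2.smul s2)
    have h2 := (A.prodMk (B.prodMk C)).congr_of_eventuallyEq
      (f₁ := fun t : ℝ ↦ christoffel G ((r, 0, 0) + t • x) ζ ζ') (by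
        filter_upwards [eventually_line hev x] with t ht
        simp [ht, warpedChristoffel])
    have h3 := h1.unique h2
    simp only [ContinuousLinearMap.flip_apply] at h3
    rw [h3]
    refine Prod.ext ?_ (Prod.ext ?_ ?_)
    · simp
      ring
    · simp
    · simp
  rw [coordRicci, trace_prod, trace_prod]
  have t1 : LinearMap.trace ℝ ℝ (LinearMap.fst ℝ ℝ (P × Q) ∘ₗ
      curvatureEnd G (r, 0, 0) (a, u, w) (a, u, w) ∘ₗ LinearMap.inl ℝ ℝ (P × Q)) =
      -(φ r * (k' + k r ^ 2) * ‖u‖ ^ 2) - ψ r * (l' + l r ^ 2) * ‖w‖ ^ 2 := by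
    rw [LinearMap.trace_eq_matrix_trace ℝ (Module.Basis.singleton Unit ℝ), Matrix.trace]
    simp [LinearMap.toMatrix_apply, curvatureEnd, hC0, hCd, warpedChristoffel,
      inner_smul_right]
    ring
  -- The rank one term removes the direction `u` itself from the intrinsic curvature, which turns
  -- the factor dim P into dim P - 1.
  have t2 := trace_smul_id_add_smul_rankOne
    ((1 - k r ^ 2 * φ r) * ‖u‖ ^ 2 - (k' + k r ^ 2) * a ^ 2 - k r * l r * ψ r * ‖w‖ ^ 2)
    (-(1 - k r ^ 2 * φ r)) u
    (LinearMap.fst ℝ P Q ∘ₗ (LinearMap.snd ℝ ℝ (P × Q) ∘ₗ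
      curvatureEnd G (r, 0, 0) (a, u, w) (a, u, w) ∘ₗ LinearMap.inr ℝ ℝ (P × Q))
      ∘ₗ LinearMap.inl ℝ P Q) (by
    intro p
    simp [curvatureEnd, hC0, hCd, warpedChristoffel, inner_smul_right]
    module)
  have t3 := trace_smul_id_add_smul_rankOne
    ((1 - l r ^ 2 * ψ r) * ‖w‖ ^ 2 - (l' + l r ^ 2) * a ^ 2 - l r * k r * φ r * ‖u‖ ^ 2)
    (-(1 - l r ^ 2 * ψ r)) w
    (LinearMap.snd ℝ P Q ∘ₗ (LinearMap.snd ℝ ℝ (P × Q) ∘ₗ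
      curvatureEnd G (r, 0, 0) (a, u, w) (a, u, w) ∘ₗ LinearMap.inr ℝ ℝ (P × Q))
      ∘ₗ LinearMap.inr ℝ P Q) (by
    intro p
    simp [curvatureEnd, hC0, hCd, warpedChristoffel, inner_smul_right]
    module)
  rw [t1, t2, t3, real_inner_self_eq_norm_sq, real_inner_self_eq_norm_sq]
  ring

end DoublyWarped

/-! ### Riemannian metrics induced by bilinear forms on an ambient space. -/

section PullbackMetric

variable {E : Type*} [NormedAddCommGroup E] [NormedSpace ℝ E]
  {M : Type*} [TopologicalSpace M] [ChartedSpace E M] [IsManifold 𝓘(ℝ, E) ∞ M]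
  {V : Type*} [NormedAddCommGroup V] [NormedSpace ℝ V]

/-- Compactness of the unit sphere gives B(v, v) ≥ c|v|² with c > 0. -/
theorem isVonNBounded_of_pos [FiniteDimensional ℝ E] (B : E →L[ℝ] E →L[ℝ] ℝ)
    (h : ∀ v, v ≠ 0 → 0 < B v v) : Bornology.IsVonNBounded ℝ {v : E | B v v < 1} := by
  obtain ⟨c, hc, hB⟩ : ∃ c > 0, ∀ v, c * ‖v‖ ^ 2 ≤ B v v := by
    have hcont : Continuous fun v ↦ B v v := by fun_prop
    -- The unit sphere is empty exactly when `E` is trivial.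
    rcases (Metric.sphere (0 : E) 1).eq_empty_or_nonempty with he | hne
    · refine ⟨1, one_pos, fun v ↦ ?_⟩
      have : v = 0 := by
        by_contra hv
        have : (‖v‖⁻¹ • v) ∈ Metric.sphere (0 : E) 1 := by
          simp [norm_smul, norm_ne_zero_iff.2 hv]
        simp [he] at this
      simp [this]
    · obtain ⟨x, hx, hmin⟩ := (isCompact_sphere (0 : E) 1).exists_isMinOn hne hcont.continuousOn
      have hx0 : x ≠ 0 := ne_zero_of_mem_unit_sphere ⟨x, hx⟩
      refine ⟨B x x, h x hx0, fun v ↦ ?_⟩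
      by_cases hv : v = 0
      · simp [hv]
      have hn : ‖v‖ ≠ 0 := norm_ne_zero_iff.2 hv
      have hm : (‖v‖⁻¹ • v) ∈ Metric.sphere (0 : E) 1 := by simp [norm_smul, hn]
      have := hmin hm
      simp only [Set.mem_ofPred_eq, map_smul, smul_apply, smul_eq_mul] at this
      calc B x x * ‖v‖ ^ 2 ≤ (‖v‖⁻¹ * (‖v‖⁻¹ * B v v)) * ‖v‖ ^ 2 := by gcongr
        _ = B v v := by field_simp
  have hsub : {v : E | B v v < 1} ⊆ Metric.ball 0 (1 / c + 1) := by
    intro v hv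
    simp only [Set.mem_ofPred_eq] at hv
    have h1 : c * ‖v‖ ^ 2 < 1 := (hB v).trans_lt hv
    have h2 : ‖v‖ ^ 2 < 1 / c := by rwa [lt_div_iff₀' hc]
    have h3 : 0 < 1 / c := by positivity
    rw [mem_ball_zero_iff]
    nlinarith [norm_nonneg v]
  exact (NormedSpace.isVonNBounded_ball ℝ E _).subset hsub

/-- The restriction of the form `B` on the ambient space `V` to the tangent space at `p` of the
immersed manifold `ι : M → V`. -/
noncomputable def inducedForm (ι : M → V) (B : V → V →L[ℝ] V →L[ℝ] ℝ) (p : M) :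
    TangentSpace 𝓘(ℝ, E) p →L[ℝ] TangentSpace 𝓘(ℝ, E) p →L[ℝ] ℝ :=
  ContinuousLinearMap.bilinearComp (E' := E) (F' := E) (E := V) (F := V)
    (B (ι p)) (mfderiv 𝓘(ℝ, E) 𝓘(ℝ, V) ι p) (mfderiv 𝓘(ℝ, E) 𝓘(ℝ, V) ι p)

/-- In a trivialization the section is `B` composed on both sides with the derivative of `ι` in
tangent coordinates, which is smooth. The second argument is reached by flipping. -/
theorem contMDiff_inducedForm {ι : M → V} {B : V → V →L[ℝ] V →L[ℝ] ℝ}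
    (hι : ContMDiff 𝓘(ℝ, E) 𝓘(ℝ, V) ∞ ι) (hB : ∀ p, ContDiffAt ℝ ∞ B (ι p)) :
    ContMDiff 𝓘(ℝ, E) (𝓘(ℝ, E).prod 𝓘(ℝ, E →L[ℝ] E →L[ℝ] ℝ)) ∞
      (fun p : M ↦ Bundle.TotalSpace.mk' (E →L[ℝ] E →L[ℝ] ℝ)
        (E := fun x : M ↦ TangentSpace 𝓘(ℝ, E) x →L[ℝ] TangentSpace 𝓘(ℝ, E) x →L[ℝ] ℝ)
        p (inducedForm (E := E) ι B p)) := by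
  intro x₀
  rw [Bundle.contMDiffAt_section]
  have hD := (hι x₀).mfderiv_const (m := ∞) (by simp)
  have hB' : ContMDiffAt 𝓘(ℝ, E) 𝓘(ℝ, V →L[ℝ] V →L[ℝ] ℝ) ∞ (fun p ↦ B (ι p)) x₀ :=
    (hB x₀).contMDiffAt.comp x₀ (hι x₀)
  set T : M → E →L[ℝ] V :=
    inTangentCoordinates 𝓘(ℝ, E) 𝓘(ℝ, V) id ι (mfderiv 𝓘(ℝ, E) 𝓘(ℝ, V) ι) x₀ with hT
  have h1 : ContMDiffAt 𝓘(ℝ, E) 𝓘(ℝ, E →L[ℝ] V →L[ℝ] ℝ) ∞ (fun p ↦ (B (ι p)) ∘L (T p)) x₀ :=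
    hB'.clm_comp hD
  have h2 : ContMDiffAt 𝓘(ℝ, E) 𝓘(ℝ, V →L[ℝ] E →L[ℝ] ℝ) ∞
      (fun p ↦ ((B (ι p)) ∘L (T p)).flip) x₀ :=
    (ContinuousLinearMap.flipₗᵢ ℝ E V ℝ).contDiff.contMDiff.contMDiffAt.comp x₀ h1
  have h3 : ContMDiffAt 𝓘(ℝ, E) 𝓘(ℝ, E →L[ℝ] E →L[ℝ] ℝ) ∞
      (fun p ↦ (((B (ι p)) ∘L (T p)).flip ∘L (T p)).flip) x₀ :=
    (ContinuousLinearMap.flipₗᵢ ℝ E E ℝ).contDiff.contMDiff.contMDiffAt.comp x₀ (h2.clm_comp hD)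
  refine h3.congr_of_eventuallyEq ?_
  have hsrc : ∀ᶠ p in 𝓝 x₀, p ∈ (chartAt E x₀).source := chart_source_mem_nhds E x₀
  filter_upwards [hsrc] with p hp
  have hTp : T p = (mfderiv 𝓘(ℝ, E) 𝓘(ℝ, V) ι p : E →L[ℝ] V) ∘L
      ((trivializationAt E (TangentSpace 𝓘(ℝ, E)) x₀).symmL ℝ p : E →L[ℝ] E) := by
    ext v
    simp [hT, inTangentCoordinates, ContinuousLinearMap.inCoordinates]
    rfl
  ext v w
  rw [hTp]
  simp [hom_trivializationAt_apply, ContinuousLinearMap.inCoordinates, inducedForm, hp]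
  rfl

theorem contDiffAt_comp_extChartAt_symm {ι : M → V} (hι : ContMDiff 𝓘(ℝ, E) 𝓘(ℝ, V) ∞ ι)
    (x₀ : M) {y : E} (hy : y ∈ (extChartAt 𝓘(ℝ, E) x₀).target) :
    ContDiffAt ℝ ∞ (ι ∘ (extChartAt 𝓘(ℝ, E) x₀).symm) y := by
  rw [← contMDiffAt_iff_contDiffAt]
  exact (hι _).comp y ((contMDiffOn_extChartAt_symm (n := ∞) (I := 𝓘(ℝ, E)) x₀).contMDiffAt
      ((isOpen_extChartAt_target (I := 𝓘(ℝ, E)) x₀).mem_nhds hy))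

variable [FiniteDimensional ℝ E]

/-- The Riemannian metric induced by the form `B` on the ambient space `V` of the immersed manifold
`ι : M → V`. -/
noncomputable def inducedMetric (ι : M → V) (B : V → V →L[ℝ] V →L[ℝ] ℝ)
    (hι : ContMDiff 𝓘(ℝ, E) 𝓘(ℝ, V) ∞ ι) (hB : ∀ p, ContDiffAt ℝ ∞ B (ι p))
    (hs : ∀ p v w, B (ι p) v w = B (ι p) w v)
    (hp : ∀ p (ξ : TangentSpace 𝓘(ℝ, E) p), ξ ≠ 0 → 0 < inducedForm (E := E) ι B p ξ ξ) :
    SmoothMetric E M where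
  inner := inducedForm ι B
  symm p _ _ := hs p _ _
  pos p ξ h := hp p ξ h
  isVonNBounded p := isVonNBounded_of_pos (E := E) (inducedForm ι B p) (hp p)
  contMDiff := contMDiff_inducedForm hι hB

section CoordMetric

variable {ι : M → V} {B : V → V →L[ℝ] V →L[ℝ] ℝ}
    {hι : ContMDiff 𝓘(ℝ, E) 𝓘(ℝ, V) ∞ ι} {hB : ∀ p, ContDiffAt ℝ ∞ B (ι p)}
    {hs : ∀ p v w, B (ι p) v w = B (ι p) w v}
    {hp : ∀ p (ξ : TangentSpace 𝓘(ℝ, E) p), ξ ≠ 0 → 0 < inducedForm (E := E) ι B p ξ ξ}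

/-- The chain rule makes the chart expression a `pullback` of the ambient form, so the naturality
results apply to it. -/
theorem coordMetric_inducedMetric (x₀ : M) {y : E} (hy : y ∈ (extChartAt 𝓘(ℝ, E) x₀).target) :
    coordMetric (inducedMetric ι B hι hB hs hp) x₀ y =
      pullback (ι ∘ (extChartAt 𝓘(ℝ, E) x₀).symm) B y := by
  have h1 : MDifferentiableAt 𝓘(ℝ, E) 𝓘(ℝ, E) (extChartAt 𝓘(ℝ, E) x₀).symm y := by
    have := (contMDiffOn_extChartAt_symm (n := ∞) (I := 𝓘(ℝ, E)) x₀).contMDiffAt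
      ((isOpen_extChartAt_target (I := 𝓘(ℝ, E)) x₀).mem_nhds hy)
    exact this.mdifferentiableAt (by simp)
  have h2 := mfderiv_comp y ((hι _).mdifferentiableAt (by simp)) h1
  ext v w
  rw [pullback, ← mfderiv_eq_fderiv, h2]
  rfl

theorem isMetricNear_coordMetric (x₀ : M) {y : E} (hy : y ∈ (extChartAt 𝓘(ℝ, E) x₀).target) :
    IsMetricNear (coordMetric (inducedMetric ι B hι hB hs hp) x₀) y := by
  have hσ := contDiffAt_comp_extChartAt_symm hι x₀ hy
  have hev : ∀ᶠ z in 𝓝 y, z ∈ (extChartAt 𝓘(ℝ, E) x₀).target :=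
    (isOpen_extChartAt_target (I := 𝓘(ℝ, E)) x₀).mem_nhds hy
  have he : coordMetric (inducedMetric ι B hι hB hs hp) x₀ =ᶠ[𝓝 y]
      pullback (ι ∘ (extChartAt 𝓘(ℝ, E) x₀).symm) B := by
    filter_upwards [hev] with z hz using coordMetric_inducedMetric x₀ hz
  refine ⟨ContDiffAt.congr_of_eventuallyEq ?_ he, ?_, ?_⟩
  · exact contDiffAt_pullback ((hB _).of_le ENat.LEInfty.out)
      (hσ.of_le (m := 3) ENat.LEInfty.out) (by norm_num)
  · exact Filter.Eventually.of_forall fun z v w ↦ hs _ _ _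
  · refine isInvertible_of_pos _ fun v hv ↦ ?_
    refine hp _ (mfderiv 𝓘(ℝ, E) 𝓘(ℝ, E) (extChartAt 𝓘(ℝ, E) x₀).symm y v) ?_
    have hinv := isInvertible_mfderivWithin_extChartAt_symm (I := 𝓘(ℝ, E)) hy
    rw [ModelWithCorners.Boundaryless.range_eq_univ, mfderivWithin_univ] at hinv
    intro h0
    exact hv (hinv.injective (h0.trans (map_zero _).symm))

end CoordMetric

end PullbackMetric

/-! ### Distance estimates from maps and curves. -/

section Distance

open Bundle Manifold MeasureTheory Set

variable {E : Type*} [NormedAddCommGroup E] [NormedSpace ℝ E]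
  {M : Type*} [TopologicalSpace M] [ChartedSpace E M]
  {E' : Type*} [NormedAddCommGroup E'] [NormedSpace ℝ E']
  {N : Type*} [TopologicalSpace N] [ChartedSpace E' N]

/-- A map with derivative of norm at most one shortens curves. Both the lift and the shrinking map
below are controlled in this way. -/
theorem riemannianEDist_map_le [∀ x : M, ENorm (TangentSpace 𝓘(ℝ, E) x)]
    [∀ x : N, ENorm (TangentSpace 𝓘(ℝ, E') x)]
    [∀ x : N, ENormSMulClass ℝ (TangentSpace 𝓘(ℝ, E') x)]
    {φ : M → N} (hφ : ContMDiff 𝓘(ℝ, E) 𝓘(ℝ, E') 1 φ)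
    (h : ∀ p (ξ : TangentSpace 𝓘(ℝ, E) p), ‖mfderiv 𝓘(ℝ, E) 𝓘(ℝ, E') φ p ξ‖ₑ ≤ ‖ξ‖ₑ) (x y : M) :
    riemannianEDist 𝓘(ℝ, E') (φ x) (φ y) ≤ riemannianEDist 𝓘(ℝ, E) x y := by
  refine le_of_forall_gt fun r hr ↦ ?_
  obtain ⟨γ, h0, h1, hγ, hlen⟩ := exists_lt_of_riemannianEDist_lt hr
  refine lt_of_le_of_lt ?_ hlen
  refine (riemannianEDist_le_pathELength (γ := φ ∘ γ) (hφ.comp_contMDiffOn hγ)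
    (by simp [h0]) (by simp [h1]) zero_le_one).trans ?_
  rw [pathELength_eq_lintegral_mfderivWithin_Icc, pathELength_eq_lintegral_mfderivWithin_Icc]
  refine setLIntegral_mono' measurableSet_Icc fun t ht ↦ ?_
  rw [mfderiv_comp_mfderivWithin t ((hφ _).mdifferentiableAt one_ne_zero)
    (hγ.mdifferentiableOn one_ne_zero t ht)
    (uniqueMDiffWithinAt_iff_uniqueDiffWithinAt.2 (uniqueDiffOn_Icc zero_lt_one t ht))]
  exact h _ _

variable [IsManifold 𝓘(ℝ, E) ∞ M] [IsManifold 𝓘(ℝ, E') ∞ N]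

theorem riemDist_map_le {g : SmoothMetric E M} {g' : SmoothMetric E' N}
    {φ : M → N} (hφ : ContMDiff 𝓘(ℝ, E) 𝓘(ℝ, E') 1 φ)
    (h : ∀ p (ξ : TangentSpace 𝓘(ℝ, E) p), g'.inner (φ p) (mfderiv 𝓘(ℝ, E) 𝓘(ℝ, E') φ p ξ)
      (mfderiv 𝓘(ℝ, E) 𝓘(ℝ, E') φ p ξ) ≤ g.inner p ξ ξ) (x y : M) :
    riemDist g' (φ x) (φ y) ≤ riemDist g x y := by
  let : RiemannianBundle (fun x : M ↦ TangentSpace 𝓘(ℝ, E) x) := ⟨g.toRiemannianMetric⟩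
  let : RiemannianBundle (fun x : N ↦ TangentSpace 𝓘(ℝ, E') x) := ⟨g'.toRiemannianMetric⟩
  refine riemannianEDist_map_le hφ (fun p ξ ↦ ?_) x y
  rw [enorm_le_iff_norm_le]
  refine le_of_sq_le_sq ?_ (norm_nonneg _)
  rw [← real_inner_self_eq_norm_sq, ← real_inner_self_eq_norm_sq]
  exact h p ξ

theorem riemDist_le_of_curve {g : SmoothMetric E M} {γ : ℝ → M} {a b K : ℝ} (hab : a ≤ b)
    (hK : 0 ≤ K) (hγ : ∀ t ∈ Icc a b, ContMDiffAt 𝓘(ℝ, ℝ) 𝓘(ℝ, E) 1 γ t)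
    (h : ∀ t ∈ Icc a b, g.inner (γ t) (mfderiv 𝓘(ℝ, ℝ) 𝓘(ℝ, E) γ t (1 : ℝ))
      (mfderiv 𝓘(ℝ, ℝ) 𝓘(ℝ, E) γ t (1 : ℝ)) ≤ K ^ 2) :
    riemDist g (γ a) (γ b) ≤ ENNReal.ofReal (K * (b - a)) := by
  let : RiemannianBundle (fun x : M ↦ TangentSpace 𝓘(ℝ, E) x) := ⟨g.toRiemannianMetric⟩
  refine (riemannianEDist_le_pathELength (γ := γ) (fun t ht ↦ (hγ t ht).contMDiffWithinAt)
    rfl rfl hab).trans ?_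
  rw [pathELength_eq_lintegral_mfderiv_Icc]
  calc _ ≤ ∫⁻ _ in Icc a b, ENNReal.ofReal K := by
        refine setLIntegral_mono' measurableSet_Icc fun t ht ↦ ?_
        rw [← ofReal_norm]
        refine ENNReal.ofReal_le_ofReal (le_of_sq_le_sq ?_ hK)
        rw [← real_inner_self_eq_norm_sq]
        exact h t ht
    _ = _ := by
        rw [setLIntegral_const, Real.volume_Icc, ← ENNReal.ofReal_mul hK]

end Distance

/-! ### Orthogonal splittings of Euclidean spaces. -/

section Coordinates

/-- The projection of `ℝ^{m+n+1} = ℝ^{m+1} × ℝ^n` to the first factor. -/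
noncomputable def fstL (m n : ℕ) :
    EuclideanSpace ℝ (Fin (m + n + 1)) →L[ℝ] EuclideanSpace ℝ (Fin (m + 1)) :=
  LinearMap.toContinuousLinearMap
    { toFun p := WithLp.toLp 2 fun i ↦ p (Fin.cast (by omega) (Fin.castAdd n i))
      map_add' _ _ := rfl
      map_smul' _ _ := rfl }

/-- The projection of `ℝ^{m+n+1} = ℝ^{m+1} × ℝ^n` to the second factor. -/
noncomputable def sndL (m n : ℕ) :
    EuclideanSpace ℝ (Fin (m + n + 1)) →L[ℝ] EuclideanSpace ℝ (Fin n) :=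
  LinearMap.toContinuousLinearMap
    { toFun p := WithLp.toLp 2 fun i ↦ p (Fin.cast (by omega) (Fin.natAdd (m + 1) i))
      map_add' _ _ := rfl
      map_smul' _ _ := rfl }

/-- The projection of `ℝ^{n+1} = ℝ × ℝ^n` to the second factor. -/
noncomputable def tailL (n : ℕ) :
    EuclideanSpace ℝ (Fin (n + 1)) →L[ℝ] EuclideanSpace ℝ (Fin n) :=
  LinearMap.toContinuousLinearMap
    { toFun p := WithLp.toLp 2 fun i ↦ p i.succ
      map_add' _ _ := rfl
      map_smul' _ _ := rfl }

variable {m n : ℕ}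

theorem fstL_apply (p : EuclideanSpace ℝ (Fin (m + n + 1))) (i : Fin (m + 1)) :
    fstL m n p i = p (Fin.cast (by omega) (Fin.castAdd n i)) := rfl

theorem sndL_apply (p : EuclideanSpace ℝ (Fin (m + n + 1))) (i : Fin n) :
    sndL m n p i = p (Fin.cast (by omega) (Fin.natAdd (m + 1) i)) := rfl

theorem tailL_apply (p : EuclideanSpace ℝ (Fin (n + 1))) (i : Fin n) :
    tailL n p i = p i.succ := rfl

@[simp]
theorem fstL_pair (x : EuclideanSpace ℝ (Fin (m + 1))) (y : EuclideanSpace ℝ (Fin n)) :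
    fstL m n (pair x y) = x := by
  ext i
  simp [fstL_apply, pair]

@[simp]
theorem sndL_pair (x : EuclideanSpace ℝ (Fin (m + 1))) (y : EuclideanSpace ℝ (Fin n)) :
    sndL m n (pair x y) = y := by
  ext i
  simp [sndL_apply, pair]

theorem inner_eq_fstL_add_sndL (p q : EuclideanSpace ℝ (Fin (m + n + 1))) :
    ⟪p, q⟫_ℝ = ⟪fstL m n p, fstL m n q⟫_ℝ + ⟪sndL m n p, sndL m n q⟫_ℝ := by
  simp only [PiLp.inner_apply]
  rw [← Equiv.sum_comp (finCongr (show m + 1 + n = m + n + 1 by omega)), Fin.sum_univ_add]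
  rfl

theorem norm_sq_eq_fstL_add_sndL (p : EuclideanSpace ℝ (Fin (m + n + 1))) :
    ‖p‖ ^ 2 = ‖fstL m n p‖ ^ 2 + ‖sndL m n p‖ ^ 2 := by
  simp only [← real_inner_self_eq_norm_sq, inner_eq_fstL_add_sndL p p]

theorem ext_fstL_sndL {p q : EuclideanSpace ℝ (Fin (m + n + 1))}
    (h1 : fstL m n p = fstL m n q) (h2 : sndL m n p = sndL m n q) : p = q := by
  have h := norm_sq_eq_fstL_add_sndL (p - q)
  rw [map_sub, map_sub, h1, h2] at h
  simpa [sub_eq_zero] using h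

variable (m n) in
/-- `pair` as a continuous linear map. -/
noncomputable def pairL :
    EuclideanSpace ℝ (Fin (m + 1)) × EuclideanSpace ℝ (Fin n) →L[ℝ]
      EuclideanSpace ℝ (Fin (m + n + 1)) :=
  LinearMap.toContinuousLinearMap
    { toFun p := pair p.1 p.2
      map_add' p q := ext_fstL_sndL (by simp) (by simp)
      map_smul' c p := ext_fstL_sndL (by simp) (by simp) }

theorem pairL_apply (x : EuclideanSpace ℝ (Fin (m + 1))) (y : EuclideanSpace ℝ (Fin n)) :
    pairL m n (x, y) = pair x y := rfl

@[simp]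
theorem tailL_consVec (t : ℝ) (y : EuclideanSpace ℝ (Fin n)) : tailL n (consVec t y) = y := by
  ext i
  simp [tailL_apply, consVec]

@[simp]
theorem consVec_zero (t : ℝ) (y : EuclideanSpace ℝ (Fin n)) : consVec t y 0 = t := by
  simp [consVec]

theorem inner_eq_head_add_tailL (p q : EuclideanSpace ℝ (Fin (n + 1))) :
    ⟪p, q⟫_ℝ = p 0 * q 0 + ⟪tailL n p, tailL n q⟫_ℝ := by
  simp only [PiLp.inner_apply]
  rw [Fin.sum_univ_succ]
  simp [tailL_apply, mul_comm]

theorem norm_sq_eq_head_add_tailL (p : EuclideanSpace ℝ (Fin (n + 1))) :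
    ‖p‖ ^ 2 = p 0 ^ 2 + ‖tailL n p‖ ^ 2 := by
  simp only [← real_inner_self_eq_norm_sq, inner_eq_head_add_tailL p p]
  ring

theorem ext_head_tailL {p q : EuclideanSpace ℝ (Fin (n + 1))}
    (h1 : p 0 = q 0) (h2 : tailL n p = tailL n q) : p = q := by
  have h := norm_sq_eq_head_add_tailL (p - q)
  rw [map_sub, h2] at h
  simpa [sub_eq_zero, h1] using h

variable (n) in
/-- `consVec` as a continuous linear map. -/
noncomputable def consL : ℝ × EuclideanSpace ℝ (Fin n) →L[ℝ] EuclideanSpace ℝ (Fin (n + 1)) :=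
  LinearMap.toContinuousLinearMap
    { toFun p := consVec p.1 p.2
      map_add' p q := ext_head_tailL (by simp) (by simp)
      map_smul' c p := ext_head_tailL (by simp) (by simp) }

end Coordinates

/-! ### The ambient form inducing g_λ. -/

section AmbientForm

/-- The inner product as a bilinear form. -/
noncomputable def innerForm {F : Type*} [NormedAddCommGroup F] [InnerProductSpace ℝ F] :
    F →L[ℝ] F →L[ℝ] ℝ := innerSL ℝ

@[simp]
theorem innerForm_apply {F : Type*} [NormedAddCommGroup F] [InnerProductSpace ℝ F] (v w : F) :
    innerForm v w = ⟪v, w⟫_ℝ := rfl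

/-- `q = cos² r + a sin² r` for `s = sin² r`. -/
noncomputable def quadCoef (a s : ℝ) : ℝ := 1 + (a - 1) * s

/-- `f² / sin²` as a function of `s = sin²`. -/
noncomputable def fstCoef (a s : ℝ) : ℝ := (√(1 + a * s))⁻¹

/-- `h² / cos²` as a function of `s = sin²`. -/
noncomputable def sndCoef (a s : ℝ) : ℝ := a / quadCoef a s

/-- The coefficient of the radial correction; see `fstCoef_add_radialCoef`. -/
noncomputable def radialCoef (a s : ℝ) : ℝ :=
  (2 - a - (a - 1) ^ 2 * s) / (quadCoef a s * √(1 + a * s) * (√(1 + a * s) + quadCoef a s))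

variable {a s : ℝ}

theorem quadCoef_pos (ha : 1 ≤ a) (hs : 0 ≤ s) : 0 < quadCoef a s := by
  have := mul_nonneg (sub_nonneg.2 ha) hs
  unfold quadCoef
  linarith

theorem sqrt_one_add_pos (ha : 1 ≤ a) (hs : 0 ≤ s) : 0 < √(1 + a * s) := by positivity

/-- The value 1/q is forced by |∂_r| = 1. Solving for the radial coefficient requires division by
`s`; after rationalizing, (1 + as) - q² is visibly divisible by `s`, so the formula stays smooth at
s = 0. -/
theorem fstCoef_add_radialCoef (ha : 1 ≤ a) (hs : 0 ≤ s) :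
    fstCoef a s + radialCoef a s * s = (quadCoef a s)⁻¹ := by
  have h1 := quadCoef_pos ha hs
  have h2 := sqrt_one_add_pos ha hs
  have h3 : √(1 + a * s) ^ 2 = 1 + a * s := Real.sq_sqrt (by positivity)
  have h4 : √(1 + a * s) + quadCoef a s ≠ 0 := by positivity
  have h5 : √(1 + a * s) ^ 2 - quadCoef a s ^ 2 = (2 - a - (a - 1) ^ 2 * s) * s := by
    rw [h3, quadCoef]
    ring
  rw [fstCoef, radialCoef]
  field_simp
  linear_combination -h5

/-- The bilinear form on `ℝ^{m+n+1}` inducing the metric `g_λ` on the unit sphere; `a = λ²`. -/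
noncomputable def ambientForm (m n : ℕ) (a : ℝ) (p : EuclideanSpace ℝ (Fin (m + n + 1))) :
    EuclideanSpace ℝ (Fin (m + n + 1)) →L[ℝ] EuclideanSpace ℝ (Fin (m + n + 1)) →L[ℝ] ℝ :=
  fstCoef a (‖fstL m n p‖ ^ 2) • innerForm.bilinearComp (fstL m n) (fstL m n)
    + sndCoef a (‖fstL m n p‖ ^ 2) • innerForm.bilinearComp (sndL m n) (sndL m n)
    + radialCoef a (‖fstL m n p‖ ^ 2) •
      ((innerForm (fstL m n p)) ∘L fstL m n).smulRight ((innerForm (fstL m n p)) ∘L fstL m n)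

variable {m n : ℕ}

theorem ambientForm_apply (p v w : EuclideanSpace ℝ (Fin (m + n + 1))) :
    ambientForm m n a p v w =
      fstCoef a (‖fstL m n p‖ ^ 2) * ⟪fstL m n v, fstL m n w⟫_ℝ
      + sndCoef a (‖fstL m n p‖ ^ 2) * ⟪sndL m n v, sndL m n w⟫_ℝ
      + radialCoef a (‖fstL m n p‖ ^ 2) *
        (⟪fstL m n p, fstL m n v⟫_ℝ * ⟪fstL m n p, fstL m n w⟫_ℝ) := by
  simp [ambientForm]

theorem ambientForm_comm (p v w : EuclideanSpace ℝ (Fin (m + n + 1))) :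
    ambientForm m n a p v w = ambientForm m n a p w v := by
  rw [ambientForm_apply, ambientForm_apply, real_inner_comm (fstL m n w) (fstL m n v),
    real_inner_comm (sndL m n w) (sndL m n v)]
  ring

theorem contDiff_ambientForm (ha : 1 ≤ a) : ContDiff ℝ ∞ (ambientForm m n a) := by
  have hs : ContDiff ℝ ∞ fun p : EuclideanSpace ℝ (Fin (m + n + 1)) ↦ ‖fstL m n p‖ ^ 2 :=
    (fstL m n).contDiff.norm_sq ℝ
  have hq : ContDiff ℝ ∞ fun p : EuclideanSpace ℝ (Fin (m + n + 1)) ↦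
      quadCoef a (‖fstL m n p‖ ^ 2) := by
    unfold quadCoef
    fun_prop
  have hR : ContDiff ℝ ∞ fun p : EuclideanSpace ℝ (Fin (m + n + 1)) ↦
      √(1 + a * ‖fstL m n p‖ ^ 2) :=
    ContDiff.sqrt (by fun_prop) fun p ↦ by positivity
  have hq0 := fun p : EuclideanSpace ℝ (Fin (m + n + 1)) ↦
    quadCoef_pos ha (sq_nonneg ‖fstL m n p‖)
  have hR0 := fun p : EuclideanSpace ℝ (Fin (m + n + 1)) ↦
    sqrt_one_add_pos ha (sq_nonneg ‖fstL m n p‖)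
  have hl : ContDiff ℝ ∞ fun p : EuclideanSpace ℝ (Fin (m + n + 1)) ↦
      (innerForm (fstL m n p)) ∘L fstL m n :=
    (innerForm.contDiff.comp (fstL m n).contDiff).clm_comp contDiff_const
  have h1 : ContDiff ℝ ∞ fun p : EuclideanSpace ℝ (Fin (m + n + 1)) ↦
      fstCoef a (‖fstL m n p‖ ^ 2) := hR.inv fun p ↦ (hR0 p).ne'
  have h2 : ContDiff ℝ ∞ fun p : EuclideanSpace ℝ (Fin (m + n + 1)) ↦
      sndCoef a (‖fstL m n p‖ ^ 2) := contDiff_const.div hq fun p ↦ (hq0 p).ne'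
  have h3 : ContDiff ℝ ∞ fun p : EuclideanSpace ℝ (Fin (m + n + 1)) ↦
      radialCoef a (‖fstL m n p‖ ^ 2) :=
    ContDiff.div (by fun_prop) ((hq.mul hR).mul (hR.add hq)) fun p ↦
      (mul_pos (mul_pos (hq0 p) (hR0 p)) (add_pos (hR0 p) (hq0 p))).ne'
  exact ((h1.smul contDiff_const).add (h2.smul contDiff_const)).add (h3.smul (hl.smulRight hl))

/-- The radial coefficient may have either sign. If nonnegative its term is dropped; if negative,
Cauchy–Schwarz bounds the first-factor part below by (F + R s)|dX|² = |dX|²/q. Only positivity of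
`c` matters later. -/
theorem ambientForm_ge (ha : 1 ≤ a) (p : EuclideanSpace ℝ (Fin (m + n + 1))) :
    ∃ c > 0, ∀ v, c * ‖fstL m n v‖ ^ 2 + sndCoef a (‖fstL m n p‖ ^ 2) * ‖sndL m n v‖ ^ 2 ≤
      ambientForm m n a p v v := by
  have hs := sq_nonneg ‖fstL m n p‖
  have h1 := quadCoef_pos ha hs
  have h2 := sqrt_one_add_pos ha hs
  have h3 := fstCoef_add_radialCoef ha hs
  have key : ∃ c > 0, ∀ v : EuclideanSpace ℝ (Fin (m + n + 1)), c * ‖fstL m n v‖ ^ 2 ≤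
      fstCoef a (‖fstL m n p‖ ^ 2) * ‖fstL m n v‖ ^ 2 +
      radialCoef a (‖fstL m n p‖ ^ 2) * ⟪fstL m n p, fstL m n v⟫_ℝ ^ 2 := by
    rcases le_total 0 (radialCoef a (‖fstL m n p‖ ^ 2)) with h | h
    · exact ⟨_, inv_pos.2 h2, fun v ↦ le_add_of_nonneg_right (by positivity)⟩
    · refine ⟨_, inv_pos.2 h1, fun v ↦ ?_⟩
      have hcs : ⟪fstL m n p, fstL m n v⟫_ℝ ^ 2 ≤ ‖fstL m n p‖ ^ 2 * ‖fstL m n v‖ ^ 2 := by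
        rw [← mul_pow]
        exact sq_le_sq.2 ((abs_real_inner_le_norm _ _).trans (le_abs_self _))
      rw [← h3]
      nlinarith [mul_le_mul_of_nonpos_left hcs h]
  obtain ⟨c, hc, hv⟩ := key
  refine ⟨c, hc, fun v ↦ ?_⟩
  rw [ambientForm_apply, real_inner_self_eq_norm_sq, real_inner_self_eq_norm_sq]
  linarith [hv v]

theorem sndCoef_pos (ha : 1 ≤ a) (hs : 0 ≤ s) : 0 < sndCoef a s :=
  div_pos (by linarith) (quadCoef_pos ha hs)

theorem ambientForm_pos (ha : 1 ≤ a) (p : EuclideanSpace ℝ (Fin (m + n + 1)))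
    {v : EuclideanSpace ℝ (Fin (m + n + 1))} (hv : v ≠ 0) : 0 < ambientForm m n a p v v := by
  obtain ⟨c, hc, h⟩ := ambientForm_ge ha p
  have hY := sndCoef_pos ha (sq_nonneg ‖fstL m n p‖)
  refine lt_of_lt_of_le ?_ (h v)
  by_cases h1 : fstL m n v = 0
  · have h2 : sndL m n v ≠ 0 := fun h2 ↦ hv (ext_fstL_sndL (by simp [h1]) (by simp [h2]))
    have := norm_pos_iff.2 h2
    positivity
  · have := norm_pos_iff.2 h1
    positivity

end AmbientForm

/-! ### The metrics on the sphere and on the open hemisphere. -/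

section Metrics

variable {m n : ℕ}

theorem fact_finrank_euclideanSpace (k : ℕ) :
    Fact (Module.finrank ℝ (EuclideanSpace ℝ (Fin (k + 1))) = k + 1) := ⟨by simp⟩

attribute [local instance] fact_finrank_euclideanSpace

theorem mfderiv_coe_sphere_ne_zero {k : ℕ} (p : Sphere k) {ξ : TangentSpace (𝓡 k) p}
    (hξ : ξ ≠ 0) : mfderiv (𝓡 k) 𝓘(ℝ, EuclideanSpace ℝ (Fin (k + 1)))
      (fun q : Sphere k ↦ (q : EuclideanSpace ℝ (Fin (k + 1)))) p ξ ≠ 0 := fun h ↦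
  hξ (injective_mvfderiv_subtypeVal_sphere (E := EuclideanSpace ℝ (Fin (k + 1))) p
    (h.trans (map_zero _).symm))

/-- The metric `g_λ` on the sphere `S^{m+n}`; `a = λ²`. -/
noncomputable def sphereMetric (m n : ℕ) (a : ℝ) (ha : 1 ≤ a) :
    SmoothMetric (EuclideanSpace ℝ (Fin (m + n))) (Sphere (m + n)) :=
  inducedMetric (fun q : Sphere (m + n) ↦ (q : EuclideanSpace ℝ (Fin (m + n + 1))))
    (ambientForm m n a) contMDiff_coe_sphere (fun _ ↦ (contDiff_ambientForm ha).contDiffAt)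
    (fun _ ↦ ambientForm_comm _)
    (fun _ _ hξ ↦ ambientForm_pos ha _ (mfderiv_coe_sphere_ne_zero _ hξ))

/-- The inclusion of the open hemisphere into `ℝ^{n+1}`. -/
def hemisphereCoe (q : openHemisphere n) : EuclideanSpace ℝ (Fin (n + 1)) := ((q : Sphere n) : _)

theorem contMDiff_hemisphereCoe {k : ℕ∞ω} :
    ContMDiff (𝓡 n) 𝓘(ℝ, EuclideanSpace ℝ (Fin (n + 1))) k (hemisphereCoe (n := n)) :=
  contMDiff_coe_sphere.comp contMDiff_subtype_val

/-- A left inverse of the inclusion of an open set is smooth on this set. -/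
theorem contMDiffAt_toOpens {E H M : Type*} [NormedAddCommGroup E] [NormedSpace ℝ E]
    [TopologicalSpace H] {I : ModelWithCorners ℝ E H} [TopologicalSpace M] [ChartedSpace H M]
    {k : ℕ∞ω} {U : TopologicalSpace.Opens M} {r : M → U} (hr : ∀ x : U, r x = x) (x : U) :
    ContMDiffAt I I k r x := by
  rw [← contMDiffAt_subtype_iff]
  simp only [hr]
  exact contMDiffAt_id

theorem exists_toOpens {M : Type*} [TopologicalSpace M] {U : TopologicalSpace.Opens M} (x₀ : U) :
    ∃ r : M → U, ∀ x : U, r x = x := by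
  classical
  exact ⟨fun x ↦ if h : x ∈ U then ⟨x, h⟩ else x₀, fun x ↦ by simp⟩

/-- The inclusion of the open hemisphere has a left inverse smooth at `p`, and the inclusion of the
sphere is an immersion. -/
theorem mfderiv_hemisphereCoe_injective (p : openHemisphere n) :
    Function.Injective (mfderiv (𝓡 n) 𝓘(ℝ, EuclideanSpace ℝ (Fin (n + 1))) hemisphereCoe p) := by
  obtain ⟨r, hr⟩ := exists_toOpens p
  have h1 : MDifferentiableAt (𝓡 n) (𝓡 n) (Subtype.val : openHemisphere n → Sphere n) p :=
    (contMDiff_subtype_val (n := 1) p).mdifferentiableAt one_ne_zero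
  have h2 : MDifferentiableAt (𝓡 n) 𝓘(ℝ, EuclideanSpace ℝ (Fin (n + 1)))
      (fun q : Sphere n ↦ (q : EuclideanSpace ℝ (Fin (n + 1)))) (p : Sphere n) :=
    (contMDiff_coe_sphere (m := 1) (p : Sphere n)).mdifferentiableAt one_ne_zero
  have h3 : MDifferentiableAt (𝓡 n) (𝓡 n) r (p : Sphere n) :=
    (contMDiffAt_toOpens (k := 1) hr p).mdifferentiableAt one_ne_zero
  have hc : mfderiv (𝓡 n) 𝓘(ℝ, EuclideanSpace ℝ (Fin (n + 1))) hemisphereCoe p =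
      (mfderiv (𝓡 n) 𝓘(ℝ, EuclideanSpace ℝ (Fin (n + 1)))
        (fun q : Sphere n ↦ (q : EuclideanSpace ℝ (Fin (n + 1)))) (p : Sphere n)).comp
      (mfderiv (𝓡 n) (𝓡 n) (Subtype.val : openHemisphere n → Sphere n) p) :=
    mfderiv_comp p h2 h1
  have hid : (mfderiv (𝓡 n) (𝓡 n) r (p : Sphere n)).comp
      (mfderiv (𝓡 n) (𝓡 n) (Subtype.val : openHemisphere n → Sphere n) p) =
      ContinuousLinearMap.id ℝ (TangentSpace (𝓡 n) p) := by
    have := mfderiv_comp p h3 h1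
    rw [← this, show r ∘ (Subtype.val : openHemisphere n → Sphere n) = id from funext hr]
    exact mfderiv_id
  rw [hc]
  refine (injective_mvfderiv_subtypeVal_sphere (E := EuclideanSpace ℝ (Fin (n + 1)))
    (p : Sphere n)).comp ?_
  refine Function.LeftInverse.injective (g := mfderiv (𝓡 n) (𝓡 n) r (p : Sphere n)) fun ξ ↦ ?_
  exact congrArg (fun L ↦ L ξ) hid

/-- The bilinear form on `ℝ^{n+1}` inducing the Grushin metric on the open hemisphere. -/
noncomputable def grushinForm (n : ℕ) (p : EuclideanSpace ℝ (Fin (n + 1))) :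
    EuclideanSpace ℝ (Fin (n + 1)) →L[ℝ] EuclideanSpace ℝ (Fin (n + 1)) →L[ℝ] ℝ :=
  (p 0 ^ 2)⁻¹ • innerForm.bilinearComp (tailL n) (tailL n)

theorem grushinForm_apply (p v w : EuclideanSpace ℝ (Fin (n + 1))) :
    grushinForm n p v w = (p 0 ^ 2)⁻¹ * ⟪tailL n v, tailL n w⟫_ℝ := by
  simp [grushinForm]

theorem hemisphereCoe_pos (p : openHemisphere n) : 0 < hemisphereCoe p 0 := p.2

theorem norm_hemisphereCoe (p : openHemisphere n) : ‖hemisphereCoe p‖ = 1 :=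
  norm_eq_of_mem_sphere (p : Sphere n)

theorem inner_mfderiv_of_norm_eq_one {E M V : Type*} [NormedAddCommGroup E] [NormedSpace ℝ E]
    [TopologicalSpace M] [ChartedSpace E M] [NormedAddCommGroup V] [InnerProductSpace ℝ V]
    {ι : M → V} (h : ∀ p, ‖ι p‖ = 1) {p : M}
    (hι : MDifferentiableAt 𝓘(ℝ, E) 𝓘(ℝ, V) ι p) (ξ : TangentSpace 𝓘(ℝ, E) p) :
    ⟪ι p, (mfderiv 𝓘(ℝ, E) 𝓘(ℝ, V) ι p ξ : V)⟫_ℝ = 0 := by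
  have hn : HasFDerivAt (fun v : V ↦ ‖v‖ ^ 2) (2 • innerSL ℝ (ι p)) (ι p) :=
    (hasStrictFDerivAt_norm_sq (ι p)).hasFDerivAt
  have hc := mfderiv_comp p hn.differentiableAt.mdifferentiableAt hι
  have hconst : (fun v : V ↦ ‖v‖ ^ 2) ∘ ι = fun _ ↦ (1 : ℝ) := by
    funext q
    simp [h q]
  rw [hconst, mfderiv_const, mfderiv_eq_fderiv, hn.fderiv] at hc
  have := congrArg (fun L : E →L[ℝ] ℝ ↦ L ξ) hc
  have h2 : (0 : ℝ) = 2 * ⟪ι p, (mfderiv 𝓘(ℝ, E) 𝓘(ℝ, V) ι p ξ : V)⟫_ℝ := by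
    rw [two_mul, ← two_nsmul]
    exact this
  linarith

/-- The ambient form is degenerate along the axis. But a tangent vector with zero tail has p₀ v₀ = 0
by orthogonality to `p`, hence vanishes because p₀ > 0. -/
theorem inducedForm_grushinForm_pos (p : openHemisphere n) (ξ : TangentSpace (𝓡 n) p)
    (hξ : ξ ≠ 0) :
    0 < inducedForm (E := EuclideanSpace ℝ (Fin n)) hemisphereCoe (grushinForm n) p ξ ξ := by
  set v : EuclideanSpace ℝ (Fin (n + 1)) :=
    mfderiv (𝓡 n) 𝓘(ℝ, EuclideanSpace ℝ (Fin (n + 1))) hemisphereCoe p ξ with hv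
  have hv0 : v ≠ 0 := fun h ↦
    hξ (mfderiv_hemisphereCoe_injective p (h.trans (map_zero _).symm))
  have hp := hemisphereCoe_pos p
  have hin : ⟪hemisphereCoe p, v⟫_ℝ = 0 := inner_mfderiv_of_norm_eq_one norm_hemisphereCoe
    ((contMDiff_hemisphereCoe (k := 1) p).mdifferentiableAt one_ne_zero) ξ
  have ht : tailL n v ≠ 0 := by
    intro ht
    rw [inner_eq_head_add_tailL, ht, inner_zero_right, add_zero] at hin
    exact hv0 (ext_head_tailL (by simpa [hp.ne'] using hin) (by simpa using ht))
  have h1 : inducedForm (E := EuclideanSpace ℝ (Fin n)) hemisphereCoe (grushinForm n) p ξ ξ =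
    grushinForm n (hemisphereCoe p) v v := rfl
  rw [h1, grushinForm_apply, real_inner_self_eq_norm_sq]
  have := norm_pos_iff.2 ht
  positivity

/-- The metric `dr² + (tan r)⁻² ds²` on the open hemisphere. -/
noncomputable def grushinMetric (n : ℕ) :
    SmoothMetric (EuclideanSpace ℝ (Fin n)) (openHemisphere n) :=
  inducedMetric hemisphereCoe (grushinForm n) contMDiff_hemisphereCoe
    (fun p ↦ by
      have h0 : hemisphereCoe p 0 ^ 2 ≠ 0 := pow_ne_zero _ (hemisphereCoe_pos p).ne'
      have h1 : ContDiffAt ℝ ∞ (fun v : EuclideanSpace ℝ (Fin (n + 1)) ↦ v 0 ^ 2)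
          (hemisphereCoe p) := by fun_prop
      exact (h1.inv h0).smul contDiffAt_const)
    (fun p v w ↦ by rw [grushinForm_apply, grushinForm_apply, real_inner_comm])
    inducedForm_grushinForm_pos

end Metrics

attribute [local instance] fact_finrank_euclideanSpace

/-! ### The induced metrics in polar coordinates. -/

section Warped

variable {m n : ℕ}

theorem norm_sq_smul_add_smul {F : Type*} [NormedAddCommGroup F] [InnerProductSpace ℝ F] {x u : F}
    (hx : ‖x‖ = 1) (hxu : ⟪x, u⟫_ℝ = 0) (b c : ℝ) :
    ‖b • x + c • u‖ ^ 2 = b ^ 2 + c ^ 2 * ‖u‖ ^ 2 := by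
  rw [norm_add_sq_real, norm_smul, norm_smul, inner_smul_left, inner_smul_right, hxu, hx]
  simp [mul_pow]

theorem sphereMetric_inner {a : ℝ} (ha : 1 ≤ a) (p : Sphere (m + n))
    (ξ η : TangentSpace (𝓡 (m + n)) p) :
    (sphereMetric m n a ha).inner p ξ η = ambientForm m n a p
      (mfderiv (𝓡 (m + n)) 𝓘(ℝ, EuclideanSpace ℝ (Fin (m + n + 1)))
        (fun q : Sphere (m + n) ↦ (q : EuclideanSpace ℝ (Fin (m + n + 1)))) p ξ)
      (mfderiv (𝓡 (m + n)) 𝓘(ℝ, EuclideanSpace ℝ (Fin (m + n + 1)))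
        (fun q : Sphere (m + n) ↦ (q : EuclideanSpace ℝ (Fin (m + n + 1)))) p η) := rfl

theorem grushinMetric_inner (p : openHemisphere n) (ξ η : TangentSpace (𝓡 n) p) :
    (grushinMetric n).inner p ξ η = grushinForm n (hemisphereCoe p)
      (mfderiv (𝓡 n) 𝓘(ℝ, EuclideanSpace ℝ (Fin (n + 1))) hemisphereCoe p ξ)
      (mfderiv (𝓡 n) 𝓘(ℝ, EuclideanSpace ℝ (Fin (n + 1))) hemisphereCoe p η) := rfl

/-- The square of `f_λ` as a function of `a = λ²`. -/
noncomputable def fstWarp (a r : ℝ) : ℝ := Real.sin r ^ 2 * fstCoef a (Real.sin r ^ 2)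

/-- The square of `h_λ` as a function of `a = λ²`. -/
noncomputable def sndWarp (a r : ℝ) : ℝ := Real.cos r ^ 2 * sndCoef a (Real.sin r ^ 2)

/-- The coefficient of b² is cos² r (F + R s) + sin² r H = (cos² r + a sin² r)/q = 1. No sign of sin
r or cos r is needed. -/
theorem ambientForm_polar {a : ℝ} (ha : 1 ≤ a) (r b : ℝ)
    {x u : EuclideanSpace ℝ (Fin (m + 1))} {y v : EuclideanSpace ℝ (Fin n)}
    (hx : ‖x‖ = 1) (hy : ‖y‖ = 1) (hxu : ⟪x, u⟫_ℝ = 0) (hyv : ⟪y, v⟫_ℝ = 0)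
    {p w : EuclideanSpace ℝ (Fin (m + n + 1))}
    (hp : p = pair (Real.sin r • x) (Real.cos r • y))
    (hw : w = pair ((b * Real.cos r) • x + Real.sin r • u)
      (-(b * Real.sin r) • y + Real.cos r • v)) :
    ambientForm m n a p w w = b ^ 2 + fstWarp a r * ‖u‖ ^ 2 + sndWarp a r * ‖v‖ ^ 2 := by
  have hs : ‖Real.sin r • x‖ ^ 2 = Real.sin r ^ 2 := by simp [norm_smul, hx]
  have hi : ⟪Real.sin r • x, (b * Real.cos r) • x + Real.sin r • u⟫_ℝ =
      b * Real.sin r * Real.cos r := by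
    rw [inner_add_right, inner_smul_left, inner_smul_right, inner_smul_left, inner_smul_right, hxu,
      real_inner_self_eq_norm_sq, hx]
    simp
    ring
  rw [hp, hw, ambientForm_apply, fstL_pair, sndL_pair, fstL_pair, hs, hi,
    real_inner_self_eq_norm_sq, real_inner_self_eq_norm_sq, norm_sq_smul_add_smul hx hxu,
    norm_sq_smul_add_smul hy hyv, fstWarp, sndWarp]
  have hc := Real.cos_sq' r
  have key := fstCoef_add_radialCoef ha (sq_nonneg (Real.sin r))
  have hq := quadCoef_pos ha (sq_nonneg (Real.sin r))
  have h1 : Real.cos r ^ 2 * (quadCoef a (Real.sin r ^ 2))⁻¹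
      + Real.sin r ^ 2 * sndCoef a (Real.sin r ^ 2) = 1 := by
    rw [sndCoef]
    field_simp
    rw [quadCoef, hc]
    ring
  rw [← key] at h1
  linear_combination b ^ 2 * h1

theorem isDoublyWarpedProduct_sphereMetric {lam : ℝ} (hl : 1 ≤ lam) (ha : 1 ≤ lam ^ 2) :
    IsDoublyWarpedProduct (warpF lam) (warpH lam) (sphereMetric m n (lam ^ 2) ha) := by
  intro r hr x u y v b hx hy hxu hyv p ξ hp hξ
  rw [sphereMetric_inner, ambientForm_polar ha r b hx hy hxu hyv hp hξ]
  have hcos : 0 < Real.cos r := Real.cos_pos_of_mem_Ioo ⟨by linarith [hr.1, Real.pi_pos], hr.2⟩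
  have hf : fstWarp (lam ^ 2) r = warpF lam r ^ 2 := by
    have h0 : 0 ≤ 1 + lam ^ 2 * Real.sin r ^ 2 := by positivity
    rw [fstWarp, warpF, fstCoef, div_pow, ← Real.rpow_natCast ((_ : ℝ) ^ (_ : ℝ)),
      ← Real.rpow_mul h0, Real.sqrt_eq_rpow]
    norm_num
    rfl
  have hh : sndWarp (lam ^ 2) r = warpH lam r ^ 2 := by
    have h0 : 0 < 1 / lam ^ 2 + Real.tan r ^ 2 := by positivity
    have hq := quadCoef_pos ha (sq_nonneg (Real.sin r))
    rw [sndWarp, warpH, sndCoef, ← Real.rpow_natCast ((_ : ℝ) ^ (_ : ℝ)), ← Real.rpow_mul h0.le]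
    norm_num
    rw [Real.rpow_neg_one]
    refine eq_inv_of_mul_eq_one_left ?_
    rw [Real.tan_eq_sin_div_cos]
    field_simp
    rw [quadCoef, Real.cos_sq']
    ring
  rw [hf, hh]

/-- The tail of the tangent vector has squared norm b² sin² r + cos² r |v|²; dividing by p₀² = sin²
r gives the claim. -/
theorem isWarpedProduct_grushinMetric :
    IsWarpedProduct (fun r ↦ (Real.tan r)⁻¹) (grushinMetric n) := by
  intro r hr y v b hy hyv p ξ hp hξ
  have hsin : 0 < Real.sin r := Real.sin_pos_of_pos_of_lt_pi hr.1 (by linarith [hr.2, Real.pi_pos])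
  have hξ' : mfderiv (𝓡 n) 𝓘(ℝ, EuclideanSpace ℝ (Fin (n + 1))) hemisphereCoe p ξ =
    consVec (b * Real.cos r) (-(b * Real.sin r) • y + Real.cos r • v) := hξ
  rw [grushinMetric_inner, hξ',
    show hemisphereCoe p = consVec (Real.sin r) (Real.cos r • y) from hp,
    grushinForm_apply, tailL_consVec, real_inner_self_eq_norm_sq, norm_sq_smul_add_smul hy hyv,
    consVec_zero]
  change _ = b ^ 2 + (Real.tan r)⁻¹ ^ 2 * ‖v‖ ^ 2
  rw [Real.tan_eq_sin_div_cos]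
  field_simp

end Warped

/-! ### Shrinking, lifting and explicit curves between sphere and hemisphere. -/

section Maps

variable {m n : ℕ}

theorem contMDiffAt_of_val {E H M E' H' N : Type*} [NormedAddCommGroup E] [NormedSpace ℝ E]
    [TopologicalSpace H] {I : ModelWithCorners ℝ E H} [TopologicalSpace M] [ChartedSpace H M]
    [NormedAddCommGroup E'] [NormedSpace ℝ E']
    [TopologicalSpace H'] {J : ModelWithCorners ℝ E' H'} [TopologicalSpace N] [ChartedSpace H' N]
    {k : ℕ∞ω} {U : TopologicalSpace.Opens M} {φ : N → U} {x : N}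
    (h : ContMDiffAt J I k (fun y ↦ (φ y : M)) x) : ContMDiffAt J I k φ x := by
  obtain ⟨r, hr⟩ := exists_toOpens (φ x)
  have : φ = r ∘ (fun y ↦ (φ y : M)) := funext fun y ↦ (hr _).symm
  rw [this]
  exact (contMDiffAt_toOpens hr (φ x)).comp x h

theorem clm_mfderiv {E M V W : Type*} [NormedAddCommGroup E] [NormedSpace ℝ E]
    [TopologicalSpace M] [ChartedSpace E M] [NormedAddCommGroup V] [NormedSpace ℝ V]
    [NormedAddCommGroup W] [NormedSpace ℝ W] (L : V →L[ℝ] W) {f : M → V} {p : M}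
    (hf : MDifferentiableAt 𝓘(ℝ, E) 𝓘(ℝ, V) f p) (ξ : TangentSpace 𝓘(ℝ, E) p) :
    mfderiv 𝓘(ℝ, E) 𝓘(ℝ, W) (fun q ↦ L (f q)) p ξ =
      L (mfderiv 𝓘(ℝ, E) 𝓘(ℝ, V) f p ξ : V) := by
  have h := mfderiv_comp p (L.differentiableAt (x := f p)).mdifferentiableAt hf
  rw [mfderiv_eq_fderiv, L.fderiv] at h
  exact congrArg (fun T : E →L[ℝ] W ↦ T ξ) h

theorem riemDist_map_inducedMetric_le {E M E' N V : Type*} [NormedAddCommGroup E] [NormedSpace ℝ E]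
    [TopologicalSpace M] [ChartedSpace E M] [IsManifold 𝓘(ℝ, E) ∞ M]
    [NormedAddCommGroup E'] [NormedSpace ℝ E'] [FiniteDimensional ℝ E']
    [TopologicalSpace N] [ChartedSpace E' N] [IsManifold 𝓘(ℝ, E') ∞ N]
    [NormedAddCommGroup V] [NormedSpace ℝ V] {ι : N → V} {B : V → V →L[ℝ] V →L[ℝ] ℝ}
    {hι : ContMDiff 𝓘(ℝ, E') 𝓘(ℝ, V) ∞ ι} {hB : ∀ p, ContDiffAt ℝ ∞ B (ι p)}
    {hs : ∀ p v w, B (ι p) v w = B (ι p) w v}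
    {hp : ∀ p (ξ : TangentSpace 𝓘(ℝ, E') p), ξ ≠ 0 → 0 < inducedForm (E := E') ι B p ξ ξ}
    {g : SmoothMetric E M} {φ : M → N} (hφ : ContMDiff 𝓘(ℝ, E) 𝓘(ℝ, E') 1 φ)
    (h : ∀ p (ξ : TangentSpace 𝓘(ℝ, E) p), B (ι (φ p))
      (mfderiv 𝓘(ℝ, E) 𝓘(ℝ, V) (fun q ↦ ι (φ q)) p ξ)
      (mfderiv 𝓘(ℝ, E) 𝓘(ℝ, V) (fun q ↦ ι (φ q)) p ξ) ≤ g.inner p ξ ξ) (x y : M) :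
    riemDist (inducedMetric ι B hι hB hs hp) (φ x) (φ y) ≤ riemDist g x y := by
  refine riemDist_map_le hφ (fun p ξ ↦ ?_) x y
  have hc := mfderiv_comp p ((hι (φ p)).mdifferentiableAt (by simp))
    ((hφ p).mdifferentiableAt one_ne_zero)
  have h' := h p ξ
  have he : (fun q ↦ ι (φ q)) = ι ∘ φ := rfl
  rw [he, hc] at h'
  exact h'

theorem riemDist_inducedMetric_le_of_curve {E M V : Type*} [NormedAddCommGroup E] [NormedSpace ℝ E]
    [FiniteDimensional ℝ E] [TopologicalSpace M] [ChartedSpace E M] [IsManifold 𝓘(ℝ, E) ∞ M]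
    [NormedAddCommGroup V] [NormedSpace ℝ V] {ι : M → V} {B : V → V →L[ℝ] V →L[ℝ] ℝ}
    {hι : ContMDiff 𝓘(ℝ, E) 𝓘(ℝ, V) ∞ ι} {hB : ∀ p, ContDiffAt ℝ ∞ B (ι p)}
    {hs : ∀ p v w, B (ι p) v w = B (ι p) w v}
    {hp : ∀ p (ξ : TangentSpace 𝓘(ℝ, E) p), ξ ≠ 0 → 0 < inducedForm (E := E) ι B p ξ ξ}
    {γ : ℝ → M} {γ' : ℝ → V} {a b K : ℝ} (hab : a ≤ b) (hK : 0 ≤ K)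
    (hγ : ∀ t ∈ Set.Icc a b, ContMDiffAt 𝓘(ℝ, ℝ) 𝓘(ℝ, E) 1 γ t)
    (hγ' : ∀ t ∈ Set.Icc a b, HasDerivAt (fun s ↦ ι (γ s)) (γ' t) t)
    (h : ∀ t ∈ Set.Icc a b, B (ι (γ t)) (γ' t) (γ' t) ≤ K ^ 2) :
    riemDist (inducedMetric ι B hι hB hs hp) (γ a) (γ b) ≤ ENNReal.ofReal (K * (b - a)) := by
  refine riemDist_le_of_curve hab hK hγ fun t ht ↦ ?_
  have hc := mfderiv_comp t ((hι (γ t)).mdifferentiableAt (by simp))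
    ((hγ t ht).mdifferentiableAt one_ne_zero)
  have he : (fun q ↦ ι (γ q)) = ι ∘ γ := rfl
  have h1 := (hγ' t ht).hasFDerivAt.fderiv
  rw [he, ← mfderiv_eq_fderiv, hc] at h1
  have h2 : mfderiv 𝓘(ℝ, E) 𝓘(ℝ, V) ι (γ t) (mfderiv 𝓘(ℝ, ℝ) 𝓘(ℝ, E) γ t (1 : ℝ)) = γ' t := by
    exact (congrArg (fun T : ℝ →L[ℝ] V ↦ T 1) h1).trans
      (by simp : (ContinuousLinearMap.toSpanSingleton ℝ (γ' t)) 1 = γ' t)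
  have h3 := h t ht
  rw [← h2] at h3
  exact h3

/-- The Riemannian distance of the metric `g_λ`; `a = λ²`. -/
noncomputable def sphereDist (m n : ℕ) (a : ℝ) (ha : 1 ≤ a) :
    Sphere (m + n) → Sphere (m + n) → ℝ≥0∞ :=
  riemDist (sphereMetric m n a ha)

/-- The distance of the Grushin hemisphere on its open dense part. -/
noncomputable def grushinDist (n : ℕ) : openHemisphere n → openHemisphere n → ℝ≥0∞ :=
  riemDist (grushinMetric n)

theorem hemisphere_head_sq (P : openHemisphere n) :
    hemisphereCoe P 0 ^ 2 = 1 - ‖tailL n (hemisphereCoe P)‖ ^ 2 := by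
  have := norm_sq_eq_head_add_tailL (hemisphereCoe P)
  rw [norm_hemisphereCoe] at this
  linarith

theorem hemisphere_ext {P Q : openHemisphere n}
    (h : tailL n (hemisphereCoe P) = tailL n (hemisphereCoe Q)) : P = Q := by
  have h0 : hemisphereCoe P 0 ^ 2 = hemisphereCoe Q 0 ^ 2 := by
    rw [hemisphere_head_sq, hemisphere_head_sq, h]
  have h1 : hemisphereCoe P 0 = hemisphereCoe Q 0 :=
    (pow_left_inj₀ (hemisphereCoe_pos P).le (hemisphereCoe_pos Q).le two_ne_zero).1 h0
  exact Subtype.ext (Subtype.ext (ext_head_tailL h1 h))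

theorem sphere_fstL_norm_sq (p : Sphere (m + n)) :
    ‖fstL m n p‖ ^ 2 = 1 - ‖sndL m n p‖ ^ 2 := by
  have := norm_sq_eq_fstL_add_sndL (p : EuclideanSpace ℝ (Fin (m + n + 1)))
  rw [norm_eq_of_mem_sphere] at this
  linarith

section Projection

/-- The vector `(√(1 - θ|Y|²), √θ Y)`, where `Y` is the second component of `p`. -/
noncomputable def shrinkVec (m n : ℕ) (θ : ℝ) (p : EuclideanSpace ℝ (Fin (m + n + 1))) :
    EuclideanSpace ℝ (Fin (n + 1)) :=
  consVec √(1 - θ * ‖sndL m n p‖ ^ 2) (√θ • sndL m n p)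

variable {θ : ℝ}

theorem one_sub_mul_pos (h0 : 0 ≤ θ) (h1 : θ < 1) (p : Sphere (m + n)) :
    0 < 1 - θ * ‖sndL m n p‖ ^ 2 := by
  have := sphere_fstL_norm_sq p
  nlinarith [sq_nonneg ‖fstL m n p‖, sq_nonneg ‖sndL m n p‖]

theorem shrinkVec_mem_sphere (h0 : 0 ≤ θ) (h1 : θ < 1) (p : Sphere (m + n)) :
    shrinkVec m n θ p ∈ Metric.sphere (0 : EuclideanSpace ℝ (Fin (n + 1))) 1 := by
  rw [mem_sphere_zero_iff_norm, ← pow_left_inj₀ (norm_nonneg _) zero_le_one two_ne_zero,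
    norm_sq_eq_head_add_tailL, shrinkVec, consVec_zero, tailL_consVec,
    Real.sq_sqrt (one_sub_mul_pos h0 h1 p).le, norm_smul, mul_pow, Real.norm_eq_abs, sq_abs,
    Real.sq_sqrt h0]
  ring

/-- The map `(X, Y) ↦ (√(1 - θ|Y|²), √θ Y)` from `S^{m+n}` to the open hemisphere of `S^n`. -/
noncomputable def shrinkMap (h0 : 0 ≤ θ) (h1 : θ < 1) (p : Sphere (m + n)) : openHemisphere n :=
  ⟨⟨shrinkVec m n θ p, shrinkVec_mem_sphere h0 h1 p⟩, by
    change 0 < shrinkVec m n θ p 0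
    rw [shrinkVec, consVec_zero]
    exact Real.sqrt_pos.2 (one_sub_mul_pos h0 h1 p)⟩

theorem hemisphereCoe_shrinkMap (h0 : 0 ≤ θ) (h1 : θ < 1) (p : Sphere (m + n)) :
    hemisphereCoe (shrinkMap h0 h1 p) = shrinkVec m n θ p := rfl

theorem contMDiff_shrinkMap (h0 : 0 ≤ θ) (h1 : θ < 1) :
    ContMDiff (𝓡 (m + n)) (𝓡 n) 1 (shrinkMap (m := m) (n := n) h0 h1) := by
  have hV : ContMDiff (𝓡 (m + n)) 𝓘(ℝ, EuclideanSpace ℝ (Fin (n + 1))) 1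
      (fun p : Sphere (m + n) ↦ shrinkVec m n θ p) := by
    intro p
    have hd : ContDiffAt ℝ 1 (shrinkVec m n θ) (p : EuclideanSpace ℝ (Fin (m + n + 1))) := by
      have hn : ContDiffAt ℝ 1 (fun q ↦ 1 - θ * ‖sndL m n q‖ ^ 2)
          (p : EuclideanSpace ℝ (Fin (m + n + 1))) :=
        contDiffAt_const.sub (contDiffAt_const.mul ((sndL m n).contDiff.norm_sq ℝ).contDiffAt)
      have hs : ContDiffAt ℝ 1 (fun q ↦ √θ • sndL m n q)
          (p : EuclideanSpace ℝ (Fin (m + n + 1))) := by fun_prop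
      exact (consL n).contDiff.contDiffAt.comp _
        ((hn.sqrt (one_sub_mul_pos h0 h1 p).ne').prodMk hs)
    exact hd.contMDiffAt.comp p (contMDiff_coe_sphere p)
  intro p
  exact contMDiffAt_of_val (hV.codRestrict_sphere (shrinkVec_mem_sphere h0 h1) p)

/-- The Grushin form sees only the tail √θ Y, so its pullback is θ|dY|²/(1 - θ|Y|²). For θ = 1 - 1/a
the denominator is q/a, and the result is θ H|dY|², at most the part H|dY|² of g_λ. -/
theorem grushinDist_shrinkMap_le {a : ℝ} (ha : 1 ≤ a) (h0 : 0 ≤ 1 - a⁻¹) (h1 : 1 - a⁻¹ < 1)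
    (p q : Sphere (m + n)) :
    grushinDist n (shrinkMap h0 h1 p) (shrinkMap h0 h1 q) ≤ sphereDist m n a ha p q := by
  refine riemDist_map_inducedMetric_le (contMDiff_shrinkMap h0 h1) (fun p ξ ↦ ?_) p q
  have hm1 : MDifferentiableAt (𝓡 (m + n)) 𝓘(ℝ, EuclideanSpace ℝ (Fin (n + 1)))
      (fun q : Sphere (m + n) ↦ hemisphereCoe (shrinkMap h0 h1 q)) p :=
    ((contMDiff_hemisphereCoe (k := 1)).comp
      (contMDiff_shrinkMap h0 h1) p).mdifferentiableAt one_ne_zero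
  have hm2 : MDifferentiableAt (𝓡 (m + n)) 𝓘(ℝ, EuclideanSpace ℝ (Fin (m + n + 1)))
      (fun q : Sphere (m + n) ↦ (q : EuclideanSpace ℝ (Fin (m + n + 1)))) p :=
    (contMDiff_coe_sphere (m := 1) p).mdifferentiableAt one_ne_zero
  have e1 := clm_mfderiv (tailL n) hm1 ξ
  have e2 := clm_mfderiv (√(1 - a⁻¹) • sndL m n) hm2 ξ
  have e3 : (fun q : Sphere (m + n) ↦ tailL n (hemisphereCoe (shrinkMap h0 h1 q))) =
      fun q : Sphere (m + n) ↦
        (√(1 - a⁻¹) • sndL m n) (q : EuclideanSpace ℝ (Fin (m + n + 1))) := by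
    funext q
    simp [hemisphereCoe_shrinkMap, shrinkVec]
  have e4 := (e1.symm.trans (congrArg (fun f : Sphere (m + n) → EuclideanSpace ℝ (Fin n) ↦
    (show EuclideanSpace ℝ (Fin n) from
      mfderiv (𝓡 (m + n)) 𝓘(ℝ, EuclideanSpace ℝ (Fin n)) f p ξ)) e3)).trans e2
  obtain ⟨c, hc, hge⟩ := ambientForm_ge (m := m) (n := n) ha p
  let w : EuclideanSpace ℝ (Fin (n + 1)) := mfderiv (𝓡 (m + n)) 𝓘(ℝ, EuclideanSpace ℝ (Fin (n + 1)))
    (fun q ↦ hemisphereCoe (shrinkMap h0 h1 q)) p ξ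
  change grushinForm n (hemisphereCoe (shrinkMap h0 h1 p)) w w ≤ _
  have e5 : tailL n w = _ := e4
  rw [grushinForm_apply, sphereMetric_inner, e5, real_inner_self_eq_norm_sq]
  refine le_trans ?_ (hge _)
  set η : EuclideanSpace ℝ (Fin (m + n + 1)) :=
    mfderiv (𝓡 (m + n)) 𝓘(ℝ, EuclideanSpace ℝ (Fin (m + n + 1)))
      (fun q : Sphere (m + n) ↦ (q : EuclideanSpace ℝ (Fin (m + n + 1)))) p ξ with hη
  have hq := quadCoef_pos ha (sq_nonneg ‖fstL m n p‖)
  have hpos := one_sub_mul_pos h0 h1 p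
  have ha0 : 0 < a := by linarith
  -- This identity is the reason for the choice θ = 1 - 1/a.
  have hkey : (1 - (1 - a⁻¹) * ‖sndL m n p‖ ^ 2) = quadCoef a (‖fstL m n p‖ ^ 2) / a := by
    rw [quadCoef, sphere_fstL_norm_sq]
    field_simp
    ring
  rw [hemisphereCoe_shrinkMap, shrinkVec, consVec_zero, Real.sq_sqrt hpos.le, smul_apply,
    norm_smul, mul_pow, Real.norm_eq_abs, sq_abs, Real.sq_sqrt h0, hkey, inv_div, sndCoef]
  have h2 : 0 ≤ a / quadCoef a (‖fstL m n p‖ ^ 2) * ‖sndL m n η‖ ^ 2 := by positivity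
  have h3 : 0 ≤ c * ‖fstL m n η‖ ^ 2 := by positivity
  nlinarith

end Projection

section Lift

/-- The linear map `(t, Y) ↦ (t x, Y)`. -/
noncomputable def liftL (n : ℕ) (x : EuclideanSpace ℝ (Fin (m + 1))) :
    EuclideanSpace ℝ (Fin (n + 1)) →L[ℝ] EuclideanSpace ℝ (Fin (m + n + 1)) :=
  pairL m n ∘L (((EuclideanSpace.proj (0 : Fin (n + 1))).smulRight x).prod (tailL n))

variable {x : EuclideanSpace ℝ (Fin (m + 1))}

@[simp]
theorem fstL_liftL (v : EuclideanSpace ℝ (Fin (n + 1))) : fstL m n (liftL n x v) = v 0 • x := by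
  simp [liftL, pairL_apply]

@[simp]
theorem sndL_liftL (v : EuclideanSpace ℝ (Fin (n + 1))) : sndL m n (liftL n x v) = tailL n v := by
  simp [liftL, pairL_apply]

theorem norm_liftL (hx : ‖x‖ = 1) (v : EuclideanSpace ℝ (Fin (n + 1))) : ‖liftL n x v‖ = ‖v‖ := by
  rw [← pow_left_inj₀ (norm_nonneg _) (norm_nonneg _) two_ne_zero,
    norm_sq_eq_fstL_add_sndL, norm_sq_eq_head_add_tailL v, fstL_liftL, sndL_liftL, norm_smul, hx]
  simp

/-- The map `(t, Y) ↦ (t x, Y)` from the open hemisphere of `S^n` to `S^{m+n}`. -/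
noncomputable def liftMap (hx : ‖x‖ = 1) (P : openHemisphere n) : Sphere (m + n) :=
  ⟨liftL n x (hemisphereCoe P), by
    rw [mem_sphere_zero_iff_norm, norm_liftL hx, norm_hemisphereCoe]⟩

theorem contMDiff_liftMap (hx : ‖x‖ = 1) :
    ContMDiff (𝓡 n) (𝓡 (m + n)) 1 (liftMap (n := n) hx) :=
  ((liftL n x).contMDiff.comp contMDiff_hemisphereCoe).codRestrict_sphere fun P ↦
    (liftMap hx P).2

/-- The radial parts agree and h_λ ≤ cot r; in ambient coordinates this becomes Cauchy–Schwarz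
combined with tangency. -/
theorem sphereDist_liftMap_le {a : ℝ} (ha : 1 ≤ a) (hx : ‖x‖ = 1) (P Q : openHemisphere n) :
    sphereDist m n a ha (liftMap hx P) (liftMap hx Q) ≤ grushinDist n P Q := by
  refine riemDist_map_inducedMetric_le (contMDiff_liftMap hx) (fun P ξ ↦ ?_) P Q
  have hm : MDifferentiableAt (𝓡 n) 𝓘(ℝ, EuclideanSpace ℝ (Fin (n + 1))) hemisphereCoe P :=
    (contMDiff_hemisphereCoe (k := 1) P).mdifferentiableAt one_ne_zero
  have e1 := clm_mfderiv (liftL n x) hm ξ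
  have hin := inner_mfderiv_of_norm_eq_one norm_hemisphereCoe hm ξ
  rw [grushinMetric_inner]
  change ambientForm m n a (liftL n x (hemisphereCoe P))
    (mfderiv (𝓡 n) 𝓘(ℝ, EuclideanSpace ℝ (Fin (m + n + 1)))
      (fun q ↦ liftL n x (hemisphereCoe q)) P ξ)
    (mfderiv (𝓡 n) 𝓘(ℝ, EuclideanSpace ℝ (Fin (m + n + 1)))
      (fun q ↦ liftL n x (hemisphereCoe q)) P ξ) ≤ _
  rw [e1]
  set v : EuclideanSpace ℝ (Fin (n + 1)) :=
    mfderiv (𝓡 n) 𝓘(ℝ, EuclideanSpace ℝ (Fin (n + 1))) hemisphereCoe P ξ with hv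
  set w := hemisphereCoe P with hw
  have ht : 0 < w 0 := hemisphereCoe_pos P
  have hnw : ‖tailL n w‖ ^ 2 = 1 - w 0 ^ 2 := by
    have := hemisphere_head_sq P
    linarith
  have hn : ‖w 0 • x‖ ^ 2 = w 0 ^ 2 := by simp [norm_smul, hx]
  have hxx : ⟪w 0 • x, v 0 • x⟫_ℝ = w 0 * v 0 := by
    rw [inner_smul_left, inner_smul_right, real_inner_self_eq_norm_sq, hx]
    simp
  have hq := quadCoef_pos ha (sq_nonneg (w 0))
  have key := fstCoef_add_radialCoef ha (sq_nonneg (w 0))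
  rw [ambientForm_apply, grushinForm_apply, fstL_liftL, fstL_liftL, sndL_liftL, hn, hxx,
    real_inner_self_eq_norm_sq, real_inner_self_eq_norm_sq, norm_smul, hx, mul_one,
    Real.norm_eq_abs, sq_abs]
  rw [inner_eq_head_add_tailL] at hin
  have hcs : (w 0 * v 0) ^ 2 ≤ (1 - w 0 ^ 2) * ‖tailL n v‖ ^ 2 := by
    rw [eq_neg_of_add_eq_zero_left hin, neg_sq, ← hnw, ← mul_pow]
    exact sq_le_sq.2 ((abs_real_inner_le_norm _ _).trans (le_abs_self _))
  have hval : fstCoef a (w 0 ^ 2) * v 0 ^ 2 + sndCoef a (w 0 ^ 2) * ‖tailL n v‖ ^ 2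
      + radialCoef a (w 0 ^ 2) * (w 0 * v 0 * (w 0 * v 0)) =
      (v 0 ^ 2 + a * ‖tailL n v‖ ^ 2) / quadCoef a (w 0 ^ 2) := by
    rw [sndCoef, div_eq_mul_inv, div_eq_mul_inv, ← key]
    ring
  rw [hval, div_le_iff₀ hq, ← sub_nonneg]
  -- The dependence on `a` cancels in this difference.
  have : (w 0 ^ 2)⁻¹ * ‖tailL n v‖ ^ 2 * quadCoef a (w 0 ^ 2) - (v 0 ^ 2 + a * ‖tailL n v‖ ^ 2) =
      ((1 - w 0 ^ 2) * ‖tailL n v‖ ^ 2 - (w 0 * v 0) ^ 2) / w 0 ^ 2 := by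
    rw [quadCoef]
    field_simp
    ring
  rw [this]
  exact div_nonneg (by linarith) (sq_nonneg _)

end Lift

section Curves

/-- Points of the hemisphere on the same meridian. -/
theorem grushinDist_meridian_le (hn : n ≠ 0) {P Q : openHemisphere n} {c : ℝ} (hc0 : 0 ≤ c)
    (hc1 : c ≤ 1)
    (h : tailL n (hemisphereCoe Q) = c • tailL n (hemisphereCoe P)) :
    grushinDist n P Q ≤ ENNReal.ofReal (Real.arccos (c * ‖tailL n (hemisphereCoe P)‖)
      - Real.arccos ‖tailL n (hemisphereCoe P)‖) := by
  set Y := tailL n (hemisphereCoe P) with hY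
  -- At the pole, where Y = 0, any direction serves; one exists because n ≠ 0.
  obtain ⟨y, hy, hyY⟩ : ∃ y : EuclideanSpace ℝ (Fin n), ‖y‖ = 1 ∧ ‖Y‖ • y = Y := by
    by_cases h0 : Y = 0
    · refine ⟨EuclideanSpace.single ⟨0, Nat.pos_of_ne_zero hn⟩ 1, by simp, by simp [h0]⟩
    · refine ⟨‖Y‖⁻¹ • Y, by simp [norm_smul, h0], by simp [smul_smul, h0]⟩
  have hYlt : ‖Y‖ < 1 := by
    have h1 := hemisphere_head_sq P
    have h2 := pow_pos (hemisphereCoe_pos P) 2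
    rw [← hY] at h1
    nlinarith [norm_nonneg Y]
  have hvec : ∀ r, consVec (Real.sin r) (Real.cos r • y) ∈
      Metric.sphere (0 : EuclideanSpace ℝ (Fin (n + 1))) 1 := fun r ↦ by
    rw [mem_sphere_zero_iff_norm, ← pow_left_inj₀ (norm_nonneg _) zero_le_one two_ne_zero,
      norm_sq_eq_head_add_tailL, consVec_zero, tailL_consVec, norm_smul, hy]
    simp
  obtain ⟨ρ, hρ⟩ := exists_toOpens P
  -- The meridian, of unit speed in the parameter r. Values of `ρ` off the hemisphere play no role,
  -- since sin r > 0 on the interval used.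
  let γ : ℝ → openHemisphere n := fun r ↦ ρ ⟨_, hvec r⟩
  have hsin : ∀ t ∈ Set.Icc (Real.arccos ‖Y‖) (Real.arccos (c * ‖Y‖)), 0 < Real.sin t := by
    intro t ht
    refine Real.sin_pos_of_pos_of_lt_pi ((Real.arccos_pos.2 hYlt).trans_le ht.1) ?_
    have : Real.arccos (c * ‖Y‖) ≤ Real.pi / 2 := Real.arccos_le_pi_div_two.2 (by positivity)
    linarith [ht.2, Real.pi_pos]
  have hγ : ∀ t, 0 < Real.sin t →
      hemisphereCoe (γ t) = consVec (Real.sin t) (Real.cos t • y) := fun t ht ↦ by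
    have hmem : (⟨_, hvec t⟩ : Sphere n) ∈ openHemisphere n := by
      change 0 < consVec (Real.sin t) (Real.cos t • y) 0
      rwa [consVec_zero]
    change ((ρ (⟨_, hmem⟩ : openHemisphere n) : Sphere n) : EuclideanSpace ℝ (Fin (n + 1))) = _
    rw [hρ]
  have hle : Real.arccos ‖Y‖ ≤ Real.arccos (c * ‖Y‖) := Real.arccos_le_arccos (by
    nlinarith [norm_nonneg Y])
  have hP : γ (Real.arccos ‖Y‖) = P := by
    refine hemisphere_ext ?_
    rw [hγ _ (hsin _ ⟨le_rfl, hle⟩), tailL_consVec,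
      Real.cos_arccos (by linarith [norm_nonneg Y]) hYlt.le, hyY]
  have hQ : γ (Real.arccos (c * ‖Y‖)) = Q := by
    refine hemisphere_ext ?_
    rw [hγ _ (hsin _ ⟨hle, le_rfl⟩), tailL_consVec,
      Real.cos_arccos (by nlinarith [norm_nonneg Y]) (by nlinarith [norm_nonneg Y]), mul_smul, hyY,
      h]
  have hd : ∀ t, HasDerivAt (fun r ↦ consVec (Real.sin r) (Real.cos r • y))
      (consVec (Real.cos t) (-Real.sin t • y)) t := fun t ↦
    (consL n).hasFDerivAt.comp_hasDerivAt t
      ((Real.hasDerivAt_sin t).prodMk ((Real.hasDerivAt_cos t).smul_const y))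
  have hsm : ContDiff ℝ 1 fun r ↦ consVec (Real.sin r) (Real.cos r • y) :=
    (consL n).contDiff.comp (Real.contDiff_sin.prodMk (Real.contDiff_cos.smul contDiff_const))
  have hγc : ∀ t ∈ Set.Icc (Real.arccos ‖Y‖) (Real.arccos (c * ‖Y‖)),
      ContMDiffAt 𝓘(ℝ, ℝ) (𝓡 n) 1 γ t := by
    intro t ht
    have h1 : ContMDiff 𝓘(ℝ, ℝ) (𝓡 n) 1 fun r ↦ (⟨_, hvec r⟩ : Sphere n) :=
      (contMDiff_iff_contDiff.2 hsm).codRestrict_sphere hvec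
    have hmem : (⟨_, hvec t⟩ : Sphere n) ∈ openHemisphere n := by
      change 0 < consVec (Real.sin t) (Real.cos t • y) 0
      rw [consVec_zero]
      exact hsin t ht
    exact (contMDiffAt_toOpens hρ ⟨_, hmem⟩).comp t (h1 t)
  have hfin : grushinDist n (γ (Real.arccos ‖Y‖)) (γ (Real.arccos (c * ‖Y‖))) ≤
      ENNReal.ofReal (1 * (Real.arccos (c * ‖Y‖) - Real.arccos ‖Y‖)) := by
    refine riemDist_inducedMetric_le_of_curve hle zero_le_one hγc
      (γ' := fun t ↦ consVec (Real.cos t) (-Real.sin t • y)) ?_ ?_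
    · intro t ht
      refine (hd t).congr_of_eventuallyEq ?_
      have : ∀ᶠ s in 𝓝 t, 0 < Real.sin s :=
        Real.continuous_sin.continuousAt.eventually (lt_mem_nhds (hsin t ht))
      filter_upwards [this] with s hs using hγ s hs
    · intro t ht
      have := hsin t ht
      rw [hγ t this, grushinForm_apply, consVec_zero, tailL_consVec, real_inner_self_eq_norm_sq,
        norm_smul, hy]
      simp [this.ne']
  rwa [hP, hQ, one_mul] at hfin

/-- This is f_λ² ≤ 1/λ, the collapse of the fibres: a s² ≤ 1 + a s because s ≤ 1. -/
theorem fstCoef_mul_sq_le {a s : ℝ} (ha : 1 ≤ a) (hs0 : 0 ≤ s) (hs1 : s ≤ 1) :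
    fstCoef a s * s ≤ (√a)⁻¹ := by
  have h1 : 0 < √(1 + a * s) := sqrt_one_add_pos ha hs0
  have h2 : 0 < √a := Real.sqrt_pos.2 (by linarith)
  rw [fstCoef, ← div_eq_inv_mul, div_le_iff₀ h1, ← div_eq_inv_mul, le_div_iff₀ h2]
  refine Real.le_sqrt_of_sq_le ?_
  rw [mul_pow, Real.sq_sqrt (by linarith)]
  nlinarith [mul_nonneg hs0 (sub_nonneg.2 hs1)]

/-- Two points of a fibre `S^m` over the hemisphere, in orthogonal directions. -/
theorem sphereDist_liftMap_orthogonal_le {a : ℝ} (ha : 1 ≤ a) {x z : EuclideanSpace ℝ (Fin (m + 1))}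
    (hx : ‖x‖ = 1) (hz : ‖z‖ = 1) (hxz : ⟪x, z⟫_ℝ = 0) (P : openHemisphere n) :
    sphereDist m n a ha (liftMap hx P) (liftMap hz P) ≤
      ENNReal.ofReal (√(√a)⁻¹ * (Real.pi / 2)) := by
  set t := hemisphereCoe P 0 with ht
  have hdir : ∀ r, ‖Real.cos r • x + Real.sin r • z‖ = 1 := fun r ↦ by
    rw [← pow_left_inj₀ (norm_nonneg _) zero_le_one two_ne_zero, norm_sq_smul_add_smul hx hxz, hz]
    simp
  let γ : ℝ → Sphere (m + n) := fun r ↦ liftMap (hdir r) P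
  have hγ : ∀ r, (γ r : EuclideanSpace ℝ (Fin (m + n + 1))) =
      pairL m n (t • (Real.cos r • x + Real.sin r • z), tailL n (hemisphereCoe P)) := fun r ↦ rfl
  have hsm : ContDiff ℝ 1 fun r ↦ (γ r : EuclideanSpace ℝ (Fin (m + n + 1))) := by
    simp only [hγ]
    fun_prop
  have hγc : ContMDiff 𝓘(ℝ, ℝ) (𝓡 (m + n)) 1 γ :=
    (contMDiff_iff_contDiff.2 hsm).codRestrict_sphere fun r ↦ (γ r).2
  have hfin : sphereDist m n a ha (γ 0) (γ (Real.pi / 2)) ≤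
      ENNReal.ofReal (√(√a)⁻¹ * (Real.pi / 2 - 0)) := by
    refine riemDist_inducedMetric_le_of_curve (by positivity) (by positivity)
      (fun t _ ↦ hγc t)
      (γ' := fun r ↦ pairL m n (t • (-Real.sin r • x + Real.cos r • z), 0)) ?_ ?_
    · intro r _
      simp only [hγ]
      exact (pairL m n).hasFDerivAt.comp_hasDerivAt r
        (((((Real.hasDerivAt_cos r).smul_const x).add
          ((Real.hasDerivAt_sin r).smul_const z)).const_smul t).prodMk (hasDerivAt_const r _))
    · intro r _
      have h1 : ‖-Real.sin r • x + Real.cos r • z‖ = 1 := by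
        rw [← pow_left_inj₀ (norm_nonneg _) zero_le_one two_ne_zero,
          norm_sq_smul_add_smul hx hxz, hz]
        simp
      have h2 : ⟪Real.cos r • x + Real.sin r • z, -Real.sin r • x + Real.cos r • z⟫_ℝ = 0 := by
        simp only [inner_add_left, inner_add_right, inner_smul_left, inner_smul_right, hxz,
          real_inner_comm x z, real_inner_self_eq_norm_sq, hx, hz]
        simp
        ring
      -- The velocity is orthogonal to `X`, so the radial correction does not contribute.
      have h3 : ⟪t • (Real.cos r • x + Real.sin r • z),
          t • (-Real.sin r • x + Real.cos r • z)⟫_ℝ = 0 := by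
        rw [inner_smul_left, inner_smul_right, h2]
        simp
      have ht1 : t ^ 2 ≤ 1 := by
        rw [ht, hemisphere_head_sq]
        linarith [sq_nonneg ‖tailL n (hemisphereCoe P)‖]
      rw [Real.sq_sqrt (by positivity), hγ, pairL_apply, pairL_apply, ambientForm_apply, fstL_pair,
        fstL_pair, sndL_pair, h3, real_inner_self_eq_norm_sq, norm_smul, norm_smul, hdir, h1]
      have := fstCoef_mul_sq_le ha (sq_nonneg t) ht1
      simpa using this
  have h0 : γ 0 = liftMap hx P := Subtype.ext (by simp [γ, liftMap])
  have h1 : γ (Real.pi / 2) = liftMap hz P := Subtype.ext (by simp [γ, liftMap])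
  rwa [h0, h1, sub_zero] at hfin

end Curves

end Maps

/-! ### Riemannian manifolds as metric spaces, and their completions. -/

section RiemannianSpace

open Bundle Manifold

variable {E : Type*} [NormedAddCommGroup E] [NormedSpace ℝ E]
  {M : Type*} [TopologicalSpace M] [ChartedSpace E M] [IsManifold 𝓘(ℝ, E) ∞ M]

theorem riemDist_comm (g : SmoothMetric E M) (x y : M) : riemDist g x y = riemDist g y x := by
  let : RiemannianBundle (fun x : M ↦ TangentSpace 𝓘(ℝ, E) x) := ⟨g.toRiemannianMetric⟩
  exact riemannianEDist_comm

theorem riemDist_triangle (g : SmoothMetric E M) (x y z : M) :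
    riemDist g x z ≤ riemDist g x y + riemDist g y z := by
  let : RiemannianBundle (fun x : M ↦ TangentSpace 𝓘(ℝ, E) x) := ⟨g.toRiemannianMetric⟩
  exact riemannianEDist_triangle

theorem eventually_riemDist_lt (g : SmoothMetric E M) (x : M) {c : ℝ≥0∞} (hc : 0 < c) :
    ∀ᶠ y in 𝓝 x, riemDist g x y < c := by
  let : RiemannianBundle (fun x : M ↦ TangentSpace 𝓘(ℝ, E) x) := ⟨g.toRiemannianMetric⟩
  have : IsContinuousRiemannianBundle E (fun x : M ↦ TangentSpace 𝓘(ℝ, E) x) :=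
    ⟨g.inner, g.contMDiff.continuous, fun _ _ _ ↦ rfl⟩
  exact eventually_riemannianEDist_lt 𝓘(ℝ, E) x hc

/-- The manifold `M` as a metric space, with the Riemannian distance of `g`. -/
def RiemSpace (g : SmoothMetric E M) (_ : ∀ x y, riemDist g x y ≠ ⊤) : Type _ := M

variable {g : SmoothMetric E M} {h : ∀ x y, riemDist g x y ≠ ⊤}

/-- The extended distance of `RiemSpace g h`. -/
@[reducible] noncomputable def riemSpaceEMetric [T3Space M] (g : SmoothMetric E M) :
    EMetricSpace M :=
  letI : RiemannianBundle (fun x : M ↦ TangentSpace 𝓘(ℝ, E) x) := ⟨g.toRiemannianMetric⟩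
  haveI : IsContinuousRiemannianBundle E (fun x : M ↦ TangentSpace 𝓘(ℝ, E) x) :=
    ⟨g.inner, g.contMDiff.continuous, fun _ _ _ ↦ rfl⟩
  EMetricSpace.ofRiemannianMetric 𝓘(ℝ, E) M

noncomputable instance RiemSpace.instMetricSpace [T3Space M] : MetricSpace (RiemSpace g h) :=
  letI : EMetricSpace (RiemSpace g h) := riemSpaceEMetric (M := M) g
  EMetricSpace.toMetricSpace h

/-- The metric structure is built on the topology of the manifold, so compactness carries over
unchanged. -/
instance RiemSpace.instCompactSpace [T3Space M] [hM : CompactSpace M] :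
    CompactSpace (RiemSpace g h) := hM

instance RiemSpace.instNonempty [hM : Nonempty M] : Nonempty (RiemSpace g h) := hM

theorem isRiemannianSpace_rep [T3Space M] [CompactSpace M] [Nonempty M] :
    IsRiemannianSpace g (GromovHausdorff.toGHSpace (RiemSpace g h)).Rep := by
  obtain ⟨e⟩ := GromovHausdorff.toGHSpace_eq_toGHSpace_iff_isometryEquiv.1
    (GromovHausdorff.GHSpace.toGHSpace_rep (GromovHausdorff.toGHSpace (RiemSpace g h)))
  exact ⟨e.toEquiv, fun a b ↦ (e.isometry.edist_eq a b).symm⟩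

theorem isMetricCompletion_of_isometryEquiv [T3Space M] {X : Type*} [MetricSpace X]
    (e : UniformSpace.Completion (RiemSpace g h) ≃ᵢ X) : IsMetricCompletion g X := by
  let c : RiemSpace g h → UniformSpace.Completion (RiemSpace g h) := fun x ↦ x
  have h1 : DenseRange fun x ↦ e (c x) :=
    e.surjective.denseRange.comp UniformSpace.Completion.denseRange_coe e.continuous
  have h2 : ∀ a b : RiemSpace g h, edist (e (c a)) (e (c b)) = riemDist g a b := fun a b ↦ by
    rw [e.isometry.edist_eq]
    exact UniformSpace.Completion.edist_eq a b
  exact ⟨e.completeSpace_iff.1 inferInstance, fun x ↦ e (c x), h1, h2⟩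

theorem compactSpace_completion {α : Type*} [UniformSpace α]
    (h : TotallyBounded (Set.univ : Set α)) :
    CompactSpace (UniformSpace.Completion α) := by
  have h1 := (h.image (UniformSpace.Completion.uniformContinuous_coe α)).closure
  rw [Set.image_univ, UniformSpace.Completion.denseRange_coe.closure_range] at h1
  exact ⟨h1.isCompact_of_isClosed isClosed_univ⟩

end RiemannianSpace

/-! ### Almost isometry of the projection to the hemisphere. -/

section Comparison

variable {m n : ℕ}

/-- If one component vanishes, rotate towards an arbitrary unit vector of that factor. The curve
yields density of the generic set and is the path along which the Ricci bound is passed to the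
limit. -/
theorem exists_path_generic (hn : n ≠ 0) (p : Sphere (m + n)) :
    ∃ γ : ℝ → Sphere (m + n), Continuous γ ∧ γ 0 = p ∧
      ∀ᶠ t in 𝓝[>] (0 : ℝ), fstL m n (γ t) ≠ 0 ∧ sndL m n (γ t) ≠ 0 := by
  have hp := norm_sq_eq_fstL_add_sndL (m := m) (n := n) (p : EuclideanSpace ℝ (Fin (m + n + 1)))
  rw [norm_eq_of_mem_sphere] at hp
  have key : ∀ (x : EuclideanSpace ℝ (Fin (m + 1))) (y : EuclideanSpace ℝ (Fin n)), ‖x‖ = 1 →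
      ‖y‖ = 1 → ∀ c s : ℝ → ℝ, Continuous c → Continuous s → (∀ t, s t ^ 2 + c t ^ 2 = 1) →
      (∀ᶠ t in 𝓝[>] (0 : ℝ), s t ≠ 0 ∧ c t ≠ 0) →
      (p : EuclideanSpace ℝ (Fin (m + n + 1))) = pair (s 0 • x) (c 0 • y) →
      ∃ γ : ℝ → Sphere (m + n), Continuous γ ∧ γ 0 = p ∧
        ∀ᶠ t in 𝓝[>] (0 : ℝ), fstL m n (γ t) ≠ 0 ∧ sndL m n (γ t) ≠ 0 := by
    intro x y hx hy c s hc hs hcs hev h0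
    refine ⟨fun t ↦ ⟨pair (s t • x) (c t • y), ?_⟩, ?_, Subtype.ext h0.symm, ?_⟩
    · rw [mem_sphere_zero_iff_norm, ← pow_left_inj₀ (norm_nonneg _) zero_le_one two_ne_zero,
        norm_sq_eq_fstL_add_sndL, fstL_pair, sndL_pair, norm_smul, norm_smul, hx, hy]
      simp [hcs]
    · refine Continuous.subtype_mk ?_ _
      exact (pairL m n).continuous.comp ((hs.smul continuous_const).prodMk
        (hc.smul continuous_const))
    · filter_upwards [hev] with t ht
      have hx0 : x ≠ 0 := norm_ne_zero_iff.1 (by simp [hx])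
      have hy0 : y ≠ 0 := norm_ne_zero_iff.1 (by simp [hy])
      simp [ht.1, ht.2, hx0, hy0]
  have hev : ∀ᶠ t in 𝓝[>] (0 : ℝ), Real.sin t ≠ 0 ∧ Real.cos t ≠ 0 := by
    have : ∀ᶠ t in 𝓝[>] (0 : ℝ), t ∈ Set.Ioo 0 (Real.pi / 2) :=
      Ioo_mem_nhdsGT (by positivity)
    filter_upwards [this] with t ht
    exact ⟨(Real.sin_pos_of_pos_of_lt_pi ht.1 (by linarith [ht.2, Real.pi_pos])).ne',
      (Real.cos_pos_of_mem_Ioo ⟨by linarith [ht.1, Real.pi_pos], ht.2⟩).ne'⟩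
  by_cases h1 : fstL m n p = 0
  · refine key (EuclideanSpace.single 0 1) (sndL m n p) (by simp) ?_ Real.cos Real.sin
      Real.continuous_cos Real.continuous_sin Real.sin_sq_add_cos_sq hev ?_
    · rw [h1] at hp
      rw [← pow_left_inj₀ (norm_nonneg _) zero_le_one two_ne_zero]
      simpa using hp.symm
    · exact ext_fstL_sndL (by simp [h1]) (by simp)
  by_cases h2 : sndL m n p = 0
  · refine key (fstL m n p) (EuclideanSpace.single ⟨0, Nat.pos_of_ne_zero hn⟩ 1) ?_ (by simp)
      Real.sin Real.cos Real.continuous_sin Real.continuous_cos Real.cos_sq_add_sin_sq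
      (hev.mono fun t ht ↦ ht.symm) ?_
    · rw [h2] at hp
      rw [← pow_left_inj₀ (norm_nonneg _) zero_le_one two_ne_zero]
      simpa using hp.symm
    · exact ext_fstL_sndL (by simp) (by simp [h2])
  · exact ⟨fun _ ↦ p, continuous_const, rfl, Filter.Eventually.of_forall fun _ ↦ ⟨h1, h2⟩⟩

theorem exists_generic_near (hn : n ≠ 0) (p : Sphere (m + n)) {s : Set (Sphere (m + n))}
    (hs : s ∈ 𝓝 p) : ∃ q ∈ s, fstL m n q ≠ 0 := by
  obtain ⟨γ, hγ, h0, hev⟩ := exists_path_generic hn p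
  have h1 : ∀ᶠ t in 𝓝[>] (0 : ℝ), γ t ∈ s := by
    refine (hγ.tendsto' 0 p h0).mono_left nhdsWithin_le_nhds |>.eventually hs
  obtain ⟨t, ht1, ht2⟩ := (h1.and hev).exists
  exact ⟨γ t, ht1, ht2.1⟩

/-- The projection `(X, Y) ↦ (|X|, Y)` to the open hemisphere. -/
noncomputable def baseMap (p : Sphere (m + n)) (hp : fstL m n p ≠ 0) : openHemisphere n :=
  ⟨⟨consVec ‖fstL m n p‖ (sndL m n p), by
    have h := norm_sq_eq_fstL_add_sndL (m := m) (n := n) (p : EuclideanSpace ℝ (Fin (m + n + 1)))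
    rw [mem_sphere_zero_iff_norm, ← pow_left_inj₀ (norm_nonneg _) zero_le_one two_ne_zero,
      norm_sq_eq_head_add_tailL, consVec_zero, tailL_consVec, ← h, norm_eq_of_mem_sphere]⟩, by
    change 0 < consVec ‖fstL m n p‖ (sndL m n p) 0
    rw [consVec_zero]
    exact norm_pos_iff.2 hp⟩

theorem hemisphereCoe_baseMap (p : Sphere (m + n)) (hp : fstL m n p ≠ 0) :
    hemisphereCoe (baseMap p hp) = consVec ‖fstL m n p‖ (sndL m n p) := rfl

theorem exists_liftMap_baseMap (p : Sphere (m + n)) (hp : fstL m n p ≠ 0) :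
    ∃ (x : EuclideanSpace ℝ (Fin (m + 1))) (hx : ‖x‖ = 1), liftMap hx (baseMap p hp) = p := by
  refine ⟨‖fstL m n p‖⁻¹ • fstL m n p, by simp [norm_smul, hp], Subtype.ext ?_⟩
  change liftL n _ (hemisphereCoe (baseMap p hp)) = _
  rw [hemisphereCoe_baseMap]
  exact ext_fstL_sndL (by simp [smul_smul, hp]) (by simp)

theorem baseMap_liftMap {x : EuclideanSpace ℝ (Fin (m + 1))} (hx : ‖x‖ = 1) (P : openHemisphere n)
    (h : fstL m n (liftMap hx P) ≠ 0) : baseMap (liftMap hx P) h = P := by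
  refine hemisphere_ext ?_
  rw [hemisphereCoe_baseMap, tailL_consVec]
  exact sndL_liftL _

theorem fstL_liftMap_ne_zero {x : EuclideanSpace ℝ (Fin (m + 1))} (hx : ‖x‖ = 1)
    (P : openHemisphere n) : fstL m n (liftMap hx P) ≠ 0 := by
  change fstL m n (liftL n x (hemisphereCoe P)) ≠ 0
  have hx0 : x ≠ 0 := norm_ne_zero_iff.1 (by simp [hx])
  simp [hx0, (hemisphereCoe_pos P).ne']

/-- Two vectors span at most a plane in dimension m + 1 ≥ 3. Passing through `w` joins any two
points of a fibre by two quarter circles, whatever the angle between `x` and `z`. -/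
theorem exists_orthogonal_unit (hm : 2 ≤ m) (x z : EuclideanSpace ℝ (Fin (m + 1))) :
    ∃ w : EuclideanSpace ℝ (Fin (m + 1)), ‖w‖ = 1 ∧ ⟪x, w⟫_ℝ = 0 ∧ ⟪w, z⟫_ℝ = 0 := by
  let K : Submodule ℝ (EuclideanSpace ℝ (Fin (m + 1))) := Submodule.span ℝ {x, z}
  have h1 : Module.finrank ℝ K ≤ 2 := by
    have := finrank_span_le_card (R := ℝ) ({x, z} : Set (EuclideanSpace ℝ (Fin (m + 1))))
    exact this.trans (by
      classical
      rw [Set.toFinset_insert, Set.toFinset_singleton]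
      exact Finset.card_le_two)
  have h2 := K.finrank_add_finrank_orthogonal
  rw [finrank_euclideanSpace, Fintype.card_fin] at h2
  have h3 : 0 < Module.finrank ℝ Kᗮ := by omega
  have : Nontrivial Kᗮ := Module.finrank_pos_iff.1 h3
  obtain ⟨w, hw⟩ := exists_norm_eq Kᗮ zero_le_one
  refine ⟨w, by simpa using hw, ?_, ?_⟩
  · exact (K.mem_orthogonal w).1 w.2 x (Submodule.subset_span (by simp))
  · exact (K.mem_orthogonal' w).1 w.2 z (Submodule.subset_span (by simp))

/-- A bound for the diameter of the fibres of `baseMap`. -/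
noncomputable def fibreBound (a : ℝ) : ℝ := √(√a)⁻¹ * Real.pi

/-- Follow the lift of a path in the hemisphere with `x` fixed, then turn `x` to `w` and `w` to `z`
inside the last fibre. -/
theorem sphereDist_le (hm : 2 ≤ m) {a : ℝ} (ha : 1 ≤ a) (p q : Sphere (m + n))
    (hp : fstL m n p ≠ 0) (hq : fstL m n q ≠ 0) :
    sphereDist m n a ha p q ≤
      grushinDist n (baseMap p hp) (baseMap q hq) + ENNReal.ofReal (fibreBound a) := by
  obtain ⟨x, hx, hxp⟩ := exists_liftMap_baseMap p hp
  obtain ⟨z, hz, hzq⟩ := exists_liftMap_baseMap q hq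
  obtain ⟨w, hw, hxw, hwz⟩ := exists_orthogonal_unit hm x z
  have h1 := sphereDist_liftMap_le ha hx (baseMap p hp) (baseMap q hq)
  have h2 := sphereDist_liftMap_orthogonal_le ha hx hw hxw (baseMap q hq)
  have h3 := sphereDist_liftMap_orthogonal_le ha hw hz hwz (baseMap q hq)
  rw [hxp] at h1
  rw [hzq] at h3
  have h4 : ENNReal.ofReal (fibreBound a) = ENNReal.ofReal (√(√a)⁻¹ * (Real.pi / 2)) +
      ENNReal.ofReal (√(√a)⁻¹ * (Real.pi / 2)) := by
    rw [← ENNReal.ofReal_add (by positivity) (by positivity), fibreBound]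
    ring_nf
  rw [h4]
  calc _ ≤ sphereDist m n a ha p (liftMap hx (baseMap q hq)) +
        (sphereDist m n a ha (liftMap hx (baseMap q hq)) (liftMap hw (baseMap q hq)) +
        sphereDist m n a ha (liftMap hw (baseMap q hq)) q) :=
      (riemDist_triangle _ _ _ _).trans (add_le_add_right (riemDist_triangle _ _ _ _) _)
    _ ≤ _ := add_le_add h1 (add_le_add h2 h3)

/-- Replace both projections by the shrunk points, each at cost `ε` along a meridian; between the
shrunk points the 1-Lipschitz bound applies. -/
theorem grushinDist_le (hn : n ≠ 0) {a : ℝ} (ha : 1 ≤ a) (p q : Sphere (m + n))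
    (hp : fstL m n p ≠ 0) (hq : fstL m n q ≠ 0) {ε : ℝ}
    (hε : ∀ c ∈ Set.Icc (0 : ℝ) 1, Real.arccos (√(1 - a⁻¹) * c) - Real.arccos c ≤ ε) :
    grushinDist n (baseMap p hp) (baseMap q hq) ≤
      sphereDist m n a ha p q + (ENNReal.ofReal ε + ENNReal.ofReal ε) := by
  have hai : 0 < a⁻¹ := by positivity
  have h0 : 0 ≤ 1 - a⁻¹ := sub_nonneg.2 (inv_le_one_of_one_le₀ ha)
  have h1 : 1 - a⁻¹ < 1 := by linarith
  have key : ∀ (r : Sphere (m + n)) (hr : fstL m n r ≠ 0),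
      grushinDist n (baseMap r hr) (shrinkMap h0 h1 r) ≤ ENNReal.ofReal ε := by
    intro r hr
    refine (grushinDist_meridian_le hn (Real.sqrt_nonneg (1 - a⁻¹))
      (Real.sqrt_le_one.2 h1.le) ?_).trans (ENNReal.ofReal_le_ofReal (hε _ ⟨norm_nonneg _, ?_⟩))
    · rw [hemisphereCoe_baseMap, hemisphereCoe_shrinkMap, shrinkVec, tailL_consVec, tailL_consVec]
    · have := hemisphere_head_sq (baseMap r hr)
      have h2 := sq_nonneg (hemisphereCoe (baseMap r hr) 0)
      nlinarith [norm_nonneg (tailL n (hemisphereCoe (baseMap r hr)))]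
  calc _ ≤ grushinDist n (baseMap p hp) (shrinkMap h0 h1 p) +
        (grushinDist n (shrinkMap h0 h1 p) (shrinkMap h0 h1 q) +
        grushinDist n (shrinkMap h0 h1 q) (baseMap q hq)) :=
      (riemDist_triangle _ _ _ _).trans (add_le_add_right (riemDist_triangle _ _ _ _) _)
    _ ≤ ENNReal.ofReal ε + (sphereDist m n a ha p q + ENNReal.ofReal ε) := by
      refine add_le_add (key p hp) (add_le_add (grushinDist_shrinkMap_le ha h0 h1 p q) ?_)
      rw [grushinDist, riemDist_comm]
      exact key q hq
    _ = _ := by ring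

theorem grushinDist_ne_top (hn : n ≠ 0) (P Q : openHemisphere n) : grushinDist n P Q ≠ ⊤ := by
  -- Every point is joined to the pole by its meridian, the case c = 0 of `grushinDist_meridian_le`.
  let O : openHemisphere n := ⟨⟨consVec 1 0, by
    rw [mem_sphere_zero_iff_norm, ← pow_left_inj₀ (norm_nonneg _) zero_le_one two_ne_zero,
      norm_sq_eq_head_add_tailL, consVec_zero, tailL_consVec]
    simp⟩, by
    change 0 < consVec (1 : ℝ) (0 : EuclideanSpace ℝ (Fin n)) 0
    rw [consVec_zero]
    exact one_pos⟩
  have hO : ∀ R : openHemisphere n, grushinDist n R O ≠ ⊤ := fun R ↦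
    ne_top_of_le_ne_top ENNReal.ofReal_ne_top
      (grushinDist_meridian_le hn le_rfl zero_le_one (by
        rw [zero_smul]
        exact tailL_consVec _ _))
  refine ne_top_of_le_ne_top (ENNReal.add_ne_top.2 ⟨hO P, hO Q⟩) ?_
  refine (riemDist_triangle _ P O Q).trans (le_of_eq ?_)
  rw [riemDist_comm _ O Q]
  rfl

theorem sphereDist_ne_top (hn : n ≠ 0) (hm : 2 ≤ m) {a : ℝ} (ha : 1 ≤ a) (p q : Sphere (m + n)) :
    sphereDist m n a ha p q ≠ ⊤ := by
  obtain ⟨p', hp', hp0⟩ := exists_generic_near hn p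
    (eventually_riemDist_lt (sphereMetric m n a ha) p one_pos)
  obtain ⟨q', hq', hq0⟩ := exists_generic_near hn q
    (eventually_riemDist_lt (sphereMetric m n a ha) q one_pos)
  have h1 : sphereDist m n a ha p p' ≠ ⊤ := (hp'.trans ENNReal.one_lt_top).ne
  have h2 : sphereDist m n a ha q' q ≠ ⊤ := by
    rw [sphereDist, riemDist_comm]
    exact (hq'.trans ENNReal.one_lt_top).ne
  have h3 : sphereDist m n a ha p' q' ≠ ⊤ := ne_top_of_le_ne_top
    (ENNReal.add_ne_top.2 ⟨grushinDist_ne_top hn _ _, ENNReal.ofReal_ne_top⟩)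
    (sphereDist_le hm ha p' q' hp0 hq0)
  exact ne_top_of_le_ne_top (ENNReal.add_ne_top.2 ⟨h1, ENNReal.add_ne_top.2 ⟨h3, h2⟩⟩)
    ((riemDist_triangle _ p p' q).trans (add_le_add_right (riemDist_triangle _ _ _ _) _))

/-- Uniform continuity of arccos on [0, 1] makes the estimate uniform up to the equator, where the
derivative of arccos blows up. -/
theorem eventually_arccos_sub_le {ε : ℝ} (hε : 0 < ε) :
    ∀ᶠ a : ℝ in Filter.atTop, ∀ c ∈ Set.Icc (0 : ℝ) 1,
      Real.arccos (√(1 - a⁻¹) * c) - Real.arccos c ≤ ε := by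
  have huc := (isCompact_Icc (a := (0 : ℝ)) (b := 1)).uniformContinuousOn_of_continuous
    Real.continuous_arccos.continuousOn
  obtain ⟨δ, hδ, h⟩ := Metric.uniformContinuousOn_iff.1 huc ε hε
  have ht : Filter.Tendsto (fun a : ℝ ↦ √(1 - a⁻¹)) Filter.atTop (𝓝 1) := by
    have := (tendsto_inv_atTop_zero (𝕜 := ℝ)).const_sub 1
    simpa using this.sqrt
  filter_upwards [ht.eventually (Metric.ball_mem_nhds 1 hδ), Filter.eventually_ge_atTop 1]
    with a ha ha1 c hc
  have h1 : √(1 - a⁻¹) ≤ 1 := Real.sqrt_le_one.2 (by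
    have : 0 < a⁻¹ := by positivity
    linarith)
  have hs := Real.sqrt_nonneg (1 - a⁻¹)
  rw [Real.dist_eq, abs_lt] at ha
  refine (le_abs_self _).trans (h _ ⟨mul_nonneg hs hc.1, mul_le_one₀ h1 hc.1 hc.2⟩ c hc ?_).le
  rw [Real.dist_eq, abs_lt]
  constructor <;> nlinarith [hc.1, hc.2]

theorem tendsto_fibreBound : Filter.Tendsto fibreBound Filter.atTop (𝓝 0) := by
  have h1 : Filter.Tendsto (fun a : ℝ ↦ √(√a)⁻¹) Filter.atTop (𝓝 0) := by
    have := (tendsto_inv_atTop_zero.comp Real.tendsto_sqrt_atTop).sqrt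
    rwa [Real.sqrt_zero] at this
  have h2 := h1.mul_const Real.pi
  rwa [zero_mul] at h2

end Comparison

/-! ### Compactness of the Grushin hemisphere and Gromov–Hausdorff convergence. -/

section Limit

open GromovHausdorff

variable {m n : ℕ}

/-- The sphere as a metric space, with the Riemannian distance of `sphereMetric m n a ha`. -/
abbrev SphereSpace (hn : n ≠ 0) (hm : 2 ≤ m) {a : ℝ} (ha : 1 ≤ a) : Type :=
  RiemSpace (sphereMetric m n a ha) (sphereDist_ne_top hn hm ha)

/-- The open hemisphere as a metric space, with the Riemannian distance of the Grushin metric. -/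
abbrev GrushinSpace (hn : n ≠ 0) : Type := RiemSpace (grushinMetric n) (grushinDist_ne_top hn)

instance (k : ℕ) : Nonempty (Sphere k) := ⟨⟨EuclideanSpace.single 0 1, by simp⟩⟩

theorem nonempty_openHemisphere (n : ℕ) : Nonempty (openHemisphere n) :=
  ⟨⟨⟨EuclideanSpace.single 0 1, by simp⟩, by
    change 0 < (EuclideanSpace.single (0 : Fin (n + 1)) (1 : ℝ)) 0
    simp⟩⟩

noncomputable instance (hn : n ≠ 0) : MetricSpace (GrushinSpace hn) :=
  RiemSpace.instMetricSpace (g := grushinMetric n)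

noncomputable instance (hn : n ≠ 0) (hm : 2 ≤ m) {a : ℝ} (ha : 1 ≤ a) :
    MetricSpace (SphereSpace hn hm ha) :=
  RiemSpace.instMetricSpace (g := sphereMetric m n a ha)

instance (hn : n ≠ 0) (hm : 2 ≤ m) {a : ℝ} (ha : 1 ≤ a) : CompactSpace (SphereSpace hn hm ha) :=
  RiemSpace.instCompactSpace (g := sphereMetric m n a ha)

instance (hn : n ≠ 0) (hm : 2 ≤ m) {a : ℝ} (ha : 1 ≤ a) : Nonempty (SphereSpace hn hm ha) :=
  RiemSpace.instNonempty (g := sphereMetric m n a ha)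

theorem dist_le_of_riemDist_le (hn : n ≠ 0) (hm : 2 ≤ m) {a : ℝ} (ha : 1 ≤ a)
    (p q : Sphere (m + n)) (hp : fstL m n p ≠ 0) (hq : fstL m n q ≠ 0) :
    (sphereDist m n a ha p q).toReal ≤
      (grushinDist n (baseMap p hp) (baseMap q hq)).toReal + fibreBound a := by
  have h := ENNReal.toReal_mono (ENNReal.add_ne_top.2
    ⟨grushinDist_ne_top hn _ _, ENNReal.ofReal_ne_top⟩) (sphereDist_le hm ha p q hp hq)
  rwa [ENNReal.toReal_add (grushinDist_ne_top hn _ _) ENNReal.ofReal_ne_top,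
    ENNReal.toReal_ofReal (by unfold fibreBound; positivity)] at h

theorem toReal_grushinDist_le (hn : n ≠ 0) (hm : 2 ≤ m) {a : ℝ} (ha : 1 ≤ a)
    (p q : Sphere (m + n)) (hp : fstL m n p ≠ 0) (hq : fstL m n q ≠ 0) {ε : ℝ} (h0 : 0 ≤ ε)
    (hε : ∀ c ∈ Set.Icc (0 : ℝ) 1, Real.arccos (√(1 - a⁻¹) * c) - Real.arccos c ≤ ε) :
    (grushinDist n (baseMap p hp) (baseMap q hq)).toReal ≤
      (sphereDist m n a ha p q).toReal + 2 * ε := by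
  have h := ENNReal.toReal_mono (ENNReal.add_ne_top.2
    ⟨sphereDist_ne_top hn hm ha p q, ENNReal.add_ne_top.2 ⟨ENNReal.ofReal_ne_top,
      ENNReal.ofReal_ne_top⟩⟩) (grushinDist_le hn ha p q hp hq hε)
  rwa [ENNReal.toReal_add (sphereDist_ne_top hn hm ha p q) (ENNReal.add_ne_top.2
    ⟨ENNReal.ofReal_ne_top, ENNReal.ofReal_ne_top⟩), ENNReal.toReal_add ENNReal.ofReal_ne_top
    ENNReal.ofReal_ne_top, ENNReal.toReal_ofReal h0, ← two_mul] at h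

/-- For large `a` the lift embeds the hemisphere in a compact sphere with distance loss at most ε/2,
so a finite net of the image pulls back. -/
theorem totallyBounded_grushinSpace (hn : n ≠ 0) :
    TotallyBounded (Set.univ : Set (GrushinSpace hn)) := by
  refine Metric.totallyBounded_iff.2 fun ε hε ↦ ?_
  obtain ⟨a, ha1, ha⟩ := ((Filter.eventually_ge_atTop (1 : ℝ)).and
    (eventually_arccos_sub_le (ε := ε / 4) (by positivity))).exists
  obtain ⟨x, hx⟩ := exists_norm_eq (EuclideanSpace ℝ (Fin (2 + 1))) zero_le_one
  -- The limit does not depend on the fibre dimension, so the smallest one allowed, m = 2, suffices.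
  let F : GrushinSpace hn → SphereSpace hn le_rfl ha1 := fun P ↦ liftMap hx P
  have key : ∀ P Q : GrushinSpace hn, dist P Q ≤ dist (F P) (F Q) + ε / 2 := by
    intro P Q
    have h := toReal_grushinDist_le hn le_rfl ha1 _ _ (fstL_liftMap_ne_zero hx P)
      (fstL_liftMap_ne_zero hx Q) (by positivity) ha
    rw [baseMap_liftMap hx P (fstL_liftMap_ne_zero hx P),
      baseMap_liftMap hx Q (fstL_liftMap_ne_zero hx Q)] at h
    calc dist P Q ≤ dist (F P) (F Q) + 2 * (ε / 4) := h
      _ = _ := by ring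
  have hb : TotallyBounded (Set.range F) :=
    isCompact_univ.totallyBounded.subset (Set.subset_univ _)
  obtain ⟨t, ht, hft, hsub⟩ := hb.exists_subset (Metric.dist_mem_uniformity (half_pos hε))
  have : Nonempty (GrushinSpace hn) := nonempty_openHemisphere n
  have ht : ∀ q ∈ t, ∃ P, F P = q := fun q hq ↦ ht hq
  choose! G hG using ht
  refine ⟨G '' t, hft.image G, fun P _ ↦ ?_⟩
  obtain ⟨q, hq, hPq⟩ := Set.mem_iUnion₂.1 (hsub (Set.mem_range_self P))
  refine Set.mem_iUnion₂.2 ⟨G q, Set.mem_image_of_mem G hq, ?_⟩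
  have h1 := key P (G q)
  rw [hG q hq] at h1
  have h2 : dist (F P) q < ε / 2 := hPq
  rw [Metric.mem_ball]
  linarith

instance (hn : n ≠ 0) : CompactSpace (UniformSpace.Completion (GrushinSpace hn)) :=
  compactSpace_completion (totallyBounded_grushinSpace hn)

instance (hn : n ≠ 0) : Nonempty (UniformSpace.Completion (GrushinSpace hn)) :=
  (nonempty_openHemisphere n).map fun x : GrushinSpace hn ↦ (x : UniformSpace.Completion _)

theorem isGrushinHemisphere_rep (hn : n ≠ 0) :
    IsGrushinHemisphere n (toGHSpace (UniformSpace.Completion (GrushinSpace hn))).Rep := by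
  obtain ⟨e⟩ := toGHSpace_eq_toGHSpace_iff_isometryEquiv.1
    (toGHSpace (UniformSpace.Completion (GrushinSpace hn))).toGHSpace_rep
  exact ⟨grushinMetric n, isWarpedProduct_grushinMetric, isMetricCompletion_of_isometryEquiv e.symm⟩

theorem ghDist_sphereSpace_le (hn : n ≠ 0) (hm : 2 ≤ m) {a : ℝ} (ha : 1 ≤ a) {ε : ℝ} (h0 : 0 < ε)
    (hε : ∀ c ∈ Set.Icc (0 : ℝ) 1, Real.arccos (√(1 - a⁻¹) * c) - Real.arccos c ≤ ε)
    (hf : fibreBound a ≤ ε) :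
    ghDist (SphereSpace hn hm ha) (UniformSpace.Completion (GrushinSpace hn)) ≤ 3 * ε := by
  let s : Set (SphereSpace hn hm ha) := {p : Sphere (m + n) | fstL m n p ≠ 0}
  let c : GrushinSpace hn → UniformSpace.Completion (GrushinSpace hn) := fun P ↦ P
  let Φ : s → UniformSpace.Completion (GrushinSpace hn) := fun p ↦ c (baseMap p.1 p.2)
  obtain ⟨x, hx⟩ := exists_norm_eq (EuclideanSpace ℝ (Fin (m + 1))) zero_le_one
  -- The projection reaches the open hemisphere only where X ≠ 0, which is a dense set. Density on
  -- either side costs `ε`, and distortion 2ε counts half: ε + 2ε/2 + ε = 3ε.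
  refine (ghDist_le_of_approx_subsets Φ (ε₁ := ε) (ε₂ := 2 * ε) (ε₃ := ε) ?_ ?_ ?_).trans_eq
    (by ring)
  · intro p
    obtain ⟨q, hq, hq0⟩ := exists_generic_near hn p
      (eventually_riemDist_lt (sphereMetric m n a ha) p (ENNReal.ofReal_pos.2 h0))
    exact ⟨q, hq0, ENNReal.toReal_le_of_le_ofReal h0.le hq.le⟩
  · intro z
    obtain ⟨P, hP⟩ := UniformSpace.Completion.denseRange_coe.exists_dist_lt z h0
    refine ⟨⟨liftMap hx P, fstL_liftMap_ne_zero hx P⟩, ?_⟩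
    change dist z (c (baseMap (liftMap hx P) (fstL_liftMap_ne_zero hx P))) ≤ ε
    rw [baseMap_liftMap hx P (fstL_liftMap_ne_zero hx P)]
    exact hP.le
  · rintro ⟨p, hp⟩ ⟨q, hq⟩
    have h1 := dist_le_of_riemDist_le hn hm ha p q hp hq
    have h2 := toReal_grushinDist_le hn hm ha p q hp hq h0.le hε
    have h3 : ∀ P Q, dist (c P) (c Q) = dist P Q := UniformSpace.Completion.dist_eq
    have h4 : dist (Φ ⟨p, hp⟩) (Φ ⟨q, hq⟩) =
      (grushinDist n (baseMap p hp) (baseMap q hq)).toReal := h3 _ _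
    rw [h4]
    change |(sphereDist m n a ha p q).toReal - _| ≤ 2 * ε
    rw [abs_le]
    constructor <;> linarith

theorem tendsto_toGHSpace_sphereSpace (hn : n ≠ 0) (hm : 2 ≤ m) {a : ℝ → ℝ} (ha : ∀ t, 1 ≤ a t)
    (hlim : Filter.Tendsto a Filter.atTop Filter.atTop) :
    Filter.Tendsto (fun t ↦ toGHSpace (SphereSpace hn hm (ha t))) Filter.atTop
      (𝓝 (toGHSpace (UniformSpace.Completion (GrushinSpace hn)))) := by
  refine Metric.tendsto_nhds.2 fun δ hδ ↦ ?_
  have h1 := hlim.eventually (eventually_arccos_sub_le (ε := δ / 4) (by positivity))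
  have h2 := hlim.eventually (tendsto_fibreBound.eventually_le_const (u := δ / 4) (by positivity))
  filter_upwards [h1, h2] with t ht1 ht2
  have h := ghDist_sphereSpace_le hn hm (ha t) (by positivity) ht1 ht2
  calc _ = ghDist (SphereSpace hn hm (ha t)) (UniformSpace.Completion (GrushinSpace hn)) := rfl
    _ ≤ 3 * (δ / 4) := h
    _ < δ := by linarith

end Limit

/-! ### The three scalar inequalities behind Ric ≥ 1. -/

section Inequalities

variable {a q u N M : ℝ}

/-- Here M and N multiply -f''/f and -h''/h. Eight copies of -f''/f split into 2a(6 + u)/(1 + u)²,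
which absorbs the negative part of -h''/h, and 2(4 + u²)/(1 + u)² ≥ 1. -/
theorem ricci_radial_ge (ha : 0 ≤ a) (hq : 1 ≤ q) (hqu : q ≤ 1 + u) (huq : u ≤ q)
    (hN : 1 ≤ N) (hM : 8 * N ≤ M) :
    1 ≤ M * ((a * (6 + u) + 4 + u ^ 2) / (4 * (1 + u) ^ 2)) + N * (a * (3 - 2 * q) / q ^ 2) := by
  have hu : 0 ≤ u := by linarith
  have h1 : (2 * q - 3) / q ^ 2 ≤ 2 * (6 + u) / (1 + u) ^ 2 := by
    rw [div_le_div_iff₀ (by positivity) (by positivity)]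
    rcases le_total (2 * q) 3 with h | h
    · have h2 : (2 * q - 3) * (1 + u) ^ 2 ≤ 0 :=
        mul_nonpos_of_nonpos_of_nonneg (by linarith) (by positivity)
      have h3 : 0 ≤ 2 * (6 + u) * q ^ 2 := by positivity
      linarith
    · have h2 : (2 * q - 3) * (1 + u) ^ 2 ≤ (2 * q - 3) * (1 + q) ^ 2 :=
        mul_le_mul_of_nonneg_left (by gcongr) (by linarith)
      have h3 : 2 * (5 + q) * q ^ 2 ≤ 2 * (6 + u) * q ^ 2 := by
        gcongr ?_ * _
        linarith
      nlinarith
  have h2 : 1 ≤ 2 * (4 + u ^ 2) / (1 + u) ^ 2 := by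
    rw [le_div_iff₀ (by positivity)]
    nlinarith [sq_nonneg (u - 1)]
  have h3 : (a * (6 + u) + 4 + u ^ 2) / (4 * (1 + u) ^ 2) =
      (a * (2 * (6 + u) / (1 + u) ^ 2) + 2 * (4 + u ^ 2) / (1 + u) ^ 2) / 8 := by
    field_simp
    ring
  have h4 : a * (3 - 2 * q) / q ^ 2 = -(a * ((2 * q - 3) / q ^ 2)) := by ring
  have h5 := mul_le_mul_of_nonneg_left h1 ha
  have h6 : 0 ≤ a * (2 * (6 + u) / (1 + u) ^ 2) := by positivity
  rw [h3, h4]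
  generalize a * (2 * (6 + u) / (1 + u) ^ 2) = A at *
  generalize 2 * (4 + u ^ 2) / (1 + u) ^ 2 = B at *
  generalize a * ((2 * q - 3) / q ^ 2) = C at *
  have h7 : 8 * N * ((A + B) / 8) ≤ M * ((A + B) / 8) :=
    mul_le_mul_of_nonneg_right hM (by linarith)
  nlinarith

/-- Both -f''/f and the mixed curvature -f'h'/(fh) are at least 1/2. -/
theorem ricci_fst_ge (hq : 1 ≤ q) (hqa : q ≤ a) (hu : 0 ≤ u) (hua : u ≤ a) (hN : 1 ≤ N) :
    1 ≤ (a * (6 + u) + 4 + u ^ 2) / (4 * (1 + u) ^ 2)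
      + N * (a * (2 + u) / (2 * (1 + u) * q)) := by
  have h1 : 1 / 2 ≤ (a * (6 + u) + 4 + u ^ 2) / (4 * (1 + u) ^ 2) := by
    rw [div_le_div_iff₀ (by positivity) (by positivity)]
    nlinarith [mul_le_mul_of_nonneg_right hua (by linarith : 0 ≤ 6 + u)]
  have h2 : 1 / 2 ≤ a * (2 + u) / (2 * (1 + u) * q) := by
    rw [div_le_div_iff₀ (by positivity) (by positivity)]
    nlinarith [mul_le_mul_of_nonneg_right hqa (by linarith : 0 ≤ 1 + u)]
  nlinarith

/-- With A = a/q ≥ 1, the first term is at least -2A, the intrinsic term at least -2(N - 1)A, and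
the mixed term at least 8N · A/2. The sum is at least 2NA. -/
theorem ricci_snd_ge (hq : 1 ≤ q) (hqa : q ≤ a) (hu : 0 ≤ u) (hN : 1 ≤ N) (hM : 8 * N ≤ M) :
    1 ≤ a * (3 - 2 * q) / q ^ 2 + (N - 1) * (a / q ^ 2 - (1 - 1 / a) * (1 + a / q))
      + M * (a * (2 + u) / (2 * (1 + u) * q)) := by
  have ha : 1 ≤ a := hq.trans hqa
  have h1 : 1 ≤ a / q := by rwa [one_le_div (by positivity)]
  have h2 : a / q / 2 ≤ a * (2 + u) / (2 * (1 + u) * q) := by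
    rw [div_div, div_le_div_iff₀ (by positivity) (by positivity)]
    nlinarith [mul_pos (by linarith : 0 < a) (by linarith : 0 < q)]
  have h3 : a * (3 - 2 * q) / q ^ 2 = 3 * (a / q ^ 2) - 2 * (a / q) := by
    field_simp
  have h4 : 0 ≤ a / q ^ 2 := by positivity
  have h5 : (1 - 1 / a) * (1 + a / q) ≤ 2 * (a / q) := by
    have : 0 ≤ 1 / a := by positivity
    have h6 : (1 - 1 / a) * (1 + a / q) ≤ 1 * (1 + a / q) :=
      mul_le_mul_of_nonneg_right (by linarith) (by positivity)
    linarith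
  have h6 : 8 * N * (a / q / 2) ≤ M * (a * (2 + u) / (2 * (1 + u) * q)) :=
    mul_le_mul hM h2 (by positivity) (by linarith)
  have h7 : (N - 1) * (-(2 * (a / q))) ≤
      (N - 1) * (a / q ^ 2 - (1 - 1 / a) * (1 + a / q)) :=
    mul_le_mul_of_nonneg_left (by linarith) (by linarith)
  rw [h3]
  nlinarith

end Inequalities

/-! ### Derivatives of the warping functions. -/

section Warping

variable {a r : ℝ}

/-- The logarithmic derivative of the warping function `f`. -/
noncomputable def fstLogDeriv (a r : ℝ) : ℝ :=
  Real.cos r * (2 + a * Real.sin r ^ 2) / (2 * Real.sin r * (1 + a * Real.sin r ^ 2))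

/-- The logarithmic derivative of the warping function `h`. -/
noncomputable def sndLogDeriv (a r : ℝ) : ℝ :=
  -(a * Real.sin r) / (Real.cos r * quadCoef a (Real.sin r ^ 2))

theorem hasDerivAt_sin_sq (r : ℝ) :
    HasDerivAt (fun t ↦ Real.sin t ^ 2) (2 * Real.sin r * Real.cos r) r := by
  have := (Real.hasDerivAt_sin r).pow 2
  rwa [Nat.cast_ofNat, pow_one] at this

theorem hasDerivAt_fstWarp (ha : 1 ≤ a) (hs : Real.sin r ≠ 0) :
    HasDerivAt (fstWarp a) (2 * fstLogDeriv a r * fstWarp a r) r := by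
  have hw : 0 < 1 + a * Real.sin r ^ 2 := by positivity
  have h1 := hasDerivAt_sin_sq r
  have h2 := ((h1.const_mul a).const_add 1).sqrt hw.ne'
  have h3 := h1.mul (h2.inv (Real.sqrt_pos.2 hw).ne')
  refine h3.congr_deriv ?_
  have hq := Real.sqrt_pos.2 hw
  have hsq := Real.sq_sqrt hw.le
  simp only [fstWarp, fstCoef, fstLogDeriv, Pi.inv_apply]
  generalize √(1 + a * Real.sin r ^ 2) = R at *
  rw [← hsq, show 2 + a * Real.sin r ^ 2 = R ^ 2 + 1 by linarith]
  field_simp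
  linear_combination Real.cos r * hsq

theorem hasDerivAt_quadCoef (a r : ℝ) : HasDerivAt (fun t ↦ quadCoef a (Real.sin t ^ 2))
    ((a - 1) * (2 * Real.sin r * Real.cos r)) r := by
  have h1 := hasDerivAt_sin_sq r
  exact (h1.const_mul (a - 1)).const_add 1

theorem hasDerivAt_sndWarp (ha : 1 ≤ a) (hc : Real.cos r ≠ 0) :
    HasDerivAt (sndWarp a) (2 * sndLogDeriv a r * sndWarp a r) r := by
  have hq := quadCoef_pos ha (sq_nonneg (Real.sin r))
  have h1 : HasDerivAt (fun t ↦ Real.cos t ^ 2) (2 * Real.cos r * -Real.sin r) r := by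
    have := (Real.hasDerivAt_cos r).pow 2
    rwa [Nat.cast_ofNat, pow_one] at this
  have h3 := h1.mul ((hasDerivAt_const r a).div (hasDerivAt_quadCoef a r) hq.ne')
  refine h3.congr_deriv ?_
  have hqa : quadCoef a (Real.sin r ^ 2) = a - (a - 1) * Real.cos r ^ 2 := by
    rw [quadCoef, Real.cos_sq']
    ring
  simp only [sndWarp, sndCoef, sndLogDeriv, Pi.div_apply]
  generalize quadCoef a (Real.sin r ^ 2) = q at *
  field_simp
  rw [hqa]
  ring

/-- Writing k' as -E - k² exhibits E = -(k' + k²) = -f''/f, the combination entering the Ricci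
tensor. -/
theorem hasDerivAt_fstLogDeriv (ha : 1 ≤ a) (hs : Real.sin r ≠ 0) :
    HasDerivAt (fstLogDeriv a) (-((a * (6 + a * Real.sin r ^ 2) + 4 + (a * Real.sin r ^ 2) ^ 2)
      / (4 * (1 + a * Real.sin r ^ 2) ^ 2)) - fstLogDeriv a r ^ 2) r := by
  have hw : 0 < 1 + a * Real.sin r ^ 2 := by positivity
  have h1 := hasDerivAt_sin_sq r
  have h2 := ((Real.hasDerivAt_cos r).mul ((h1.const_mul a).const_add 2)).div
    (((Real.hasDerivAt_sin r).const_mul 2).mul ((h1.const_mul a).const_add 1))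
    (mul_ne_zero (mul_ne_zero two_ne_zero hs) hw.ne')
  refine h2.congr_deriv ?_
  simp only [fstLogDeriv, Pi.mul_apply]
  have hc := Real.cos_sq' r
  field_simp
  ring_nf
  simp only [hc]
  ring

theorem hasDerivAt_sndLogDeriv (ha : 1 ≤ a) (hc : Real.cos r ≠ 0) :
    HasDerivAt (sndLogDeriv a) (-(a * (3 - 2 * quadCoef a (Real.sin r ^ 2))
      / quadCoef a (Real.sin r ^ 2) ^ 2) - sndLogDeriv a r ^ 2) r := by
  have hq := quadCoef_pos ha (sq_nonneg (Real.sin r))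
  have h2 := ((Real.hasDerivAt_sin r).const_mul a).neg.div
    ((Real.hasDerivAt_cos r).mul (hasDerivAt_quadCoef a r)) (mul_ne_zero hc hq.ne')
  refine h2.congr_deriv ?_
  simp only [sndLogDeriv, Pi.mul_apply, Pi.neg_apply]
  have hs := Real.sin_sq r
  field_simp
  rw [quadCoef]
  ring_nf
  simp only [hs, show Real.sin r ^ 4 = (Real.sin r ^ 2) ^ 2 by ring]
  ring

theorem fstLogDeriv_mul_sndLogDeriv (ha : 1 ≤ a) (hs : Real.sin r ≠ 0) (hc : Real.cos r ≠ 0) :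
    fstLogDeriv a r * sndLogDeriv a r = -(a * (2 + a * Real.sin r ^ 2) /
      (2 * (1 + a * Real.sin r ^ 2) * quadCoef a (Real.sin r ^ 2))) := by
  have hq := quadCoef_pos ha (sq_nonneg (Real.sin r))
  have hw : 0 < 1 + a * Real.sin r ^ 2 := by positivity
  rw [fstLogDeriv, sndLogDeriv]
  field_simp

/-- This is f'² ≤ 1, so the intrinsic curvature of the S^m factor can be discarded. -/
theorem fstLogDeriv_sq_mul_fstWarp_le (ha : 1 ≤ a) (hs : Real.sin r ≠ 0) :
    fstLogDeriv a r ^ 2 * fstWarp a r ≤ 1 := by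
  have hu : 0 ≤ a * Real.sin r ^ 2 := by positivity
  have h1 : fstLogDeriv a r ^ 2 * fstWarp a r = Real.cos r ^ 2 *
      ((2 + a * Real.sin r ^ 2) / (2 * (1 + a * Real.sin r ^ 2))) ^ 2 *
      (√(1 + a * Real.sin r ^ 2))⁻¹ := by
    rw [fstLogDeriv, fstWarp, fstCoef]
    field_simp
  have h2 : (2 + a * Real.sin r ^ 2) / (2 * (1 + a * Real.sin r ^ 2)) ≤ 1 := by
    rw [div_le_one (by positivity)]
    linarith
  have h3 : (√(1 + a * Real.sin r ^ 2))⁻¹ ≤ 1 :=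
    inv_le_one_of_one_le₀ (Real.one_le_sqrt.2 (by linarith))
  rw [h1]
  refine mul_le_one₀ (mul_le_one₀ (Real.cos_sq_le_one r) (by positivity)
    (pow_le_one₀ (by positivity) h2)) (by positivity) h3

/-- The quantity 1 - h'² can be negative; extracting the factor h² makes it comparable with the
other terms in the S^{n-1} directions. -/
theorem one_sub_sndLogDeriv_sq_mul_sndWarp (ha : 1 ≤ a) (hc : Real.cos r ≠ 0) :
    1 - sndLogDeriv a r ^ 2 * sndWarp a r = sndWarp a r * (a / quadCoef a (Real.sin r ^ 2) ^ 2 -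
      (1 - 1 / a) * (1 + a / quadCoef a (Real.sin r ^ 2))) := by
  have hq := quadCoef_pos ha (sq_nonneg (Real.sin r))
  have ha0 : 0 < a := by linarith
  have hqa : quadCoef a (Real.sin r ^ 2) = a - (a - 1) * Real.cos r ^ 2 := by
    rw [quadCoef, Real.cos_sq']
    ring
  rw [sndLogDeriv, sndWarp, sndCoef]
  have hs := Real.sin_sq r
  field_simp
  rw [hqa] at hq ⊢
  rw [hs]
  ring

theorem fstWarp_pos (ha : 1 ≤ a) (hs : Real.sin r ≠ 0) : 0 < fstWarp a r := by
  rw [fstWarp, fstCoef]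
  positivity

theorem sndWarp_pos (ha : 1 ≤ a) (hc : Real.cos r ≠ 0) : 0 < sndWarp a r :=
  mul_pos (by positivity) (sndCoef_pos ha (sq_nonneg _))

end Warping

/-! ### Graph coordinates of the unit sphere. -/

section GraphMap

variable {F : Type*} [NormedAddCommGroup F] [InnerProductSpace ℝ F]

/-- The parametrization of the unit sphere near `x` by the orthogonal complement of `x`. -/
noncomputable def graphMap (x : F) (v : (ℝ ∙ x)ᗮ) : F := v + √(1 - ⟪v, v⟫_ℝ) • x

/-- The derivative of `graphMap x` at `v`. -/
noncomputable def graphMapDeriv (x : F) (v u : (ℝ ∙ x)ᗮ) : F :=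
  u - (⟪v, u⟫_ℝ / √(1 - ⟪v, v⟫_ℝ)) • x

@[simp]
theorem graphMap_zero (x : F) : graphMap x 0 = x := by simp [graphMap]

theorem inner_orthogonal (x : F) (v : (ℝ ∙ x)ᗮ) : ⟪x, (v : F)⟫_ℝ = 0 :=
  Submodule.mem_orthogonal_singleton_iff_inner_right.1 v.2

theorem norm_graphMap {x : F} (hx : ‖x‖ = 1) {v : (ℝ ∙ x)ᗮ} (hv : 0 < 1 - ⟪v, v⟫_ℝ) :
    ‖graphMap x v‖ = 1 := by
  rw [← pow_left_inj₀ (norm_nonneg _) zero_le_one two_ne_zero, graphMap, add_comm,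
    ← one_smul ℝ (v : F), norm_sq_smul_add_smul hx (inner_orthogonal x v), Real.sq_sqrt hv.le,
    real_inner_self_eq_norm_sq, Submodule.coe_norm]
  ring

theorem inner_graphMap_graphMapDeriv {x : F} (hx : ‖x‖ = 1) {v : (ℝ ∙ x)ᗮ}
    (hv : 0 < 1 - ⟪v, v⟫_ℝ) (u : (ℝ ∙ x)ᗮ) : ⟪graphMap x v, graphMapDeriv x v u⟫_ℝ = 0 := by
  have h := Real.sqrt_pos.2 hv
  have h1 := inner_orthogonal x v
  rw [real_inner_comm] at h1
  simp only [graphMap, graphMapDeriv, inner_add_left, inner_sub_right, inner_smul_left,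
    inner_smul_right, inner_orthogonal, h1, real_inner_self_eq_norm_sq x, hx, Submodule.coe_inner]
  simp only [Submodule.coe_inner] at h
  simp only [RCLike.conj_to_real]
  field_simp
  ring

theorem norm_graphMapDeriv_sq {x : F} (hx : ‖x‖ = 1) {v : (ℝ ∙ x)ᗮ}
    (hv : 0 < 1 - ⟪v, v⟫_ℝ) (u : (ℝ ∙ x)ᗮ) : ‖graphMapDeriv x v u‖ ^ 2 = graphMetric v u u := by
  have h : graphMapDeriv x v u = (-(⟪v, u⟫_ℝ / √(1 - ⟪v, v⟫_ℝ))) • x + (1 : ℝ) • (u : F) := by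
    rw [graphMapDeriv]
    module
  rw [h, norm_sq_smul_add_smul hx (inner_orthogonal x u), neg_sq, div_pow, Real.sq_sqrt hv.le,
    graphMetric, real_inner_self_eq_norm_sq u, Submodule.coe_norm]
  ring

theorem hasFDerivAt_graphMap (x : F) {v : (ℝ ∙ x)ᗮ} (hv : 0 < 1 - ⟪v, v⟫_ℝ) :
    ∃ D : (ℝ ∙ x)ᗮ →L[ℝ] F, HasFDerivAt (graphMap x) D v ∧ ∀ u, D u = graphMapDeriv x v u := by
  have h1 : HasFDerivAt (fun v : (ℝ ∙ x)ᗮ ↦ ⟪v, v⟫_ℝ) _ v :=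
    (hasFDerivAt_id v).inner ℝ (hasFDerivAt_id v)
  have h2 := (((h1.const_sub 1).sqrt hv.ne').smul_const x)
  refine ⟨_, ((ℝ ∙ x)ᗮ.subtypeL.hasFDerivAt).add h2, fun u ↦ ?_⟩
  have h := Real.sqrt_pos.2 hv
  simp only [add_apply, Submodule.subtypeL_apply, ContinuousLinearMap.smulRight_apply, smul_apply,
    neg_apply, ContinuousLinearMap.comp_apply, ContinuousLinearMap.prod_apply,
    fderivInnerCLM_apply, ContinuousLinearMap.id_apply, id, graphMapDeriv, real_inner_comm v u,
    sub_eq_add_neg, ← neg_smul]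
  congr 2
  rw [smul_eq_mul]
  field_simp
  ring

theorem contDiffAt_graphMap (x : F) {v : (ℝ ∙ x)ᗮ} (hv : 0 < 1 - ⟪v, v⟫_ℝ) :
    ContDiffAt ℝ ∞ (graphMap x) v := by
  have h1 : ContDiffAt ℝ ∞ (fun v : (ℝ ∙ x)ᗮ ↦ 1 - ⟪v, v⟫_ℝ) v :=
    contDiffAt_const.sub (contDiffAt_id.inner ℝ contDiffAt_id)
  exact (ℝ ∙ x)ᗮ.subtypeL.contDiff.contDiffAt.add ((h1.sqrt hv.ne').smul contDiffAt_const)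

end GraphMap

/-! ### Polar coordinates and the pullback of the ambient form. -/

section Polar

variable {m n : ℕ} {x : EuclideanSpace ℝ (Fin (m + 1))} {y : EuclideanSpace ℝ (Fin n)}

/-- Polar coordinates near the points `(sin r x, cos r y)` of the unit sphere. -/
noncomputable def polarMap (x : EuclideanSpace ℝ (Fin (m + 1))) (y : EuclideanSpace ℝ (Fin n))
    (z : ℝ × (ℝ ∙ x)ᗮ × (ℝ ∙ y)ᗮ) : EuclideanSpace ℝ (Fin (m + n + 1)) :=
  pair (Real.sin z.1 • graphMap x z.2.1) (Real.cos z.1 • graphMap y z.2.2)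

theorem contDiffAt_polarMap {z : ℝ × (ℝ ∙ x)ᗮ × (ℝ ∙ y)ᗮ} (h1 : 0 < 1 - ⟪z.2.1, z.2.1⟫_ℝ)
    (h2 : 0 < 1 - ⟪z.2.2, z.2.2⟫_ℝ) : ContDiffAt ℝ ∞ (polarMap x y) z := by
  have hX : ContDiffAt ℝ ∞ (fun z : ℝ × (ℝ ∙ x)ᗮ × (ℝ ∙ y)ᗮ ↦ graphMap x z.2.1) z :=
    ContDiffAt.comp (g := graphMap x) z (contDiffAt_graphMap x h1) (by fun_prop)
  have hY : ContDiffAt ℝ ∞ (fun z : ℝ × (ℝ ∙ x)ᗮ × (ℝ ∙ y)ᗮ ↦ graphMap y z.2.2) z :=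
    ContDiffAt.comp (g := graphMap y) z (contDiffAt_graphMap y h2) (by fun_prop)
  have hs : ContDiffAt ℝ ∞ (fun z : ℝ × (ℝ ∙ x)ᗮ × (ℝ ∙ y)ᗮ ↦ Real.sin z.1) z := by fun_prop
  have hc : ContDiffAt ℝ ∞ (fun z : ℝ × (ℝ ∙ x)ᗮ × (ℝ ∙ y)ᗮ ↦ Real.cos z.1) z := by fun_prop
  exact (pairL m n).contDiff.contDiffAt.comp z ((hs.smul hX).prodMk (hc.smul hY))

theorem fderiv_polarMap {z : ℝ × (ℝ ∙ x)ᗮ × (ℝ ∙ y)ᗮ} (h1 : 0 < 1 - ⟪z.2.1, z.2.1⟫_ℝ)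
    (h2 : 0 < 1 - ⟪z.2.2, z.2.2⟫_ℝ) (ζ : ℝ × (ℝ ∙ x)ᗮ × (ℝ ∙ y)ᗮ) :
    fderiv ℝ (polarMap x y) z ζ =
      pair ((ζ.1 * Real.cos z.1) • graphMap x z.2.1 + Real.sin z.1 • graphMapDeriv x z.2.1 ζ.2.1)
        (-(ζ.1 * Real.sin z.1) • graphMap y z.2.2
          + Real.cos z.1 • graphMapDeriv y z.2.2 ζ.2.2) := by
  obtain ⟨DX, hDX, hX⟩ := hasFDerivAt_graphMap x h1
  obtain ⟨DY, hDY, hY⟩ := hasFDerivAt_graphMap y h2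
  have hf : HasFDerivAt (fun z : ℝ × (ℝ ∙ x)ᗮ × (ℝ ∙ y)ᗮ ↦ z.1)
      (ContinuousLinearMap.fst ℝ ℝ ((ℝ ∙ x)ᗮ × (ℝ ∙ y)ᗮ)) z :=
    hasFDerivAt_fst
  have p1 : HasFDerivAt (fun z : ℝ × (ℝ ∙ x)ᗮ × (ℝ ∙ y)ᗮ ↦ z.2.1)
      (ContinuousLinearMap.fst ℝ _ _ ∘L ContinuousLinearMap.snd ℝ ℝ ((ℝ ∙ x)ᗮ × (ℝ ∙ y)ᗮ)) z :=
    hasFDerivAt_fst.comp z (hasFDerivAt_snd (p := z))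
  have p2 : HasFDerivAt (fun z : ℝ × (ℝ ∙ x)ᗮ × (ℝ ∙ y)ᗮ ↦ z.2.2)
      (ContinuousLinearMap.snd ℝ _ _ ∘L ContinuousLinearMap.snd ℝ ℝ ((ℝ ∙ x)ᗮ × (ℝ ∙ y)ᗮ)) z :=
    hasFDerivAt_snd.comp z (hasFDerivAt_snd (p := z))
  have hX' : HasFDerivAt (fun z : ℝ × (ℝ ∙ x)ᗮ × (ℝ ∙ y)ᗮ ↦ graphMap x z.2.1) _ z :=
    HasFDerivAt.comp (g := graphMap x) z hDX p1
  have hY' : HasFDerivAt (fun z : ℝ × (ℝ ∙ x)ᗮ × (ℝ ∙ y)ᗮ ↦ graphMap y z.2.2) _ z :=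
    HasFDerivAt.comp (g := graphMap y) z hDY p2
  have h : HasFDerivAt (polarMap x y) _ z := ((pairL m n).hasFDerivAt).comp z
    ((hf.sin.smul hX').prodMk (hf.cos.smul hY'))
  rw [h.fderiv]
  simp only [ContinuousLinearMap.comp_apply, ContinuousLinearMap.prod_apply, pairL_apply]
  congr 1
  · simp only [add_apply, smul_apply, ContinuousLinearMap.smulRight_apply,
      ContinuousLinearMap.comp_apply, hX, ContinuousLinearMap.coe_fst',
      ContinuousLinearMap.coe_snd', smul_eq_mul]
    rw [mul_comm (Real.cos z.1)]
    exact add_comm _ _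
  · simp only [add_apply, smul_apply, ContinuousLinearMap.smulRight_apply,
      ContinuousLinearMap.comp_apply, hY, ContinuousLinearMap.coe_fst',
      ContinuousLinearMap.coe_snd', smul_eq_mul]
    rw [neg_mul, mul_comm (Real.sin z.1)]
    exact add_comm _ _

theorem norm_polarMap (hx : ‖x‖ = 1) (hy : ‖y‖ = 1) {z : ℝ × (ℝ ∙ x)ᗮ × (ℝ ∙ y)ᗮ}
    (h1 : 0 < 1 - ⟪z.2.1, z.2.1⟫_ℝ) (h2 : 0 < 1 - ⟪z.2.2, z.2.2⟫_ℝ) : ‖polarMap x y z‖ = 1 := by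
  rw [← pow_left_inj₀ (norm_nonneg _) zero_le_one two_ne_zero, norm_sq_eq_fstL_add_sndL, polarMap,
    fstL_pair, sndL_pair, norm_smul, norm_smul, norm_graphMap hx h1, norm_graphMap hy h2]
  simp

theorem graphMetric_add_self {P : Type*} [NormedAddCommGroup P] [InnerProductSpace ℝ P]
    (v u u' : P) : graphMetric v (u + u') (u + u') =
      graphMetric v u u + 2 * graphMetric v u u' + graphMetric v u' u' := by
  rw [graphMetric_add_left, graphMetric_comm v u, graphMetric_comm v u', graphMetric_add_left,
    graphMetric_add_left, graphMetric_comm v u' u]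
  ring

/-- The diagonal values come from `ambientForm_polar`; polarization gives the rest, both forms being
symmetric. -/
theorem pullback_polarMap {a : ℝ} (ha : 1 ≤ a) (hx : ‖x‖ = 1) (hy : ‖y‖ = 1)
    {z : ℝ × (ℝ ∙ x)ᗮ × (ℝ ∙ y)ᗮ} (h1 : 0 < 1 - ⟪z.2.1, z.2.1⟫_ℝ)
    (h2 : 0 < 1 - ⟪z.2.2, z.2.2⟫_ℝ) (ζ ζ' : ℝ × (ℝ ∙ x)ᗮ × (ℝ ∙ y)ᗮ) :
    pullback (polarMap x y) (ambientForm m n a) z ζ ζ' =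
      warpedForm (fstWarp a) (sndWarp a) z ζ ζ' := by
  have hdiag : ∀ ζ, pullback (polarMap x y) (ambientForm m n a) z ζ ζ =
      warpedForm (fstWarp a) (sndWarp a) z ζ ζ := by
    intro ζ
    have h := ambientForm_polar ha z.1 ζ.1 (norm_graphMap hx h1) (norm_graphMap hy h2)
      (inner_graphMap_graphMapDeriv hx h1 ζ.2.1) (inner_graphMap_graphMapDeriv hy h2 ζ.2.2)
      (p := polarMap x y z) rfl (fderiv_polarMap h1 h2 ζ)
    rw [norm_graphMapDeriv_sq hx h1, norm_graphMapDeriv_sq hy h2] at h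
    rw [warpedForm, ← pow_two]
    exact h
  have h3 := hdiag (ζ + ζ')
  have h4 : pullback (polarMap x y) (ambientForm m n a) z ζ' ζ =
    pullback (polarMap x y) (ambientForm m n a) z ζ ζ' := ambientForm_comm _ _ _
  simp only [map_add, add_apply] at h3
  rw [h4, hdiag, hdiag] at h3
  simp only [warpedForm, Prod.fst_add, Prod.snd_add, graphMetric_add_self] at h3 ⊢
  linarith

end Polar

/-! ### Retraction to the sphere and polar form of generic points. -/

section Generic

variable {m n : ℕ}

/-- The map v ↦ v/|v|, with an arbitrary value at 0. It turns maps to the ambient space with values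
near the sphere into smooth maps to the sphere. -/
theorem exists_retract_sphere (k : ℕ) (p : Sphere k) :
    ∃ ρ : EuclideanSpace ℝ (Fin (k + 1)) → Sphere k, (∀ q : Sphere k, ρ q = q) ∧
      ∀ q : Sphere k, ContMDiffAt 𝓘(ℝ, EuclideanSpace ℝ (Fin (k + 1))) (𝓡 k) ∞ ρ q := by
  classical
  let U : TopologicalSpace.Opens (EuclideanSpace ℝ (Fin (k + 1))) := ⟨{0}ᶜ, isOpen_compl_singleton⟩
  have hU : ∀ v : U, ‖(v : EuclideanSpace ℝ (Fin (k + 1)))‖ ≠ 0 := fun v ↦ norm_ne_zero_iff.2 v.2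
  have hs : ∀ v : EuclideanSpace ℝ (Fin (k + 1)), v ≠ 0 →
      ‖v‖⁻¹ • v ∈ Metric.sphere (0 : EuclideanSpace ℝ (Fin (k + 1))) 1 := fun v hv ↦ by
    simp [norm_smul, hv]
  let ρ : EuclideanSpace ℝ (Fin (k + 1)) → Sphere k := fun v ↦
    if h : v = 0 then p else ⟨‖v‖⁻¹ • v, hs v h⟩
  refine ⟨ρ, fun q ↦ ?_, fun q ↦ ?_⟩
  · have hq := ne_zero_of_mem_unit_sphere q
    simp only [ρ, dif_neg hq]
    exact Subtype.ext (by simp)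
  · have hq := ne_zero_of_mem_unit_sphere q
    have h1 : ContMDiff 𝓘(ℝ, EuclideanSpace ℝ (Fin (k + 1)))
        𝓘(ℝ, EuclideanSpace ℝ (Fin (k + 1))) ∞ (fun v : U ↦
        ‖(v : EuclideanSpace ℝ (Fin (k + 1)))‖⁻¹ • (v : EuclideanSpace ℝ (Fin (k + 1)))) := by
      intro v
      refine (contMDiffAt_subtype_iff
        (f := fun v : EuclideanSpace ℝ (Fin (k + 1)) ↦ ‖v‖⁻¹ • v)).2 ?_
      exact (((contDiffAt_norm ℝ v.2).inv (hU v)).smul contDiffAt_id).contMDiffAt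
    have h2 := h1.codRestrict_sphere (n := k) (fun v ↦ hs v v.2)
    have h3 := h2 ⟨q, hq⟩
    refine (contMDiffAt_subtype_iff (f := ρ) (x := (⟨q, hq⟩ : U))).1
      (h3.congr_of_eventuallyEq (Filter.Eventually.of_forall fun v ↦ ?_))
    exact dif_neg (show ¬ (v : EuclideanSpace ℝ (Fin (k + 1))) = 0 from v.2)

theorem exists_polar (p : Sphere (m + n)) (h1 : fstL m n p ≠ 0) (h2 : sndL m n p ≠ 0) :
    ∃ (r : ℝ) (x : EuclideanSpace ℝ (Fin (m + 1))) (y : EuclideanSpace ℝ (Fin n)),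
      ‖x‖ = 1 ∧ ‖y‖ = 1 ∧ Real.sin r ≠ 0 ∧ Real.cos r ≠ 0 ∧
      (p : EuclideanSpace ℝ (Fin (m + n + 1))) = pair (Real.sin r • x) (Real.cos r • y) := by
  have hp := norm_sq_eq_fstL_add_sndL (m := m) (n := n) (p : EuclideanSpace ℝ (Fin (m + n + 1)))
  rw [norm_eq_of_mem_sphere] at hp
  have hn1 := norm_pos_iff.2 h1
  have hn2 := norm_pos_iff.2 h2
  have hsin : Real.sin (Real.arcsin ‖fstL m n p‖) = ‖fstL m n p‖ :=
    Real.sin_arcsin (by linarith) (by nlinarith)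
  have hcos : Real.cos (Real.arcsin ‖fstL m n p‖) = ‖sndL m n p‖ := by
    rw [Real.cos_arcsin, ← Real.sqrt_sq hn2.le]
    congr 1
    linarith
  refine ⟨Real.arcsin ‖fstL m n p‖, ‖fstL m n p‖⁻¹ • fstL m n p, ‖sndL m n p‖⁻¹ • sndL m n p,
    by simp [norm_smul, h1], by simp [norm_smul, h2], ?_, ?_, ext_fstL_sndL ?_ ?_⟩
  · rw [hsin]; exact hn1.ne'
  · rw [hcos]; exact hn2.ne'
  · rw [hsin, fstL_pair, smul_smul, mul_inv_cancel₀ hn1.ne', one_smul]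
  · rw [hcos, sndL_pair, smul_smul, mul_inv_cancel₀ hn2.ne', one_smul]

theorem pullback_pullback {E E' V : Type*} [NormedAddCommGroup E] [NormedSpace ℝ E]
    [NormedAddCommGroup E'] [NormedSpace ℝ E'] [NormedAddCommGroup V] [NormedSpace ℝ V]
    {σ : E → V} {Φ : E' → E} {B : V → V →L[ℝ] V →L[ℝ] ℝ} {z : E'}
    (hσ : DifferentiableAt ℝ σ (Φ z)) (hΦ : DifferentiableAt ℝ Φ z) :
    ((pullback σ B (Φ z)).bilinearComp (fderiv ℝ Φ z) (fderiv ℝ Φ z)) = pullback (σ ∘ Φ) B z := by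
  ext ζ ζ'
  simp [pullback, fderiv_comp z hσ hΦ]

end Generic

/-! ### The lower Ricci bound on the whole sphere. -/

section RicciBound

variable {m n : ℕ}

theorem isInvertible_of_injective {E E' : Type*} [NormedAddCommGroup E] [NormedSpace ℝ E]
    [NormedAddCommGroup E'] [NormedSpace ℝ E'] [FiniteDimensional ℝ E] [FiniteDimensional ℝ E']
    {D : E' →L[ℝ] E} (h : ∀ v, D v = 0 → v = 0)
    (hd : Module.finrank ℝ E' = Module.finrank ℝ E) : D.IsInvertible :=
  ⟨(LinearEquiv.ofInjectiveOfFinrankEq (D : E' →ₗ[ℝ] E)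
    ((injective_iff_map_eq_zero (D : E' →ₗ[ℝ] E)).2 h) hd).toContinuousLinearEquiv, by ext v; rfl⟩

theorem finrank_orthogonal_add_one {k : ℕ} {x : EuclideanSpace ℝ (Fin k)} (hx : ‖x‖ = 1) :
    Module.finrank ℝ (ℝ ∙ x)ᗮ + 1 = k := by
  have h := (ℝ ∙ x).finrank_add_finrank_orthogonal
  rw [finrank_span_singleton (norm_ne_zero_iff.1 (by simp [hx])), finrank_euclideanSpace,
    Fintype.card_fin] at h
  omega

/-- The right side is `coordRicci_warpedForm` with the derivatives of `fstLogDeriv` and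
`sndLogDeriv` inserted. The three scalar inequalities are weighted by b², u² f² and w² h². -/
theorem warpedRicci_ge {a r M N : ℝ} (ha : 1 ≤ a) (hN : 1 ≤ N) (hM : 8 * N ≤ M)
    (hs : Real.sin r ≠ 0) (hc : Real.cos r ≠ 0) (b u w : ℝ) :
    b ^ 2 + fstWarp a r * u ^ 2 + sndWarp a r * w ^ 2 ≤
      b ^ 2 * (-(M * (-((a * (6 + a * Real.sin r ^ 2) + 4 + (a * Real.sin r ^ 2) ^ 2)
        / (4 * (1 + a * Real.sin r ^ 2) ^ 2)) - fstLogDeriv a r ^ 2 + fstLogDeriv a r ^ 2))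
        - N * (-(a * (3 - 2 * quadCoef a (Real.sin r ^ 2))
        / quadCoef a (Real.sin r ^ 2) ^ 2) - sndLogDeriv a r ^ 2 + sndLogDeriv a r ^ 2))
      + u ^ 2 * (-(fstWarp a r * (-((a * (6 + a * Real.sin r ^ 2) + 4 + (a * Real.sin r ^ 2) ^ 2)
        / (4 * (1 + a * Real.sin r ^ 2) ^ 2)) - fstLogDeriv a r ^ 2 + fstLogDeriv a r ^ 2))
        + (M - 1) * (1 - fstLogDeriv a r ^ 2 * fstWarp a r)
        - N * (sndLogDeriv a r * fstLogDeriv a r * fstWarp a r))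
      + w ^ 2 * (-(sndWarp a r * (-(a * (3 - 2 * quadCoef a (Real.sin r ^ 2))
        / quadCoef a (Real.sin r ^ 2) ^ 2) - sndLogDeriv a r ^ 2 + sndLogDeriv a r ^ 2))
        + (N - 1) * (1 - sndLogDeriv a r ^ 2 * sndWarp a r)
        - M * (fstLogDeriv a r * sndLogDeriv a r * sndWarp a r)) := by
  have hs1 : 0 ≤ Real.sin r ^ 2 := sq_nonneg _
  have hs2 := Real.sin_sq_le_one r
  have hq : 1 ≤ quadCoef a (Real.sin r ^ 2) := by
    rw [quadCoef]
    nlinarith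
  have hqa : quadCoef a (Real.sin r ^ 2) ≤ a := by
    rw [quadCoef]
    nlinarith
  have hu : 0 ≤ a * Real.sin r ^ 2 := by positivity
  have hua : a * Real.sin r ^ 2 ≤ a := by nlinarith
  have hqu : quadCoef a (Real.sin r ^ 2) ≤ 1 + a * Real.sin r ^ 2 := by
    rw [quadCoef]
    linarith
  have huq : a * Real.sin r ^ 2 ≤ quadCoef a (Real.sin r ^ 2) := by
    rw [quadCoef]
    linarith
  have i1 := ricci_radial_ge (a := a) (by linarith) hq hqu huq hN hM
  have i2 := ricci_fst_ge hq hqa hu hua hN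
  have i3 := ricci_snd_ge hq hqa hu hN hM
  have hk := fstLogDeriv_sq_mul_fstWarp_le ha hs
  have hkl := fstLogDeriv_mul_sndLogDeriv ha hs hc
  have hφ := fstWarp_pos ha hs
  have hψ := sndWarp_pos ha hc
  rw [one_sub_sndLogDeriv_sq_mul_sndWarp ha hc, mul_comm (sndLogDeriv a r) (fstLogDeriv a r), hkl]
  have j1 := mul_le_mul_of_nonneg_left i1 (sq_nonneg b)
  have j2 := mul_le_mul_of_nonneg_left i2 (mul_nonneg (sq_nonneg u) hφ.le)
  have j3 := mul_le_mul_of_nonneg_left i3 (mul_nonneg (sq_nonneg w) hψ.le)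
  have j4 : 0 ≤ u ^ 2 * ((M - 1) * (1 - fstLogDeriv a r ^ 2 * fstWarp a r)) :=
    mul_nonneg (sq_nonneg u) (mul_nonneg (by linarith) (by linarith))
  linear_combination j1 + j2 + j3 + j4

theorem coordRicci_ge_of_pullback_eq_warpedForm {E P Q : Type*}
    [NormedAddCommGroup E] [NormedSpace ℝ E] [FiniteDimensional ℝ E]
    [NormedAddCommGroup P] [InnerProductSpace ℝ P] [FiniteDimensional ℝ P]
    [NormedAddCommGroup Q] [InnerProductSpace ℝ Q] [FiniteDimensional ℝ Q]
    {a r : ℝ} (ha : 1 ≤ a) (hs : Real.sin r ≠ 0) (hc : Real.cos r ≠ 0)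
    (hQ : 1 ≤ Module.finrank ℝ Q) (hP : 8 * Module.finrank ℝ Q ≤ Module.finrank ℝ P)
    (hE : 1 + (Module.finrank ℝ P + Module.finrank ℝ Q) = Module.finrank ℝ E)
    {G : E → E →L[ℝ] E →L[ℝ] ℝ} {Φ : ℝ × P × Q → E} (hG : IsMetricNear G (Φ (r, 0, 0)))
    (hΦ : ContDiffAt ℝ 3 Φ (r, 0, 0))
    (h : ∀ᶠ z in 𝓝 (r, (0 : P), (0 : Q)), ∀ ζ ζ', pullback Φ G z ζ ζ' =
      warpedForm (fstWarp a) (sndWarp a) z ζ ζ') (v : E) :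
    G (Φ (r, 0, 0)) v v ≤ coordRicci G (Φ (r, 0, 0)) v v := by
  have hdiag : ∀ ζ, G (Φ (r, 0, 0)) (fderiv ℝ Φ (r, 0, 0) ζ) (fderiv ℝ Φ (r, 0, 0) ζ) =
      ζ.1 ^ 2 + fstWarp a r * ‖ζ.2.1‖ ^ 2 + sndWarp a r * ‖ζ.2.2‖ ^ 2 := fun ζ ↦ by
    have := h.self_of_nhds ζ ζ
    rw [warpedForm, graphMetric_zero, graphMetric_zero, real_inner_self_eq_norm_sq,
      real_inner_self_eq_norm_sq, ← pow_two] at this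
    exact this
  have hφ := fstWarp_pos ha hs
  have hψ := sndWarp_pos ha hc
  -- The pulled back form is positive definite at the base point, so the derivative of `Φ` is
  -- injective, and the dimensions agree.
  have hinv : (fderiv ℝ Φ (r, 0, 0)).IsInvertible := by
    refine isInvertible_of_injective (fun ξ hξ ↦ ?_) ?_
    · have h0 := hdiag ξ
      rw [hξ, map_zero] at h0
      have t1 : 0 ≤ fstWarp a r * ‖ξ.2.1‖ ^ 2 := by positivity
      have t2 : 0 ≤ sndWarp a r * ‖ξ.2.2‖ ^ 2 := by positivity
      have t3 := sq_nonneg ξ.1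
      have s1 : ξ.1 ^ 2 = 0 := by linarith
      have s2 : fstWarp a r * ‖ξ.2.1‖ ^ 2 = 0 := by linarith
      have s3 : sndWarp a r * ‖ξ.2.2‖ ^ 2 = 0 := by linarith
      exact Prod.ext (by simpa using s1) (Prod.ext (by simpa [hφ.ne'] using s2)
        (by simpa [hψ.ne'] using s3))
    · rw [Module.finrank_prod, Module.finrank_prod, Module.finrank_self, hE]
  obtain ⟨ξ, rfl⟩ := hinv.surjective v
  have hric := coordRicci_warpedForm (hG.pullback hΦ hinv) h
    ((Real.continuous_sin.continuousAt.eventually_ne hs).mono fun t ht ↦ hasDerivAt_fstWarp ha ht)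
    ((Real.continuous_cos.continuousAt.eventually_ne hc).mono fun t ht ↦ hasDerivAt_sndWarp ha ht)
    (hasDerivAt_fstLogDeriv ha hs) (hasDerivAt_sndLogDeriv ha hc) ξ.1 ξ.2.1 ξ.2.2
  rw [hdiag, ← coordRicci_pullback hG hΦ hinv, hric]
  exact warpedRicci_ge ha (by exact_mod_cast hQ) (by exact_mod_cast hP) hs hc _ _ _

/-- Polar coordinates, retracted to the sphere and read in the given chart, form a change of
coordinates that brings the chart metric to warped form. -/
theorem coordMetric_le_coordRicci (hn : 2 ≤ n) (hm : 8 * (n - 1) ≤ m) {a : ℝ} (ha : 1 ≤ a)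
    (x₀ : Sphere (m + n)) {y : EuclideanSpace ℝ (Fin (m + n))}
    (hy : y ∈ (extChartAt (𝓡 (m + n)) x₀).target)
    (h1 : fstL m n ((extChartAt (𝓡 (m + n)) x₀).symm y) ≠ 0)
    (h2 : sndL m n ((extChartAt (𝓡 (m + n)) x₀).symm y) ≠ 0)
    (v : EuclideanSpace ℝ (Fin (m + n))) :
    coordMetric (sphereMetric m n a ha) x₀ y v v ≤
      coordRicci (coordMetric (sphereMetric m n a ha) x₀) y v v := by
  set p := (extChartAt (𝓡 (m + n)) x₀).symm y with hp
  set ι := fun q : Sphere (m + n) ↦ (q : EuclideanSpace ℝ (Fin (m + n + 1))) with hι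
  set G := coordMetric (sphereMetric m n a ha) x₀ with hG
  obtain ⟨r, x, z, hx, hz, hsin, hcos, hpol⟩ := exists_polar p h1 h2
  obtain ⟨ρ, hρ, hρs⟩ := exists_retract_sphere (m + n) p
  let z₀ : ℝ × (ℝ ∙ x)ᗮ × (ℝ ∙ z)ᗮ := (r, 0, 0)
  let Φ : ℝ × (ℝ ∙ x)ᗮ × (ℝ ∙ z)ᗮ → EuclideanSpace ℝ (Fin (m + n)) :=
    fun ζ ↦ extChartAt (𝓡 (m + n)) x₀ (ρ (polarMap x z ζ))
  have hpsrc : p ∈ (extChartAt (𝓡 (m + n)) x₀).source := (extChartAt _ x₀).map_target hy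
  have hpol₀ : polarMap x z z₀ = p := by
    simp [polarMap, z₀, hpol]
  have hρ₀ : ρ (polarMap x z z₀) = p := by rw [hpol₀, hρ]
  have hΦ₀ : Φ z₀ = y := by
    change extChartAt _ x₀ (ρ (polarMap x z z₀)) = y
    rw [hρ₀]
    exact (extChartAt _ x₀).right_inv hy
  have hev1 : ∀ᶠ ζ in 𝓝 z₀, 0 < 1 - ⟪ζ.2.1, ζ.2.1⟫_ℝ := by
    refine ContinuousAt.eventually_lt continuousAt_const (Continuous.continuousAt (by fun_prop)) ?_
    simp [z₀]
  have hev2 : ∀ᶠ ζ in 𝓝 z₀, 0 < 1 - ⟪ζ.2.2, ζ.2.2⟫_ℝ := by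
    refine ContinuousAt.eventually_lt continuousAt_const (Continuous.continuousAt (by fun_prop)) ?_
    simp [z₀]
  have hpolC := contDiffAt_polarMap hev1.self_of_nhds hev2.self_of_nhds
  have hρpol : ContMDiffAt 𝓘(ℝ, ℝ × (ℝ ∙ x)ᗮ × (ℝ ∙ z)ᗮ) (𝓡 (m + n)) ∞
      (fun ζ ↦ ρ (polarMap x z ζ)) z₀ :=
    ContMDiffAt.comp (g := ρ) z₀ (by rw [hpol₀]; exact hρs p) hpolC.contMDiffAt
  have hΦC : ContDiffAt ℝ ∞ Φ z₀ := by
    rw [← contMDiffAt_iff_contDiffAt]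
    refine ContMDiffAt.comp (g := extChartAt (𝓡 (m + n)) x₀) z₀ ?_ hρpol
    rw [hρ₀]
    exact contMDiffAt_extChartAt' (by simpa using hpsrc)
  have hsrc : ∀ᶠ ζ in 𝓝 z₀, ρ (polarMap x z ζ) ∈ (extChartAt (𝓡 (m + n)) x₀).source := by
    refine hρpol.continuousAt.preimage_mem_nhds ?_
    rw [hρ₀]
    exact extChartAt_source_mem_nhds' hpsrc
  -- Polar points near `z₀` lie on the sphere and in the chart domain, so neither the retraction nor
  -- the chart changes them.
  have hσΦ : ∀ᶠ ζ in 𝓝 z₀, (ι ∘ (extChartAt (𝓡 (m + n)) x₀).symm) (Φ ζ) = polarMap x z ζ := by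
    filter_upwards [hev1, hev2, hsrc] with ζ g1 g2 g3
    change ι ((extChartAt (𝓡 (m + n)) x₀).symm (extChartAt _ x₀ (ρ (polarMap x z ζ)))) = _
    rw [(extChartAt _ x₀).left_inv g3]
    have := hρ ⟨polarMap x z ζ, by simpa using norm_polarMap hx hz g1 g2⟩
    exact congrArg ι this
  have hpull : ∀ᶠ ζ in 𝓝 z₀, ∀ ξ ξ', pullback Φ G ζ ξ ξ' =
      warpedForm (fstWarp a) (sndWarp a) ζ ξ ξ' := by
    filter_upwards [hev1, hev2, hsrc, hσΦ.eventually_nhds,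
      (hΦC.of_le (m := 1) ENat.LEInfty.out).eventually (by simp)] with ζ g1 g2 g3 g4 g5 ξ ξ'
    have htgt : Φ ζ ∈ (extChartAt (𝓡 (m + n)) x₀).target := (extChartAt _ x₀).map_source g3
    have hσ := contDiffAt_comp_extChartAt_symm (ι := ι) contMDiff_coe_sphere x₀ htgt
    have e1 : G (Φ ζ) = pullback (ι ∘ (extChartAt (𝓡 (m + n)) x₀).symm) (ambientForm m n a) (Φ ζ) :=
      coordMetric_inducedMetric x₀ htgt
    have e2 := pullback_pullback (B := ambientForm m n a) (hσ.differentiableAt (by simp))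
      (g5.differentiableAt (by simp))
    have e3 : (ι ∘ (extChartAt (𝓡 (m + n)) x₀).symm) ∘ Φ =ᶠ[𝓝 ζ] polarMap x z := g4
    rw [← pullback_polarMap ha hx hz g1 g2, pullback, e1, e2, pullback, pullback, e3.fderiv_eq,
      e3.self_of_nhds]
  -- The two orthogonal complements have dimensions m and n - 1, which is how 8(n - 1) ≤ m enters.
  have f1 := finrank_orthogonal_add_one hx
  have f2 := finrank_orthogonal_add_one hz
  have h := coordRicci_ge_of_pullback_eq_warpedForm ha hsin hcos (by omega) (by omega)
    (by rw [finrank_euclideanSpace, Fintype.card_fin]; omega)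
    (hΦ₀.symm ▸ isMetricNear_coordMetric x₀ hy) (hΦC.of_le ENat.LEInfty.out) hpull v
  rwa [hΦ₀] at h

/-- In the identification of the tangent space with the model space, the preferred chart has
identity derivative at its centre. -/
theorem coordMetric_self {E M : Type*} [NormedAddCommGroup E] [NormedSpace ℝ E]
    [TopologicalSpace M] [ChartedSpace E M] [IsManifold 𝓘(ℝ, E) ∞ M] (g : SmoothMetric E M) (x : M)
    (v w : E) : coordMetric g x (extChartAt 𝓘(ℝ, E) x x) v w =
      g.inner x (v : TangentSpace 𝓘(ℝ, E) x) (w : TangentSpace 𝓘(ℝ, E) x) := by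
  let φ := extChartAt 𝓘(ℝ, E) x
  have hx : φ.symm (φ x) = x := extChartAt_to_inv x
  have h1 : ∀ p, p = x → (g.inner p : E →L[ℝ] E →L[ℝ] ℝ) = g.inner x := by
    rintro _ rfl
    rfl
  have h2 : ∀ p, p = x → (mfderiv 𝓘(ℝ, E) 𝓘(ℝ, E) φ p : E →L[ℝ] E) =
      ContinuousLinearMap.id ℝ E := by
    rintro p rfl
    ext v
    have h := mfderiv_chartAt_eq_tangentCoordChange (I := 𝓘(ℝ, E)) (mem_chart_source E p)
    have h' := tangentCoordChange_self (I := 𝓘(ℝ, E)) (v := v)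
      (mem_extChartAt_source (I := 𝓘(ℝ, E)) p)
    have hφ : (φ : M → E) = chartAt E p := by simp [φ, mfld_simps]
    rw [hφ]
    exact (congrArg (fun L : E →L[ℝ] E ↦ L v) h).trans h'
  have h3 := mfderiv_extChartAt_comp_mfderivWithin_extChartAt_symm (I := 𝓘(ℝ, E))
    (mem_extChartAt_target (I := 𝓘(ℝ, E)) x)
  rw [ModelWithCorners.Boundaryless.range_eq_univ, mfderivWithin_univ] at h3
  have h4 : ∀ u : E, (mfderiv 𝓘(ℝ, E) 𝓘(ℝ, E) φ.symm (φ x) : E →L[ℝ] E) u = u := fun u ↦ by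
    have h := congrArg (fun L : E →L[ℝ] E ↦ L u) h3
    change (mfderiv 𝓘(ℝ, E) 𝓘(ℝ, E) φ (φ.symm (φ x)) : E →L[ℝ] E)
      ((mfderiv 𝓘(ℝ, E) 𝓘(ℝ, E) φ.symm (φ x) : E →L[ℝ] E) u) = u at h
    rwa [h2 _ hx] at h
  change (g.inner (φ.symm (φ x)) : E →L[ℝ] E →L[ℝ] ℝ)
    ((mfderiv 𝓘(ℝ, E) 𝓘(ℝ, E) φ.symm (φ x) : E →L[ℝ] E) v)
    ((mfderiv 𝓘(ℝ, E) 𝓘(ℝ, E) φ.symm (φ x) : E →L[ℝ] E) w) = _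
  rw [h1 _ hx, h4, h4]
  rfl

/-- Along a curve of generic points ending at `p`, both sides of the inequality converge in the
fixed chart at `p`. -/
theorem ricciGE_sphereMetric (hn : 2 ≤ n) (hm : 8 * (n - 1) ≤ m) {a : ℝ} (ha : 1 ≤ a) :
    RicciGE (sphereMetric m n a ha) 1 := by
  intro p (v : EuclideanSpace ℝ (Fin (m + n)))
  set G := coordMetric (sphereMetric m n a ha) p with hG
  set y := extChartAt (𝓡 (m + n)) p p with hy
  have hnear : IsMetricNear G y := isMetricNear_coordMetric p (mem_extChartAt_target p)
  obtain ⟨γ, hγ, h0, hev⟩ := exists_path_generic (m := m) (n := n) (by omega) p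
  have hγp : Filter.Tendsto γ (𝓝[>] 0) (𝓝 p) := (hγ.tendsto' 0 p h0).mono_left nhdsWithin_le_nhds
  have hlim : Filter.Tendsto (fun t ↦ extChartAt (𝓡 (m + n)) p (γ t)) (𝓝[>] 0) (𝓝 y) :=
    (continuousAt_extChartAt p).tendsto.comp hγp
  have hle : ∀ᶠ t in 𝓝[>] (0 : ℝ), G (extChartAt (𝓡 (m + n)) p (γ t)) v v ≤
      coordRicci G (extChartAt (𝓡 (m + n)) p (γ t)) v v := by
    filter_upwards [hev, hγp.eventually (extChartAt_source_mem_nhds (I := 𝓡 (m + n)) p)]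
      with t ht1 ht2
    have hl := (extChartAt (𝓡 (m + n)) p).left_inv ht2
    exact coordMetric_le_coordRicci hn hm ha p ((extChartAt _ p).map_source ht2)
      (by rw [hl]; exact ht1.1) (by rw [hl]; exact ht1.2) v
  have hcont : ContinuousAt (fun z ↦ G z v v) y :=
    (hnear.smooth.continuousAt.clm_apply continuousAt_const).clm_apply continuousAt_const
  have h := le_of_tendsto_of_tendsto (hcont.tendsto.comp hlim)
    ((hnear.continuousAt_coordRicci v v).tendsto.comp hlim) hle
  rw [one_mul]
  exact (coordMetric_self _ p v v).symm.trans_le h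

end RicciBound

end RicciLimit

theorem theoremA (n m : ℕ) (hn : 2 ≤ n) (hm : 8 * (n - 1) ≤ m) :
    ∃ g : ℝ → SmoothMetric (EuclideanSpace ℝ (Fin (m + n))) (Sphere (m + n)),
      (∀ lam : ℝ, 1 ≤ lam →
        IsDoublyWarpedProduct (warpF lam) (warpH lam) (g lam) ∧ RicciGE (g lam) 1) ∧
      ∃ (X : ℝ → GromovHausdorff.GHSpace) (Y : GromovHausdorff.GHSpace),
        (∀ lam : ℝ, 1 ≤ lam → IsRiemannianSpace (g lam) (X lam).Rep) ∧
        IsGrushinHemisphere n Y.Rep ∧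
        Filter.Tendsto X Filter.atTop (𝓝 Y) := by
  have hn0 : n ≠ 0 := by omega
  have hm2 : 2 ≤ m := by omega
  -- The maximum defines a metric for every real λ and equals λ² when λ ≥ 1.
  have ha : ∀ lam : ℝ, 1 ≤ max 1 (lam ^ 2) := fun lam ↦ le_max_left _ _
  refine ⟨fun lam ↦ sphereMetric m n (max 1 (lam ^ 2)) (ha lam), fun lam hlam ↦ ⟨?_, ?_⟩,
    fun lam ↦ GromovHausdorff.toGHSpace (SphereSpace hn0 hm2 (ha lam)),
    GromovHausdorff.toGHSpace (UniformSpace.Completion (GrushinSpace hn0)),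
    fun lam _ ↦ isRiemannianSpace_rep, isGrushinHemisphere_rep hn0,
    tendsto_toGHSpace_sphereSpace hn0 hm2 ha ?_⟩
  · have h : 1 ≤ lam ^ 2 := one_le_pow₀ hlam
    simp only [max_eq_right h]
    exact isDoublyWarpedProduct_sphereMetric hlam h
  · exact ricciGE_sphereMetric hn hm (ha lam)
  · exact Filter.tendsto_atTop_mono (fun lam ↦ le_max_right 1 (lam ^ 2))
      (Filter.tendsto_pow_atTop two_ne_zero)
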